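/- Notation: $|\cdot|$ is the Euclidean norm and $\mathrm{diam}$ the Euclidean diameter. For a nonempty finite set $A\subset\mathbb Z^d$ and $\beta>0$, the discrete Newtonian capacity is $$\mathrm{Cap}_\beta(A):=\Big(\inf_{\mu}\sum_{x,y\in A}\mu(x)\mu(y)\,(|x-y|\vee 1)^{-\beta}\Big)^{-1},$$ where the infimum is over all probability measures $\mu$ on $A$. Sums of sets are Minkowski sums. Theorem. Let $d,k\ge 1$ be integers and let $\alpha_1,\beta_1,\dots,\alpha_k,\beta_k\in(0,d)$ satisfy $\sum_i\alpha_i>(k-1)d$ and $\sum_i\beta_i>(k-1)d$. Put $\gamma:=\sum_i\alpha_i-(k-1)d$. For all constants $c,C>0$ there exist constants $c',C'>0$, depending only on $d,k,(\alpha_i),(\beta_i),c,C$, such that the following holds. Let $\mathcal R_1,\dots,\mathcal R_k$ be independent random subsets of $\mathbb Z^d$ such that for each $i$, every finite set $B\subset\mathbb Z^d$ containing the origin and every $x\in\mathbb Z^d\setminus\{0\}$ with $|x|\ge 2\,\mathrm{diam}(B)$, $$c\,|x|^{-\beta_i}\,\mathrm{Cap}_{\alpha_i}(B)\le \mathbb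 P\big(\mathcal R_i\cap(x+B)\ne\emptyset\big)\le C\,|x|^{-\beta_i}\,\mathrm{Cap}_{\alpha_i}(B).$$ Then for every finite set $A\subset\mathbb Z^d$ containing the origin and every $x\in\mathbb Z^d\setminus\{0\}$ with $$|x|\ge 2\,\mathrm{diam}(A)+\max_{1\le i\le k}\mathbf 1_{\alpha_i\le\beta_i}\,\mathrm{diam}(A)^{\frac{d-\alpha_i}{d-\beta_i}}\,\log^{\frac1{d-\beta_i}}(\mathrm{diam}(A)+1),$$ we have $$c'\,|x|^{(k-1)d-\sum_i\beta_i}\,\mathrm{Cap}_{\gamma}(A)\le \mathbb P\big((\mathcal R_1+\dots+\mathcal R_k)\cap(x+A)\ne\emptyset\big)\le C'\,|x|^{(k-1)d-\sum_i\beta_i}\,\mathrm{Cap}_{\gamma}(A).$$ -/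

import Mathlib

open MeasureTheory ProbabilityTheory
open scoped Pointwise

noncomputable section

/-- The inclusion of the lattice `ℤ^d` in the Euclidean space `ℝ^d`. -/
def latticeEmb {d : ℕ} (x : Fin d → ℤ) : EuclideanSpace ℝ (Fin d) :=
  WithLp.toLp 2 (fun i => (x i : ℝ))

/-- The Euclidean norm `|x|` of a lattice point. -/
def latticeNorm {d : ℕ} (x : Fin d → ℤ) : ℝ := ‖latticeEmb x‖

/-- The Euclidean diameter of a finite subset of `ℤ^d`. -/
def latticeDiam {d : ℕ} (A : Finset (Fin d → ℤ)) : ℝ :=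
  Metric.diam (latticeEmb '' (A : Set (Fin d → ℤ)))

/-- Weight functions that define a probability measure on the finite set `A`
(only their values on `A` matter). -/
def probWeights {d : ℕ} (A : Finset (Fin d → ℤ)) : Set ((Fin d → ℤ) → ℝ) :=
  {μ | (∀ x ∈ A, 0 ≤ μ x) ∧ ∑ x ∈ A, μ x = 1}

/-- The discrete energy `∑_{x,y ∈ A} μ(x) μ(y) (|x - y| ∨ 1)^{-β}`. -/
def rieszEnergy {d : ℕ} (β : ℝ) (A : Finset (Fin d → ℤ)) (μ : (Fin d → ℤ) → ℝ) : ℝ :=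
  ∑ x ∈ A, ∑ y ∈ A, μ x * μ y * (max (latticeNorm (x - y)) 1) ^ (-β)

/-- The discrete Newtonian capacity with parameter `β` of a finite subset of `ℤ^d`: the inverse
of the infimum of the energy over all probability measures on the set (for the empty set
this expression is `0`). -/
def newtonCap {d : ℕ} (β : ℝ) (A : Finset (Fin d → ℤ)) : ℝ :=
  (sInf (rieszEnergy β A '' probWeights A))⁻¹

/-- The probability that the random set `R` meets the translate `x + A`. -/
def hitProb {d : ℕ} {Ω : Type*} [MeasurableSpace Ω] (P : Measure Ω)
    (R : Ω → Set (Fin d → ℤ)) (x : Fin d → ℤ) (A : Finset (Fin d → ℤ)) : ℝ :=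
  P.real {ω | (R ω ∩ (x +ᵥ (A : Set (Fin d → ℤ)))).Nonempty}

/-- `c |x|^{-β} Cap_α(B) ≤ P(R ∩ (x + B) ≠ ∅) ≤ C |x|^{-β} Cap_α(B)` for every finite
`B ⊆ ℤ^d` containing the origin and every lattice point `x ≠ 0` with `|x| ≥ 2 diam(B)`. -/
def HasCapacityHitting {d : ℕ} {Ω : Type*} [MeasurableSpace Ω] (P : Measure Ω)
    (R : Ω → Set (Fin d → ℤ)) (α β c C : ℝ) : Prop :=
  ∀ (B : Finset (Fin d → ℤ)) (x : Fin d → ℤ), 0 ∈ B → x ≠ 0 →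
    2 * latticeDiam B ≤ latticeNorm x →
      c * (latticeNorm x ^ (-β) * newtonCap α B) ≤ hitProb P R x B ∧
        hitProb P R x B ≤ C * (latticeNorm x ^ (-β) * newtonCap α B)

end

/-! The hypothesis describes a random set only through its probability of hitting sets that are
small compared with their distance from the origin. This suffices because of a replacement
principle: once the other sets are fixed, the event that some y_i ∈ R_i satisfy y_1 + ... + y_k ∈ x
+ A says that the remaining set hits a certain K. Hence each R_i may be exchanged, one at a time,
for any independent model whose hitting probabilities compare with those of R_i up to a factor
(`measure_pi_exists_mem_le`). At distance 2^n from the origin R_i hits K with probability of order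
2^(-nβ_i) Cap_{α_i}(K), so against a model in a box of side of order 2^n with hitting probability of
order 2^(-nα_i) Cap_{α_i}(K) the factor is 2^(n(α_i-β_i)). Each direction of the theorem needs only
one inequality for the model, so two different models serve.

Upper bound. The model is a random set with deterministic lower bounds for its ball counts
(`exists_regular_randomSet`), which hits K at least as often as required, by a second moment. Fix
the dyadic levels of the summands and let R_j have the largest level, 2^J. The other sets are
replaced by regular sets S_i, and then R_j has to hit x + A - ∑ S_i. The ball counts bound the
capacity of this set for every realisation: a potential built from the equilibrium measure of A and
counting measures on the S_i is large on it, and the weak maximum principle applies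
(`newtonCap_le_of_potential`, `exists_newtonCap_sub_sum_le`). Summing over the smaller levels gives
a factor 2^(J(d-β_i)) for each i ≠ j. Levels below diam(A) are the expensive ones, and the lower
bound on |x| with its power and logarithm of the diameter controls them. The total is of order
2^(J((k-1)d-∑β_i)) Cap_γ(A), which is summable over 2^J of order at least |x| because ∑β_i > (k-1)d.

Lower bound. The model is fractal percolation, which hits K at most as often as required
(`exists_percolation_randomSet`): it carries a measure of mass equal to the hitting probability and
of energy comparable to that mass. The R_i are localised in balls around points z_i of norm of order
|x| with ∑ z_i = x, and replaced by percolation sets. A second moment over the solutions of ∑ y_i ∈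
x + A then works, since the two-point functions are Riesz kernels and the discrete Riesz composition
inequality (`exists_sum_prod_bracket_le`) contracts their product to the kernel of exponent γ. -/

/-! ### The Euclidean norm on the lattice and its truncation. -/

section LatticeNorm

variable {d : ℕ}

lemma latticeEmb_add (x y : Fin d → ℤ) : latticeEmb (x + y) = latticeEmb x + latticeEmb y := by
  ext i; simp [latticeEmb]

lemma latticeEmb_sub (x y : Fin d → ℤ) : latticeEmb (x - y) = latticeEmb x - latticeEmb y := by
  ext i; simp [latticeEmb]

lemma latticeNorm_nonneg (x : Fin d → ℤ) : 0 ≤ latticeNorm x := norm_nonneg _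

lemma latticeNorm_neg (x : Fin d → ℤ) : latticeNorm (-x) = latticeNorm x := by
  have : latticeEmb (-x) = -latticeEmb x := by ext i; simp [latticeEmb]
  rw [latticeNorm, this, norm_neg, latticeNorm]

lemma latticeNorm_zero : latticeNorm (0 : Fin d → ℤ) = 0 := by
  have : latticeEmb (0 : Fin d → ℤ) = 0 := by ext i; simp [latticeEmb]
  rw [latticeNorm, this, norm_zero]

lemma latticeNorm_add_le (x y : Fin d → ℤ) :
    latticeNorm (x + y) ≤ latticeNorm x + latticeNorm y := by
  simp only [latticeNorm, latticeEmb_add]; exact norm_add_le _ _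

lemma latticeNorm_sub_le (x y : Fin d → ℤ) :
    latticeNorm (x - y) ≤ latticeNorm x + latticeNorm y := by
  simp only [latticeNorm, latticeEmb_sub]; exact norm_sub_le _ _

lemma latticeNorm_sub_comm (x y : Fin d → ℤ) : latticeNorm (x - y) = latticeNorm (y - x) := by
  rw [← latticeNorm_neg, neg_sub]

lemma latticeNorm_sum_le {ι : Type*} (s : Finset ι) (f : ι → Fin d → ℤ) :
    latticeNorm (∑ i ∈ s, f i) ≤ ∑ i ∈ s, latticeNorm (f i) := by
  classical
  induction s using Finset.induction_on with
  | empty => simp [latticeNorm_zero]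
  | insert a s ha ih =>
    rw [Finset.sum_insert ha, Finset.sum_insert ha]
    exact (latticeNorm_add_le _ _).trans (by linarith)

lemma latticeNorm_smul (n : ℤ) (x : Fin d → ℤ) : latticeNorm (n • x) = |(n : ℝ)| * latticeNorm x := by
  have : latticeEmb (n • x) = (n : ℝ) • latticeEmb x := by ext i; simp [latticeEmb]
  rw [latticeNorm, this, norm_smul, latticeNorm, Real.norm_eq_abs]

lemma abs_le_latticeNorm (x : Fin d → ℤ) (i : Fin d) : |(x i : ℝ)| ≤ latticeNorm x := by
  have := PiLp.norm_apply_le (latticeEmb x) i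
  simpa [latticeEmb, latticeNorm] using this

lemma latticeNorm_le_of_abs_le {x : Fin d → ℤ} {M : ℝ} (hM : 0 ≤ M) (h : ∀ i, |(x i : ℝ)| ≤ M) :
    latticeNorm x ≤ Real.sqrt d * M := by
  rw [latticeNorm, EuclideanSpace.norm_eq]
  have : ∑ i, ‖latticeEmb x i‖ ^ 2 ≤ d * M ^ 2 := by
    calc ∑ i, ‖latticeEmb x i‖ ^ 2 ≤ ∑ i : Fin d, M ^ 2 := by
          refine Finset.sum_le_sum fun i _ => ?_
          have : ‖latticeEmb x i‖ ≤ M := by simpa [latticeEmb] using h i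
          gcongr
      _ = d * M ^ 2 := by simp
  calc Real.sqrt (∑ i, ‖latticeEmb x i‖ ^ 2) ≤ Real.sqrt (d * M ^ 2) := Real.sqrt_le_sqrt this
    _ = Real.sqrt d * M := by rw [Real.sqrt_mul (by positivity), Real.sqrt_sq hM]

lemma one_le_latticeNorm {x : Fin d → ℤ} (hx : x ≠ 0) : 1 ≤ latticeNorm x := by
  obtain ⟨i, hi⟩ := Function.ne_iff.1 hx
  refine le_trans ?_ (abs_le_latticeNorm x i)
  have : (1 : ℤ) ≤ |x i| := Int.one_le_abs hi
  exact_mod_cast this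

lemma latticeNorm_sub_le_diam {A : Finset (Fin d → ℤ)} {x y : Fin d → ℤ} (hx : x ∈ A)
    (hy : y ∈ A) : latticeNorm (x - y) ≤ latticeDiam A := by
  rw [latticeNorm, latticeEmb_sub, ← dist_eq_norm]
  exact Metric.dist_le_diam_of_mem ((A.finite_toSet.image _).isBounded)
    (Set.mem_image_of_mem _ hx) (Set.mem_image_of_mem _ hy)

lemma latticeDiam_nonneg (A : Finset (Fin d → ℤ)) : 0 ≤ latticeDiam A := Metric.diam_nonneg

lemma latticeDiam_le {A : Finset (Fin d → ℤ)} {r : ℝ} (hr : 0 ≤ r)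
    (h : ∀ x ∈ A, ∀ y ∈ A, latticeNorm (x - y) ≤ r) : latticeDiam A ≤ r := by
  refine Metric.diam_le_of_forall_dist_le hr ?_
  rintro _ ⟨x, hx, rfl⟩ _ ⟨y, hy, rfl⟩
  rw [dist_eq_norm, ← latticeEmb_sub]
  exact h x hx y hy

/-- The truncated norm `|x| ∨ 1`. -/
noncomputable def bracket (x : Fin d → ℤ) : ℝ := max (latticeNorm x) 1

lemma one_le_bracket (x : Fin d → ℤ) : 1 ≤ bracket x := le_max_right _ _

lemma bracket_pos (x : Fin d → ℤ) : 0 < bracket x := lt_of_lt_of_le one_pos (one_le_bracket x)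

lemma latticeNorm_le_bracket (x : Fin d → ℤ) : latticeNorm x ≤ bracket x := le_max_left _ _

lemma bracket_zero : bracket (0 : Fin d → ℤ) = 1 := by simp [bracket, latticeNorm_zero]

lemma bracket_sub_comm (x y : Fin d → ℤ) : bracket (x - y) = bracket (y - x) := by
  rw [bracket, latticeNorm_sub_comm, bracket]

lemma bracket_le_of_abs_le {x : Fin d → ℤ} {M : ℝ} (hM : 1 ≤ M) (h : ∀ i, |(x i : ℝ)| ≤ M) :
    bracket x ≤ (Real.sqrt d + 1) * M := by
  have h1 := latticeNorm_le_of_abs_le (by linarith) h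
  refine max_le (by nlinarith) ?_
  have := Real.sqrt_nonneg (d : ℝ)
  nlinarith

lemma bracket_rpow_nonneg (x : Fin d → ℤ) (a : ℝ) : 0 ≤ bracket x ^ a :=
  Real.rpow_nonneg (bracket_pos x).le _

lemma bracket_rpow_pos (x : Fin d → ℤ) (a : ℝ) : 0 < bracket x ^ a :=
  Real.rpow_pos_of_pos (bracket_pos x) _

end LatticeNorm

/-! ### Energy, equilibrium measures and capacity. -/

section Capacity

variable {d : ℕ}

lemma rieszEnergy_eq (β : ℝ) (A : Finset (Fin d → ℤ)) (μ : (Fin d → ℤ) → ℝ) :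
    rieszEnergy β A μ = ∑ x ∈ A, ∑ y ∈ A, μ x * μ y * bracket (x - y) ^ (-β) := rfl

lemma rieszEnergy_nonneg {β : ℝ} {A : Finset (Fin d → ℤ)} {μ : (Fin d → ℤ) → ℝ}
    (h : ∀ x ∈ A, 0 ≤ μ x) : 0 ≤ rieszEnergy β A μ := by
  rw [rieszEnergy_eq]
  exact Finset.sum_nonneg fun x hx => Finset.sum_nonneg fun y hy =>
    mul_nonneg (mul_nonneg (h x hx) (h y hy)) (bracket_rpow_nonneg _ _)

lemma probWeights_nonempty {A : Finset (Fin d → ℤ)} (hA : A.Nonempty) :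
    (probWeights A).Nonempty := by
  classical
  obtain ⟨a, ha⟩ := hA
  refine ⟨Pi.single a 1, fun x _ => ?_, ?_⟩
  · by_cases h : x = a
    · subst h; simp
    · simp [h]
  · rw [Finset.sum_eq_single_of_mem a ha fun b _ hb => by simp [hb]]; simp

lemma newtonCap_nonneg (β : ℝ) (A : Finset (Fin d → ℤ)) : 0 ≤ newtonCap β A := by
  refine inv_nonneg.2 (Real.sInf_nonneg ?_)
  rintro _ ⟨μ, hμ, rfl⟩
  exact rieszEnergy_nonneg hμ.1

lemma newtonCap_empty (β : ℝ) : newtonCap β (∅ : Finset (Fin d → ℤ)) = 0 := by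
  have : probWeights (∅ : Finset (Fin d → ℤ)) = ∅ := by
    ext μ; simp [probWeights]
  simp [newtonCap, this]

/-- The Riesz potential of the weights `ν` on `A`. -/
noncomputable def rieszPotential (β : ℝ) (A : Finset (Fin d → ℤ)) (ν : (Fin d → ℤ) → ℝ)
    (x : Fin d → ℤ) : ℝ :=
  ∑ y ∈ A, ν y * bracket (x - y) ^ (-β)

lemma rieszEnergy_eq_sum_potential (β : ℝ) (A : Finset (Fin d → ℤ)) (μ : (Fin d → ℤ) → ℝ) :
    rieszEnergy β A μ = ∑ x ∈ A, μ x * rieszPotential β A μ x := by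
  rw [rieszEnergy_eq]
  refine Finset.sum_congr rfl fun x _ => ?_
  rw [rieszPotential, Finset.mul_sum]
  exact Finset.sum_congr rfl fun y _ => by ring

lemma newtonCap_le_of_forall {β b : ℝ} {A : Finset (Fin d → ℤ)} (hb : 0 ≤ b)
    (h : ∀ μ ∈ probWeights A, 1 ≤ b * rieszEnergy β A μ) : newtonCap β A ≤ b := by
  rcases A.eq_empty_or_nonempty with rfl | hA
  · rwa [newtonCap_empty]
  have hne := (probWeights_nonempty hA).image (rieszEnergy β A)
  have hb' : 0 < b := by
    rcases hb.eq_or_lt with rfl | hb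
    · obtain ⟨μ, hμ⟩ := probWeights_nonempty hA
      have := h μ hμ
      norm_num at this
    · exact hb
  have : b⁻¹ ≤ sInf (rieszEnergy β A '' probWeights A) := by
    refine le_csInf hne ?_
    rintro _ ⟨μ, hμ, rfl⟩
    rw [inv_le_iff_one_le_mul₀' hb']
    exact h μ hμ
  calc newtonCap β A ≤ (b⁻¹)⁻¹ := inv_anti₀ (by positivity) this
    _ = b := inv_inv b

/-- Existence of the equilibrium measure of a nonempty finite set. -/
lemma exists_equilibrium {β : ℝ} {A : Finset (Fin d → ℤ)} (hA : A.Nonempty) :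
    ∃ ν ∈ probWeights A, ∃ I : ℝ, 0 < I ∧ newtonCap β A = I⁻¹ ∧
      (∀ μ ∈ probWeights A, I ≤ rieszEnergy β A μ) ∧
      (∀ x ∈ A, I ≤ rieszPotential β A ν x) ∧
      (∀ x ∈ A, 0 < ν x → rieszPotential β A ν x = I) := by
  classical
  -- Only values on A matter, so the minimisation runs over weights vanishing off A. These form a
  -- compact set in the product topology, and every probability weight truncates into it.
  set S : Set ((Fin d → ℤ) → ℝ) := {f | (∀ x, f x ∈ if x ∈ A then Set.Icc (0 : ℝ) 1 else {0}) ∧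
    ∑ x ∈ A, f x = 1} with hS
  have hScomp : IsCompact S := by
    have h1 : IsCompact (Set.univ.pi fun x : Fin d → ℤ =>
        if x ∈ A then Set.Icc (0 : ℝ) 1 else {0}) := by
      refine isCompact_univ_pi fun x => ?_
      split_ifs
      · exact isCompact_Icc
      · exact isCompact_singleton
    have h2 : IsClosed {f : (Fin d → ℤ) → ℝ | ∑ x ∈ A, f x = 1} :=
      isClosed_eq (by fun_prop) continuous_const
    convert h1.inter_right h2 using 1
    ext f
    simp [hS, Set.mem_pi]
  have hSsub : S ⊆ probWeights A := by
    rintro f ⟨h1, h2⟩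
    refine ⟨fun x hx => ?_, h2⟩
    have := h1 x
    rw [if_pos hx] at this
    exact this.1
  have htrunc : ∀ μ ∈ probWeights A, ∃ f ∈ S, ∀ x ∈ A, f x = μ x := by
    intro μ hμ
    refine ⟨fun x => if x ∈ A then μ x else 0, ⟨fun x => ?_, ?_⟩, fun x hx => if_pos hx⟩
    · by_cases hx : x ∈ A
      · simp only [if_pos hx]
        refine ⟨hμ.1 x hx, ?_⟩
        rw [← hμ.2]
        exact Finset.single_le_sum (f := μ) (fun y hy => hμ.1 y hy) hx
      · simp [hx]
    · rw [← hμ.2]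
      exact Finset.sum_congr rfl fun x hx => if_pos hx
  have hSne : S.Nonempty := by
    obtain ⟨μ, hμ⟩ := probWeights_nonempty hA
    obtain ⟨f, hf, _⟩ := htrunc μ hμ
    exact ⟨f, hf⟩
  have hcont : ContinuousOn (rieszEnergy β A) S := by
    apply Continuous.continuousOn
    unfold rieszEnergy
    fun_prop
  obtain ⟨ν, hνS, hmin⟩ := hScomp.exists_isMinOn hSne hcont
  have hν := hSsub hνS
  set I := rieszEnergy β A ν with hI
  have hmin' : ∀ μ ∈ probWeights A, I ≤ rieszEnergy β A μ := by
    intro μ hμ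
    obtain ⟨f, hf, hfμ⟩ := htrunc μ hμ
    have h1 : I ≤ rieszEnergy β A f := hmin hf
    have h2 : rieszEnergy β A f = rieszEnergy β A μ := by
      unfold rieszEnergy
      refine Finset.sum_congr rfl fun x hx => Finset.sum_congr rfl fun y hy => ?_
      rw [hfμ x hx, hfμ y hy]
    rwa [h2] at h1
  have hexpos : ∃ x ∈ A, 0 < ν x := by
    by_contra hcon
    push Not at hcon
    have : ∑ x ∈ A, ν x ≤ 0 := Finset.sum_nonpos hcon
    linarith [hν.2]
  have hIpos : 0 < I := by
    obtain ⟨x, hx, hx0⟩ := hexpos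
    have hnn : ∀ a ∈ A, ∀ b ∈ A, 0 ≤ ν a * ν b * bracket (a - b) ^ (-β) := fun a ha b hb =>
      mul_nonneg (mul_nonneg (hν.1 a ha) (hν.1 b hb)) (bracket_rpow_nonneg _ _)
    calc 0 < ν x * ν x * bracket (x - x) ^ (-β) :=
          mul_pos (mul_pos hx0 hx0) (bracket_rpow_pos _ _)
      _ ≤ ∑ y ∈ A, ν x * ν y * bracket (x - y) ^ (-β) :=
          Finset.single_le_sum (f := fun y => ν x * ν y * bracket (x - y) ^ (-β))
            (fun y hy => hnn x hx y hy) hx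
      _ ≤ I := by
          rw [hI, rieszEnergy_eq]
          exact Finset.single_le_sum (f := fun a => ∑ y ∈ A, ν a * ν y * bracket (a - y) ^ (-β))
            (fun a ha => Finset.sum_nonneg fun y hy => hnn a ha y hy) hx
  have hcap : newtonCap β A = I⁻¹ := by
    unfold newtonCap
    congr 1
    refine IsLeast.csInf_eq ⟨⟨ν, hν, rfl⟩, ?_⟩
    rintro _ ⟨μ, hμ, rfl⟩
    exact hmin' μ hμ
  -- First variation: moving a fraction t of the mass of ν to the point x cannot lower the energy,
  -- so the derivative 2 (P - I) at t = 0 is nonnegative.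
  have hpot : ∀ x ∈ A, I ≤ rieszPotential β A ν x := by
    intro x hx
    set P := rieszPotential β A ν x with hP
    set g := bracket (x - x) ^ (-β) with hg
    have key : ∀ t : ℝ, 0 ≤ t → t ≤ 1 →
        I ≤ (1 - t) ^ 2 * I + 2 * t * (1 - t) * P + t ^ 2 * g := by
      intro t ht0 ht1
      set δ : (Fin d → ℤ) → ℝ := Pi.single x 1 with hδ
      have hδ0 : ∀ y, 0 ≤ δ y := by
        intro y
        by_cases h : y = x
        · subst h; simp [hδ]
        · simp [hδ, h]
      have hδs : ∀ f : (Fin d → ℤ) → ℝ, ∑ y ∈ A, δ y * f y = f x := by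
        intro f
        rw [Finset.sum_eq_single x]
        · simp [hδ]
        · intro b _ hb; simp [hδ, hb]
        · exact fun h => absurd hx h
      have hmem : (fun y => (1 - t) * ν y + t * δ y) ∈ probWeights A := by
        refine ⟨fun y hy => ?_, ?_⟩
        · have := hν.1 y hy
          have := hδ0 y
          have : 0 ≤ 1 - t := by linarith
          positivity
        · rw [Finset.sum_add_distrib, ← Finset.mul_sum, ← Finset.mul_sum, hν.2]
          have := hδs fun _ => 1
          simp only [mul_one] at this
          rw [this]; ring
      have h1 := hmin' _ hmem
      refine h1.trans (le_of_eq ?_)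
      have e1 : rieszEnergy β A (fun y => (1 - t) * ν y + t * δ y) =
          (1 - t) ^ 2 * I + (1 - t) * t * (∑ a ∈ A, ∑ b ∈ A, ν a * δ b * bracket (a - b) ^ (-β))
          + (1 - t) * t * (∑ a ∈ A, ∑ b ∈ A, δ a * ν b * bracket (a - b) ^ (-β))
          + t ^ 2 * (∑ a ∈ A, ∑ b ∈ A, δ a * δ b * bracket (a - b) ^ (-β)) := by
        rw [hI, rieszEnergy_eq, rieszEnergy_eq]
        simp only [Finset.mul_sum]
        simp only [← Finset.sum_add_distrib]
        refine Finset.sum_congr rfl fun a _ => Finset.sum_congr rfl fun b _ => ?_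
        ring
      have e2 : ∑ a ∈ A, ∑ b ∈ A, δ a * ν b * bracket (a - b) ^ (-β) = P := by
        rw [hP, rieszPotential, ← hδs fun x => ∑ y ∈ A, ν y * bracket (x - y) ^ (-β)]
        refine Finset.sum_congr rfl fun a _ => ?_
        rw [Finset.mul_sum]
        exact Finset.sum_congr rfl fun b _ => by ring
      have e3 : ∑ a ∈ A, ∑ b ∈ A, ν a * δ b * bracket (a - b) ^ (-β) = P := by
        rw [Finset.sum_comm, ← e2]
        refine Finset.sum_congr rfl fun a _ => Finset.sum_congr rfl fun b _ => ?_
        rw [bracket_sub_comm]; ring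
      have e4 : ∑ a ∈ A, ∑ b ∈ A, δ a * δ b * bracket (a - b) ^ (-β) = g := by
        have := hδs fun a => ∑ b ∈ A, δ b * bracket (a - b) ^ (-β)
        rw [hδs fun b => bracket (x - b) ^ (-β)] at this
        rw [hg, ← this]
        refine Finset.sum_congr rfl fun a _ => ?_
        rw [Finset.mul_sum]
        exact Finset.sum_congr rfl fun b _ => by ring
      rw [e1, e2, e3, e4]; ring
    by_contra hcon
    push Not at hcon
    have hgnn : 0 ≤ g := bracket_rpow_nonneg _ _
    have hPnn : 0 ≤ P := Finset.sum_nonneg fun y hy =>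
      mul_nonneg (hν.1 y hy) (bracket_rpow_nonneg _ _)
    have hden : 0 < I + g + 1 := by linarith
    -- If P < I, this t is so small that the quadratic term is at most half the linear gain 2 t (I -
    -- P), which contradicts minimality.
    have ht : (I - P) / (I + g + 1) ≤ 1 := by
      rw [div_le_one hden]; linarith
    have ht0 : 0 < (I - P) / (I + g + 1) := div_pos (by linarith) hden
    have h1 := key _ ht0.le ht
    set t := (I - P) / (I + g + 1) with htdef
    have h2 : t * (I + g + 1) = I - P := div_mul_cancel₀ _ hden.ne'
    have h3 : 0 ≤ t * (-2 * (I - P) + t * (I - 2 * P + g)) := by nlinarith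
    have h4 : 0 ≤ -2 * (I - P) + t * (I - 2 * P + g) := by
      by_contra h; push Not at h; nlinarith
    nlinarith
  refine ⟨ν, hν, I, hIpos, hcap, hmin', hpot, fun x hx hx0 => ?_⟩
  -- The ν-average of the potential is the energy I, so a potential that is at least I on A equals I
  -- wherever ν charges.
  have hsum : ∑ y ∈ A, ν y * (rieszPotential β A ν y - I) = 0 := by
    simp only [mul_sub, Finset.sum_sub_distrib, ← Finset.sum_mul, hν.2]
    rw [← rieszEnergy_eq_sum_potential]; ring
  have h0 := (Finset.sum_eq_zero_iff_of_nonneg fun y hy =>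
    mul_nonneg (hν.1 y hy) (sub_nonneg.2 (hpot y hy))).1 hsum x hx
  rcases mul_eq_zero.1 h0 with h | h
  · exact absurd h hx0.ne'
  · linarith

lemma newtonCap_pos {β : ℝ} {A : Finset (Fin d → ℤ)} (hA : A.Nonempty) : 0 < newtonCap β A := by
  obtain ⟨ν, -, I, hI, h, -⟩ := exists_equilibrium (β := β) hA
  rw [h]; positivity

/-- A measure on `A` whose energy is at most `b` times its mass bounds the capacity from below. -/
lemma le_newtonCap_of_energy_le {β b h : ℝ} {A : Finset (Fin d → ℤ)} {ν : (Fin d → ℤ) → ℝ}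
    (hb : 0 ≤ b) (hν : ∀ x ∈ A, 0 ≤ ν x) (hsum : ∑ x ∈ A, ν x = h) (hE : rieszEnergy β A ν ≤ b * h) :
    h ≤ b * newtonCap β A := by
  have hh : 0 ≤ h := hsum ▸ Finset.sum_nonneg hν
  have hEnn := rieszEnergy_nonneg (β := β) hν
  rcases hh.eq_or_lt with h0 | hpos
  · rw [← h0]
    exact mul_nonneg hb (newtonCap_nonneg _ _)
  have hA : A.Nonempty := by
    by_contra hA
    rw [Finset.not_nonempty_iff_eq_empty] at hA
    subst hA
    simp at hsum; linarith
  obtain ⟨-, -, I, hI, hcap, hmin, -⟩ := exists_equilibrium (β := β) hA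
  have hmem : (fun x => h⁻¹ * ν x) ∈ probWeights A := by
    refine ⟨fun x hx => mul_nonneg (by positivity) (hν x hx), ?_⟩
    rw [← Finset.mul_sum, hsum]; field_simp
  have h1 := hmin _ hmem
  have h2 : rieszEnergy β A (fun x => h⁻¹ * ν x) = h⁻¹ ^ 2 * rieszEnergy β A ν := by
    unfold rieszEnergy
    simp only [Finset.mul_sum]
    exact Finset.sum_congr rfl fun x _ => Finset.sum_congr rfl fun y _ => by ring
  rw [h2] at h1
  have h3 : I * h ≤ b := by
    have : I * h ^ 2 ≤ b * h := by
      calc I * h ^ 2 ≤ (h⁻¹ ^ 2 * rieszEnergy β A ν) * h ^ 2 := by gcongr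
        _ = rieszEnergy β A ν := by field_simp
        _ ≤ b * h := hE
    nlinarith
  rw [hcap]
  rw [← div_eq_mul_inv, le_div_iff₀ hI]
  linarith

/-- The weak maximum principle, in the form of an upper bound for the capacity by the mass of
any measure with large potential on the set. -/
lemma newtonCap_le_of_potential {β b : ℝ} (hβ : 0 ≤ β) (hb : 0 ≤ b) {A : Finset (Fin d → ℤ)}
    {ι : Type*} (s : Finset ι) (m : ι → ℝ) (z : ι → Fin d → ℤ) (hm : ∀ j ∈ s, 0 ≤ m j)
    (h : ∀ y ∈ A, 1 ≤ b * ∑ j ∈ s, m j * bracket (y - z j) ^ (-β)) :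
    newtonCap β A ≤ 2 ^ β * b * ∑ j ∈ s, m j := by
  have hms : 0 ≤ ∑ j ∈ s, m j := Finset.sum_nonneg hm
  rcases A.eq_empty_or_nonempty with rfl | hA
  · rw [newtonCap_empty]; positivity
  obtain ⟨ν, hν, I, hI, hcap, -, -, hpot⟩ := exists_equilibrium (β := β) hA
  -- For the point x' of the support of ν nearest to z, every y in the support satisfies |x' - y| ≤
  -- 2 |z - y|. The potential at z is thus at most 2^β times the one at x', which is I.
  have hmax : ∀ z, rieszPotential β A ν z ≤ 2 ^ β * I := by
    intro z
    have hne : (A.filter fun x => 0 < ν x).Nonempty := by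
      by_contra hcon
      rw [Finset.not_nonempty_iff_eq_empty, Finset.filter_eq_empty_iff] at hcon
      push Not at hcon
      have : ∑ x ∈ A, ν x ≤ 0 := Finset.sum_nonpos fun x hx => hcon hx
      linarith [hν.2]
    obtain ⟨x', hx', hnear⟩ := Finset.exists_min_image _ (fun x => latticeNorm (z - x)) hne
    rw [Finset.mem_filter] at hx'
    rw [← hpot x' hx'.1 hx'.2, rieszPotential, rieszPotential, Finset.mul_sum]
    refine Finset.sum_le_sum fun y hy => ?_
    rcases (hν.1 y hy).eq_or_lt with h0 | hpos
    · rw [← h0]; simp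
    have h1 : latticeNorm (x' - y) ≤ 2 * latticeNorm (z - y) := by
      have h2 := hnear y (Finset.mem_filter.2 ⟨hy, hpos⟩)
      have h3 : x' - y = (z - y) - (z - x') := by abel
      have h4 := latticeNorm_sub_le (z - y) (z - x')
      rw [← h3] at h4
      linarith
    have h2 : bracket (x' - y) ≤ 2 * bracket (z - y) :=
      max_le (h1.trans (by linarith [latticeNorm_le_bracket (z - y)]))
        (by linarith [one_le_bracket (z - y)])
    have h3 : bracket (z - y) ^ (-β) ≤ 2 ^ β * bracket (x' - y) ^ (-β) := by
      have h4 : (2 * bracket (z - y)) ^ (-β) ≤ bracket (x' - y) ^ (-β) :=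
        Real.rpow_le_rpow_of_nonpos (bracket_pos _) h2 (by linarith)
      rw [Real.mul_rpow (by norm_num) (bracket_pos _).le] at h4
      calc bracket (z - y) ^ (-β) = 2 ^ β * (2 ^ (-β) * bracket (z - y) ^ (-β)) := by
            rw [← mul_assoc, ← Real.rpow_add (by norm_num)]; simp
        _ ≤ _ := by gcongr
    calc ν y * bracket (z - y) ^ (-β) ≤ ν y * (2 ^ β * bracket (x' - y) ^ (-β)) := by gcongr
      _ = _ := by ring
  -- Integrate the lower bound on the potential of m against ν and exchange the order: this leaves
  -- the potential of ν at the points z j.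
  have h1 : (1 : ℝ) ≤ b * ∑ j ∈ s, m j * (2 ^ β * I) := by
    calc (1 : ℝ) = ∑ y ∈ A, ν y * 1 := by simp [hν.2]
      _ ≤ ∑ y ∈ A, ν y * (b * ∑ j ∈ s, m j * bracket (y - z j) ^ (-β)) :=
          Finset.sum_le_sum fun y hy => mul_le_mul_of_nonneg_left (h y hy) (hν.1 y hy)
      _ = b * ∑ j ∈ s, m j * rieszPotential β A ν (z j) := by
          simp only [rieszPotential, Finset.mul_sum]
          rw [Finset.sum_comm]
          refine Finset.sum_congr rfl fun j _ => Finset.sum_congr rfl fun y _ => ?_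
          rw [bracket_sub_comm]; ring
      _ ≤ _ := by
          gcongr with j hj
          · exact hm j hj
          · exact hmax _
  rw [← Finset.sum_mul] at h1
  rw [hcap, inv_le_iff_one_le_mul₀' hI]
  calc (1 : ℝ) ≤ _ := h1
    _ = _ := by ring

lemma newtonCap_image_add_le (β : ℝ) (A : Finset (Fin d → ℤ)) (v : Fin d → ℤ) :
    newtonCap β (A.image (v + ·)) ≤ newtonCap β A := by
  rcases A.eq_empty_or_nonempty with rfl | hA
  · simp
  obtain ⟨-, -, I, hI, hcap, hmin, -⟩ := exists_equilibrium (β := β) hA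
  refine newtonCap_le_of_forall (newtonCap_nonneg _ _) fun μ hμ => ?_
  have hinj : Set.InjOn (v + ·) (A : Set (Fin d → ℤ)) := (add_right_injective v).injOn
  have hmem : (fun x => μ (v + x)) ∈ probWeights A := by
    refine ⟨fun x hx => hμ.1 _ (Finset.mem_image_of_mem _ hx), ?_⟩
    rw [← hμ.2, Finset.sum_image hinj]
  have h1 := hmin _ hmem
  have h2 : rieszEnergy β (A.image (v + ·)) μ = rieszEnergy β A (fun x => μ (v + x)) := by
    unfold rieszEnergy
    rw [Finset.sum_image hinj]
    refine Finset.sum_congr rfl fun x _ => ?_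
    rw [Finset.sum_image hinj]
    refine Finset.sum_congr rfl fun y _ => ?_
    rw [add_sub_add_left_eq_sub]
  rw [h2, hcap, ← inv_mul_cancel₀ hI.ne']
  gcongr

lemma newtonCap_image_add (β : ℝ) (A : Finset (Fin d → ℤ)) (v : Fin d → ℤ) :
    newtonCap β (A.image (v + ·)) = newtonCap β A := by
  refine le_antisymm (newtonCap_image_add_le β A v) ?_
  have := newtonCap_image_add_le β (A.image (v + ·)) (-v)
  rw [Finset.image_image] at this
  simpa [Function.comp_def] using this

end Capacity

/-! ### Geometric sums of powers of two. -/

section GeometricSums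

lemma sum_range_pow_le {r : ℝ} (hr : 1 < r) (N : ℕ) :
    ∑ n ∈ Finset.range (N + 1), r ^ n ≤ r / (r - 1) * r ^ N := by
  rw [geom_sum_eq hr.ne', pow_succ, div_mul_eq_mul_div]
  have : 0 < r - 1 := by linarith
  gcongr
  linarith

lemma two_rpow_mul_nat (a : ℝ) (n : ℕ) : ((2 : ℝ) ^ n) ^ a = ((2 : ℝ) ^ a) ^ n := by
  rw [← Real.rpow_natCast, ← Real.rpow_natCast, ← Real.rpow_mul (by norm_num),
    ← Real.rpow_mul (by norm_num), mul_comm]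

end GeometricSums

/-! ### Sums of Riesz kernels over dyadic annuli and the Riesz composition inequality. -/

section RieszConvolution

variable {d : ℕ}

/-- The dyadic level of a lattice point: `2^n ≤ |w| ∨ 1 < 2^(n+1)`. -/
noncomputable def dyadicLevel (w : Fin d → ℤ) : ℕ := Nat.log 2 ⌊bracket w⌋₊

lemma two_pow_log_floor_le {s : ℝ} (hs : 1 ≤ s) : (2 : ℝ) ^ Nat.log 2 ⌊s⌋₊ ≤ s := by
  have h1 : 2 ^ Nat.log 2 ⌊s⌋₊ ≤ ⌊s⌋₊ := Nat.pow_log_le_self 2 (Nat.floor_pos.2 hs).ne'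
  calc (2 : ℝ) ^ Nat.log 2 ⌊s⌋₊ = ((2 ^ Nat.log 2 ⌊s⌋₊ : ℕ) : ℝ) := by push_cast; rfl
    _ ≤ (⌊s⌋₊ : ℝ) := by exact_mod_cast h1
    _ ≤ s := Nat.floor_le (by linarith)

lemma lt_two_pow_log_floor (s : ℝ) : s < (2 : ℝ) ^ (Nat.log 2 ⌊s⌋₊ + 1) := by
  have h1 : ⌊s⌋₊ < 2 ^ (Nat.log 2 ⌊s⌋₊ + 1) := Nat.lt_pow_succ_log_self one_lt_two _
  have h2 : (⌊s⌋₊ : ℝ) + 1 ≤ (2 : ℝ) ^ (Nat.log 2 ⌊s⌋₊ + 1) := by exact_mod_cast h1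
  exact lt_of_lt_of_le (Nat.lt_floor_add_one s) h2

lemma two_pow_dyadicLevel_le (w : Fin d → ℤ) : (2 : ℝ) ^ dyadicLevel w ≤ bracket w :=
  two_pow_log_floor_le (one_le_bracket w)

lemma bracket_lt_two_pow (w : Fin d → ℤ) : bracket w < (2 : ℝ) ^ (dyadicLevel w + 1) :=
  lt_two_pow_log_floor _

lemma card_dyadicLevel_le (F : Finset (Fin d → ℤ)) (n : ℕ) :
    ((F.filter fun w => dyadicLevel w = n).card : ℝ) ≤ 5 ^ d * ((2 : ℝ) ^ n) ^ (d : ℝ) := by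
  have hsub : (F.filter fun w => dyadicLevel w = n) ⊆
      Fintype.piFinset fun _ : Fin d => Finset.Icc (-(2 : ℤ) ^ (n + 1)) (2 ^ (n + 1)) := by
    intro w hw
    rw [Finset.mem_filter] at hw
    rw [Fintype.mem_piFinset]
    intro i
    have h1 := (abs_le_latticeNorm w i).trans ((latticeNorm_le_bracket w).trans
      (bracket_lt_two_pow w).le)
    rw [hw.2] at h1
    have h2 : |w i| ≤ 2 ^ (n + 1) := by exact_mod_cast h1
    exact Finset.mem_Icc.2 (abs_le.1 h2)
  have h1 := Finset.card_le_card hsub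
  rw [Fintype.card_piFinset] at h1
  simp only [Int.card_Icc, Finset.prod_const, Finset.card_univ, Fintype.card_fin] at h1
  have h2 : ((2 : ℤ) ^ (n + 1) + 1 - -2 ^ (n + 1)).toNat ≤ 5 * 2 ^ n := by
    have : (1 : ℤ) ≤ 2 ^ n := one_le_pow₀ (by norm_num)
    rw [Int.toNat_le]
    push_cast
    rw [pow_succ]
    linarith
  have h3 : (F.filter fun w => dyadicLevel w = n).card ≤ (5 * 2 ^ n) ^ d :=
    h1.trans (Nat.pow_le_pow_left h2 d)
  rw [Real.rpow_natCast, ← mul_pow]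
  exact_mod_cast h3

/-- Level n has at most of order 2^(nd) points, each contributing at most 2^(-na). -/
lemma sum_dyadicLevel_le (F : Finset (Fin d → ℤ)) (T : Finset ℕ) (hT : ∀ w ∈ F, dyadicLevel w ∈ T)
    (a : ℝ) (ha : 0 ≤ a) :
    ∑ w ∈ F, bracket w ^ (-a) ≤ 5 ^ d * ∑ n ∈ T, ((2 : ℝ) ^ ((d : ℝ) - a)) ^ n := by
  calc ∑ w ∈ F, bracket w ^ (-a) ≤ ∑ w ∈ F, ((2 : ℝ) ^ dyadicLevel w) ^ (-a) :=
        Finset.sum_le_sum fun w _ => Real.rpow_le_rpow_of_nonpos (by positivity)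
          (two_pow_dyadicLevel_le w) (by linarith)
    _ = ∑ n ∈ T, ∑ w ∈ F with dyadicLevel w = n, ((2 : ℝ) ^ dyadicLevel w) ^ (-a) :=
        (Finset.sum_fiberwise_of_maps_to hT _).symm
    _ = ∑ n ∈ T, ((F.filter fun w => dyadicLevel w = n).card : ℝ) * ((2 : ℝ) ^ n) ^ (-a) := by
        refine Finset.sum_congr rfl fun n _ => ?_
        rw [← nsmul_eq_mul]
        refine Finset.sum_eq_card_nsmul fun w hw => ?_
        rw [(Finset.mem_filter.1 hw).2]
    _ ≤ ∑ n ∈ T, 5 ^ d * ((2 : ℝ) ^ n) ^ (d : ℝ) * ((2 : ℝ) ^ n) ^ (-a) := by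
        gcongr with n _
        exact card_dyadicLevel_le F n
    _ = _ := by
        rw [Finset.mul_sum]
        refine Finset.sum_congr rfl fun n _ => ?_
        rw [mul_assoc, ← Real.rpow_add (by positivity), ← sub_eq_add_neg, two_rpow_mul_nat]

/-- The levels form a geometric series of ratio larger than 1, so the largest scale, of order s,
dominates. -/
lemma exists_sum_bracket_near_le (d : ℕ) (a : ℝ) (ha : 0 ≤ a) (had : a < d) :
    ∃ C : ℝ, 0 < C ∧ ∀ (F : Finset (Fin d → ℤ)) (s : ℝ), 0 < s → (∀ w ∈ F, bracket w ≤ s) →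
      ∑ w ∈ F, bracket w ^ (-a) ≤ C * s ^ ((d : ℝ) - a) := by
  set r : ℝ := (2 : ℝ) ^ ((d : ℝ) - a) with hr
  have hr1 : 1 < r := Real.one_lt_rpow (by norm_num) (by linarith)
  refine ⟨5 ^ d * (r / (r - 1)), by have : 0 < r - 1 := by linarith
                                    positivity, fun F s hs hF => ?_⟩
  rcases F.eq_empty_or_nonempty with rfl | ⟨w₀, hw₀⟩
  · simp only [Finset.sum_empty]
    have : 0 < r - 1 := by linarith
    positivity
  have hs1 : 1 ≤ s := (one_le_bracket w₀).trans (hF w₀ hw₀)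
  set N := Nat.log 2 ⌊s⌋₊ with hN
  have h1 := sum_dyadicLevel_le F (Finset.range (N + 1)) (fun w hw => by
    rw [Finset.mem_range, Nat.lt_succ_iff]
    exact Nat.log_mono_right (Nat.floor_mono (hF w hw))) a ha
  refine h1.trans ?_
  rw [mul_assoc]
  gcongr
  refine (sum_range_pow_le hr1 N).trans ?_
  have : 0 < r - 1 := by linarith
  gcongr
  rw [hr, ← two_rpow_mul_nat]
  exact Real.rpow_le_rpow (by positivity) (two_pow_log_floor_le hs1) (by linarith)

/-- Here the ratio is smaller than 1 and the smallest scale dominates. -/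
lemma exists_sum_bracket_far_le (d : ℕ) (e : ℝ) (hde : (d : ℝ) < e) :
    ∃ C : ℝ, 0 < C ∧ ∀ (F : Finset (Fin d → ℤ)) (s : ℝ), 0 < s → (∀ w ∈ F, s ≤ bracket w) →
      ∑ w ∈ F, bracket w ^ (-e) ≤ C * s ^ ((d : ℝ) - e) := by
  set q : ℝ := (2 : ℝ) ^ ((d : ℝ) - e) with hq
  have hq1 : q < 1 := Real.rpow_lt_one_of_one_lt_of_neg (by norm_num) (by linarith)
  have hq0 : 0 < q := by positivity
  have hq2 : 0 < 1 - q := by linarith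
  -- The last factor pays for rounding: the lowest level N only satisfies 2^N > s / 2.
  refine ⟨5 ^ d * (1 / (1 - q)) * (1 / 2) ^ ((d : ℝ) - e), by positivity, fun F s hs hF => ?_⟩
  set N := Nat.log 2 ⌊s⌋₊ with hN
  have h1 := sum_dyadicLevel_le F (Finset.Ico N (F.sup dyadicLevel + 1)) (fun w hw => by
    rw [Finset.mem_Ico, Nat.lt_succ_iff]
    exact ⟨Nat.log_mono_right (Nat.floor_mono (hF w hw)), Finset.le_sup hw⟩) e
      (by have : (0 : ℝ) ≤ d := Nat.cast_nonneg d
          linarith)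
  refine h1.trans ?_
  rw [mul_assoc, mul_assoc]
  gcongr
  refine (geom_sum_Ico_le_of_lt_one hq0.le hq1).trans ?_
  rw [div_eq_mul_one_div, mul_comm]
  gcongr
  rw [hq, ← two_rpow_mul_nat, ← Real.mul_rpow (by norm_num) hs.le]
  refine Real.rpow_le_rpow_of_nonpos (by positivity) ?_ (by linarith)
  have := lt_two_pow_log_floor s
  rw [pow_succ] at this
  linarith

lemma bracket_add_le (x y : Fin d → ℤ) : bracket (x + y) ≤ bracket x + latticeNorm y := by
  refine max_le ((latticeNorm_add_le x y).trans ?_) ?_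
  · gcongr; exact latticeNorm_le_bracket x
  · linarith [one_le_bracket x, latticeNorm_nonneg y]

/-- The discrete Riesz composition inequality. -/
lemma exists_sum_bracket_mul_bracket_le (d : ℕ) (a b : ℝ) (ha : 0 < a) (had : a < d) (hb : 0 < b)
    (hbd : b < d) (hab : (d : ℝ) < a + b) :
    ∃ C : ℝ, 0 < C ∧ ∀ (F : Finset (Fin d → ℤ)) (z : Fin d → ℤ),
      ∑ w ∈ F, bracket w ^ (-a) * bracket (z - w) ^ (-b) ≤ C * bracket z ^ (-(a + b - d)) := by
  obtain ⟨C₁, hC₁, h₁⟩ := exists_sum_bracket_near_le d a ha.le had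
  obtain ⟨C₂, hC₂, h₂⟩ := exists_sum_bracket_near_le d b hb.le hbd
  obtain ⟨C₃, hC₃, h₃⟩ := exists_sum_bracket_far_le d (a + b) hab
  refine ⟨(C₁ + C₂ + 2 * C₃) * (1 / 2) ^ (-(a + b - d)), by positivity, fun F z => ?_⟩
  set t := bracket z with ht
  have ht1 : 1 ≤ t := one_le_bracket z
  classical
  have hz1 : ∀ w : Fin d → ℤ, bracket w ≤ t / 2 → t / 2 ≤ bracket (z - w) := by
    intro w hw
    have h1 := bracket_add_le (z - w) w
    rw [sub_add_cancel, ← ht] at h1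
    linarith [latticeNorm_le_bracket w]
  have hz2 : ∀ w : Fin d → ℤ, bracket (z - w) ≤ t / 2 → t / 2 ≤ bracket w := by
    intro w hw
    have h1 := bracket_add_le w (z - w)
    rw [add_sub_cancel, ← ht] at h1
    linarith [latticeNorm_le_bracket (z - w)]
  have hinj : Set.InjOn (fun w => z - w) (F : Set (Fin d → ℤ)) := sub_right_injective.injOn
  -- If w is close to 0 or to z, the other factor is of order a power of t. If w is far from both,
  -- the smaller of the two brackets is put in both factors; the resulting exponent a + b > d is
  -- summable at infinity.
  have hpt : ∀ w ∈ F, bracket w ^ (-a) * bracket (z - w) ^ (-b) ≤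
      (if bracket w ≤ t / 2 then bracket w ^ (-a) * (t / 2) ^ (-b) else 0) +
      (if bracket (z - w) ≤ t / 2 then bracket (z - w) ^ (-b) * (t / 2) ^ (-a) else 0) +
      ((if t / 2 ≤ bracket w then bracket w ^ (-(a + b)) else 0) +
       (if t / 2 ≤ bracket (z - w) then bracket (z - w) ^ (-(a + b)) else 0)) := by
    intro w _
    have p1 := bracket_pos w
    have p2 := bracket_pos (z - w)
    have hn1 : 0 ≤ (if bracket w ≤ t / 2 then bracket w ^ (-a) * (t / 2) ^ (-b) else 0) := by
      split_ifs <;> positivity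
    have hn2 : 0 ≤ (if bracket (z - w) ≤ t / 2 then bracket (z - w) ^ (-b) * (t / 2) ^ (-a)
        else 0) := by
      split_ifs <;> positivity
    have hn3 : 0 ≤ (if t / 2 ≤ bracket w then bracket w ^ (-(a + b)) else 0) := by
      split_ifs <;> positivity
    have hn4 : 0 ≤ (if t / 2 ≤ bracket (z - w) then bracket (z - w) ^ (-(a + b)) else 0) := by
      split_ifs <;> positivity
    by_cases c1 : bracket w ≤ t / 2
    · have : bracket w ^ (-a) * bracket (z - w) ^ (-b) ≤
          (if bracket w ≤ t / 2 then bracket w ^ (-a) * (t / 2) ^ (-b) else 0) := by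
        rw [if_pos c1]
        gcongr ?_ * ?_
        exact Real.rpow_le_rpow_of_nonpos (by positivity) (hz1 w c1) (by linarith)
      linarith
    by_cases c2 : bracket (z - w) ≤ t / 2
    · have : bracket w ^ (-a) * bracket (z - w) ^ (-b) ≤
          (if bracket (z - w) ≤ t / 2 then bracket (z - w) ^ (-b) * (t / 2) ^ (-a) else 0) := by
        rw [if_pos c2, mul_comm]
        gcongr ?_ * ?_
        exact Real.rpow_le_rpow_of_nonpos (by positivity) (hz2 w c2) (by linarith)
      linarith
    push Not at c1 c2
    rcases le_total (bracket w) (bracket (z - w)) with hle | hle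
    · have : bracket w ^ (-a) * bracket (z - w) ^ (-b) ≤
          (if t / 2 ≤ bracket w then bracket w ^ (-(a + b)) else 0) := by
        rw [if_pos c1.le, neg_add, Real.rpow_add p1]
        gcongr ?_ * ?_
        exact Real.rpow_le_rpow_of_nonpos p1 hle (by linarith)
      linarith
    · have : bracket w ^ (-a) * bracket (z - w) ^ (-b) ≤
          (if t / 2 ≤ bracket (z - w) then bracket (z - w) ^ (-(a + b)) else 0) := by
        rw [if_pos c2.le, neg_add, Real.rpow_add p2]
        gcongr ?_ * ?_
        exact Real.rpow_le_rpow_of_nonpos p2 hle (by linarith)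
      linarith
  refine (Finset.sum_le_sum hpt).trans ?_
  have ht2 : 0 < t / 2 := by linarith
  have e1 : ∑ w ∈ F, (if bracket w ≤ t / 2 then bracket w ^ (-a) * (t / 2) ^ (-b) else 0) ≤
      C₁ * (t / 2) ^ (-(a + b - d)) := by
    rw [← Finset.sum_filter, ← Finset.sum_mul]
    calc _ ≤ C₁ * (t / 2) ^ ((d : ℝ) - a) * (t / 2) ^ (-b) := by
          gcongr
          exact h₁ _ _ ht2 fun w hw => (Finset.mem_filter.1 hw).2
      _ = _ := by rw [mul_assoc, ← Real.rpow_add ht2]; congr 2; ring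
  have e2 : ∑ w ∈ F, (if bracket (z - w) ≤ t / 2 then bracket (z - w) ^ (-b) * (t / 2) ^ (-a)
      else 0) ≤ C₂ * (t / 2) ^ (-(a + b - d)) := by
    have := Finset.sum_image (s := F) (g := fun w => z - w)
      (f := fun u => if bracket u ≤ t / 2 then bracket u ^ (-b) * (t / 2) ^ (-a) else 0) hinj
    rw [← this, ← Finset.sum_filter, ← Finset.sum_mul]
    calc _ ≤ C₂ * (t / 2) ^ ((d : ℝ) - b) * (t / 2) ^ (-a) := by
          gcongr
          exact h₂ _ _ ht2 fun w hw => (Finset.mem_filter.1 hw).2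
      _ = _ := by rw [mul_assoc, ← Real.rpow_add ht2]; congr 2; ring
  have e3 : ∑ w ∈ F, (if t / 2 ≤ bracket w then bracket w ^ (-(a + b)) else 0) ≤
      C₃ * (t / 2) ^ (-(a + b - d)) := by
    rw [← Finset.sum_filter, neg_sub]
    exact h₃ _ _ ht2 fun w hw => (Finset.mem_filter.1 hw).2
  have e4 : ∑ w ∈ F, (if t / 2 ≤ bracket (z - w) then bracket (z - w) ^ (-(a + b)) else 0) ≤
      C₃ * (t / 2) ^ (-(a + b - d)) := by
    have := Finset.sum_image (s := F) (g := fun w => z - w)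
      (f := fun u => if t / 2 ≤ bracket u then bracket u ^ (-(a + b)) else 0) hinj
    rw [← this, ← Finset.sum_filter, neg_sub]
    exact h₃ _ _ ht2 fun w hw => (Finset.mem_filter.1 hw).2
  simp only [Finset.sum_add_distrib]
  have e5 : (t / 2) ^ (-(a + b - d)) = (1 / 2) ^ (-(a + b - d)) * t ^ (-(a + b - (d : ℝ))) := by
    rw [← Real.mul_rpow (by norm_num) (by linarith)]; congr 1; ring
  rw [e5] at e1 e2 e3 e4
  linarith

/-- The iterated Riesz composition inequality, over boxes with an arbitrary shift. -/
lemma exists_sum_prod_bracket_le (d m : ℕ) (α : Fin m → ℝ) (a : ℝ) (ha : 0 < a) (had : a < d)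
    (hα : ∀ i, 0 < α i ∧ α i < d) (hsum : (m : ℝ) * d < a + ∑ i, α i) :
    ∃ C : ℝ, 0 < C ∧ ∀ (F : Fin m → Finset (Fin d → ℤ)) (v : Fin m → Fin d → ℤ) (z : Fin d → ℤ),
      ∑ u ∈ Fintype.piFinset F, (∏ i, bracket (u i - v i) ^ (-α i)) *
        bracket (z - ∑ i, (u i - v i)) ^ (-a) ≤ C * bracket z ^ (-(a + ∑ i, α i - m * d)) := by
  induction m generalizing a with
  | zero =>
    refine ⟨1, one_pos, fun F v z => ?_⟩
    simp
  | succ m ih =>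
    rw [Fin.sum_univ_succ] at hsum
    push_cast at hsum
    -- Together with the hypothesis on the sum this gives α 0 + a > d, so that summing over u 0
    -- leaves a kernel with exponent α 0 + a - d in (0, d), as the induction requires.
    have htail : ∑ i : Fin m, α i.succ ≤ m * d := by
      calc ∑ i : Fin m, α i.succ ≤ ∑ i : Fin m, (d : ℝ) :=
            Finset.sum_le_sum fun i _ => (hα i.succ).2.le
        _ = m * d := by simp
    have hα0 := hα 0
    obtain ⟨C₁, hC₁, h₁⟩ := exists_sum_bracket_mul_bracket_le d (α 0) a hα0.1 hα0.2 ha had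
      (by linarith)
    obtain ⟨C₂, hC₂, h₂⟩ := ih (fun i => α i.succ) (α 0 + a - d) (by linarith) (by linarith)
      (fun i => hα i.succ) (by linarith)
    refine ⟨C₁ * C₂, by positivity, fun F v z => ?_⟩
    have hre : ∑ u ∈ Fintype.piFinset F, (∏ i, bracket (u i - v i) ^ (-α i)) *
        bracket (z - ∑ i, (u i - v i)) ^ (-a) =
        ∑ u' ∈ Fintype.piFinset fun i : Fin m => F i.succ, ∑ u₀ ∈ F 0,
          (∏ i : Fin m, bracket (u' i - v i.succ) ^ (-α i.succ)) *
          (bracket (u₀ - v 0) ^ (-α 0) *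
            bracket ((z - ∑ i : Fin m, (u' i - v i.succ)) - (u₀ - v 0)) ^ (-a)) := by
      rw [Finset.sum_comm, ← Finset.sum_product']
      refine Finset.sum_nbij' (fun u => (u 0, fun i => u i.succ))
        (fun p => Fin.cons p.1 p.2) ?_ ?_ ?_ ?_ ?_
      · intro u hu
        rw [Fintype.mem_piFinset] at hu
        exact Finset.mem_product.2 ⟨hu 0, Fintype.mem_piFinset.2 fun i => hu i.succ⟩
      · rintro ⟨u₀, u'⟩ hp
        rw [Finset.mem_product, Fintype.mem_piFinset] at hp
        rw [Fintype.mem_piFinset]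
        intro i
        refine Fin.cases ?_ (fun i => ?_) i
        · exact hp.1
        · exact hp.2 i
      · intro u _
        exact Fin.cons_self_tail u
      · rintro ⟨u₀, u'⟩ _
        simp
      · intro u _
        rw [Fin.prod_univ_succ, Fin.sum_univ_succ]
        have : z - (u 0 - v 0 + ∑ i : Fin m, (u i.succ - v i.succ)) =
          z - ∑ i : Fin m, (u i.succ - v i.succ) - (u 0 - v 0) := by abel
        rw [this]; ring
    rw [hre]
    calc _ ≤ ∑ u' ∈ Fintype.piFinset fun i : Fin m => F i.succ,
          (∏ i : Fin m, bracket (u' i - v i.succ) ^ (-α i.succ)) *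
          (C₁ * bracket (z - ∑ i : Fin m, (u' i - v i.succ)) ^ (-(α 0 + a - d))) := by
          refine Finset.sum_le_sum fun u' _ => ?_
          rw [← Finset.mul_sum]
          have hnn : 0 ≤ ∏ i : Fin m, bracket (u' i - v i.succ) ^ (-α i.succ) :=
            Finset.prod_nonneg fun i _ => bracket_rpow_nonneg _ _
          gcongr
          have hinj : Set.InjOn (fun w => w - v 0) (F 0 : Set (Fin d → ℤ)) :=
            sub_left_injective.injOn
          have := Finset.sum_image (s := F 0) (g := fun w => w - v 0)
            (f := fun w => bracket w ^ (-α 0) *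
              bracket ((z - ∑ i : Fin m, (u' i - v i.succ)) - w) ^ (-a)) hinj
          rw [← this]
          exact h₁ _ _
      _ = C₁ * ∑ u' ∈ Fintype.piFinset fun i : Fin m => F i.succ,
          (∏ i : Fin m, bracket (u' i - v i.succ) ^ (-α i.succ)) *
          bracket (z - ∑ i : Fin m, (u' i - v i.succ)) ^ (-(α 0 + a - d)) := by
          rw [Finset.mul_sum]
          exact Finset.sum_congr rfl fun _ _ => by ring
      _ ≤ C₁ * (C₂ * bracket z ^ (-(α 0 + a - d + ∑ i : Fin m, α i.succ - m * d))) := by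
          gcongr
          exact h₂ _ _ _
      _ = _ := by
          rw [Fin.sum_univ_succ, mul_assoc]
          congr 4
          push_cast; ring

end RieszConvolution

/-! ### Replacement of independent random sets by means of hitting probabilities. -/

section Replacement

variable {V : Type*} [Countable V]

lemma measurableSet_exists_mem {n : ℕ} {X : Fin n → Type*} [∀ i, MeasurableSpace (X i)]
    (S : ∀ i, X i → Set V) (hS : ∀ i v, MeasurableSet {x | v ∈ S i x}) (G : Set (Fin n → V)) :
    MeasurableSet {x : ∀ i, X i | ∃ y ∈ G, ∀ i, y i ∈ S i (x i)} := by
  have : {x : ∀ i, X i | ∃ y ∈ G, ∀ i, y i ∈ S i (x i)} =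
      ⋃ y ∈ G, ⋂ i, (fun x : ∀ i, X i => x i) ⁻¹' {x | y i ∈ S i x} := by
    ext x; simp
  rw [this]
  exact MeasurableSet.biUnion (Set.to_countable G) fun y _ =>
    MeasurableSet.iInter fun i => measurable_pi_apply i (hS i (y i))

lemma measurableSet_inter_nonempty {X : Type*} [MeasurableSpace X] (S : X → Set V)
    (hS : ∀ v, MeasurableSet {x | v ∈ S x}) (K : Set V) :
    MeasurableSet {x | (S x ∩ K).Nonempty} := by
  have : {x | (S x ∩ K).Nonempty} = ⋃ v ∈ K, {x | v ∈ S x} := by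
    ext x
    simp only [Set.Nonempty, Set.mem_inter_iff, Set.mem_ofPred_eq, Set.mem_iUnion]
    exact ⟨fun ⟨v, h1, h2⟩ => ⟨v, h2, h1⟩, fun ⟨v, h1, h2⟩ => ⟨v, h2, h1⟩⟩
  rw [this]
  exact MeasurableSet.biUnion (Set.to_countable K) fun v _ => hS v

/-- The probability that a product of independent random sets meets `G`, by conditioning on all
factors but the one with index `j`. -/
lemma measure_pi_exists_mem_eq_lintegral {n : ℕ} {X : Fin (n + 1) → Type*}
    [∀ i, MeasurableSpace (X i)] (μ : ∀ i, Measure (X i)) [∀ i, IsProbabilityMeasure (μ i)]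
    (S : ∀ i, X i → Set V) (hS : ∀ i v, MeasurableSet {x | v ∈ S i x})
    (G : Set (Fin (n + 1) → V)) (j : Fin (n + 1)) :
    MeasurableSet {p : X j × ∀ i, X (j.succAbove i) |
      ∃ y ∈ G, y j ∈ S j p.1 ∧ ∀ i, y (j.succAbove i) ∈ S (j.succAbove i) (p.2 i)} ∧
    Measure.pi μ {x | ∃ y ∈ G, ∀ i, y i ∈ S i (x i)} =
      ((μ j).prod (Measure.pi fun i => μ (j.succAbove i))) {p : X j × ∀ i, X (j.succAbove i) |
        ∃ y ∈ G, y j ∈ S j p.1 ∧ ∀ i, y (j.succAbove i) ∈ S (j.succAbove i) (p.2 i)} := by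
  set E : Set (X j × ∀ i, X (j.succAbove i)) := {p |
      ∃ y ∈ G, y j ∈ S j p.1 ∧ ∀ i, y (j.succAbove i) ∈ S (j.succAbove i) (p.2 i)} with hE
  have hmeas : MeasurableSet E := by
    have : E = ⋃ y ∈ G, Prod.fst ⁻¹' {x | y j ∈ S j x} ∩ ⋂ i,
        (fun p : X j × ∀ i, X (j.succAbove i) => p.2 i) ⁻¹'
          {x | y (j.succAbove i) ∈ S (j.succAbove i) x} := by
      ext x
      simp only [hE, Set.mem_ofPred_eq, Set.mem_iUnion, Set.mem_inter_iff, Set.mem_preimage,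
        Set.mem_iInter, exists_prop]
    rw [this]
    refine MeasurableSet.biUnion (Set.to_countable G) fun y _ =>
      (measurable_fst (hS _ _)).inter (MeasurableSet.iInter fun i => ?_)
    exact ((measurable_pi_apply i).comp measurable_snd) (hS _ _)
  refine ⟨hmeas, ?_⟩
  rw [← (measurePreserving_piFinSuccAbove μ j).measure_preimage hmeas.nullMeasurableSet]
  congr 1
  ext x
  simp only [hE, Set.mem_preimage, Set.mem_ofPred_eq, MeasurableEquiv.piFinSuccAbove_apply]
  refine exists_congr fun y => and_congr_right fun _ => ?_
  rw [Fin.forall_iff_succAbove j]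
  rfl

/-- Independent random sets can be replaced one at a time by random sets with larger hitting
probabilities. -/
theorem measure_pi_exists_mem_le {n : ℕ} {X Y : Fin n → Type*}
    [∀ i, MeasurableSpace (X i)] [∀ i, MeasurableSpace (Y i)]
    (μ : ∀ i, Measure (X i)) [∀ i, IsProbabilityMeasure (μ i)]
    (ν : ∀ i, Measure (Y i)) [∀ i, IsProbabilityMeasure (ν i)]
    (S : ∀ i, X i → Set V) (hS : ∀ i v, MeasurableSet {x | v ∈ S i x})
    (T : ∀ i, Y i → Set V) (hT : ∀ i v, MeasurableSet {x | v ∈ T i x})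
    (F : Fin n → Set V) (c : Fin n → ENNReal)
    (h : ∀ i, ∀ K ⊆ F i, μ i {x | (S i x ∩ K).Nonempty} ≤ c i * ν i {x | (T i x ∩ K).Nonempty})
    (G : Set (Fin n → V)) (hG : ∀ y ∈ G, ∀ i, y i ∈ F i) :
    Measure.pi μ {x | ∃ y ∈ G, ∀ i, y i ∈ S i (x i)} ≤
      (∏ i, c i) * Measure.pi ν {x | ∃ y ∈ G, ∀ i, y i ∈ T i (x i)} := by
  induction n with
  | zero =>
    by_cases hne : G.Nonempty
    · obtain ⟨y, hy⟩ := hne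
      have e1 : {x : ∀ i, X i | ∃ y ∈ G, ∀ i, y i ∈ S i (x i)} = Set.univ :=
        Set.eq_univ_of_forall fun x => ⟨y, hy, fun i => i.elim0⟩
      have e2 : {x : ∀ i, Y i | ∃ y ∈ G, ∀ i, y i ∈ T i (x i)} = Set.univ :=
        Set.eq_univ_of_forall fun x => ⟨y, hy, fun i => i.elim0⟩
      rw [e1, e2]
      simp
    · rw [Set.not_nonempty_iff_eq_empty] at hne
      subst hne
      simp
  | succ n ih =>
    obtain ⟨hm, he⟩ := measure_pi_exists_mem_eq_lintegral μ S hS G 0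
    obtain ⟨hm', he'⟩ := measure_pi_exists_mem_eq_lintegral ν T hT G 0
    set E : Set (Y 0 × ∀ i, X (Fin.succAbove 0 i)) := {p | ∃ y ∈ G, y 0 ∈ T 0 p.1 ∧
      ∀ i, y (Fin.succAbove 0 i) ∈ S (Fin.succAbove 0 i) (p.2 i)} with hE
    have hmE : MeasurableSet E := by
      have : E = ⋃ y ∈ G, Prod.fst ⁻¹' {x | y 0 ∈ T 0 x} ∩ ⋂ i,
          (fun p : Y 0 × ∀ i, X (Fin.succAbove 0 i) => p.2 i) ⁻¹'
            {x | y (Fin.succAbove 0 i) ∈ S (Fin.succAbove 0 i) x} := by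
        ext x
        simp only [hE, Set.mem_ofPred_eq, Set.mem_iUnion, Set.mem_inter_iff, Set.mem_preimage,
          Set.mem_iInter, exists_prop]
      rw [this]
      refine MeasurableSet.biUnion (Set.to_countable G) fun y _ =>
        (measurable_fst (hT _ _)).inter (MeasurableSet.iInter fun i => ?_)
      exact ((measurable_pi_apply i).comp measurable_snd) (hS _ _)
    -- With all other coordinates frozen, the event says that the set with index 0 meets the set K
    -- of admissible first coordinates, and the hitting hypothesis applies to K.
    have step1 : Measure.pi μ {x | ∃ y ∈ G, ∀ i, y i ∈ S i (x i)} ≤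
        c 0 * ((ν 0).prod (Measure.pi fun i => μ (Fin.succAbove 0 i))) E := by
      rw [he, Measure.prod_apply_symm hm, Measure.prod_apply_symm hmE,
        ← lintegral_const_mul _ (measurable_measure_prodMk_right hmE)]
      refine lintegral_mono fun x => ?_
      set K : Set V := {v | ∃ y ∈ G, y 0 = v ∧
        ∀ i, y (Fin.succAbove 0 i) ∈ S (Fin.succAbove 0 i) (x i)} with hK
      have hKF : K ⊆ F 0 := by
        rintro v ⟨y, hy, rfl, -⟩
        exact hG y hy 0
      refine le_trans (measure_mono ?_) ((h 0 K hKF).trans ?_)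
      · rintro x₀ ⟨y, hy, h1, h2⟩
        exact ⟨y 0, h1, y, hy, rfl, h2⟩
      · gcongr
        rintro x₀ ⟨v, h1, y, hy, rfl, h2⟩
        exact ⟨y, hy, h1, h2⟩
    -- With the new set of index 0 frozen instead, the remaining coordinates range over a slice G'
    -- of G, to which the induction hypothesis applies.
    have step2 : ((ν 0).prod (Measure.pi fun i => μ (Fin.succAbove 0 i))) E ≤
        (∏ i : Fin n, c i.succ) *
          Measure.pi ν {x | ∃ y ∈ G, ∀ i, y i ∈ T i (x i)} := by
      rw [he', Measure.prod_apply hm', Measure.prod_apply hmE,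
        ← lintegral_const_mul _ (measurable_measure_prodMk_left hm')]
      refine lintegral_mono fun x₀ => ?_
      set G' : Set (Fin n → V) := {y' | ∃ y ∈ G, y 0 ∈ T 0 x₀ ∧ y' = fun i => y (Fin.succAbove 0 i)}
        with hG'
      have := ih (fun i => μ (Fin.succAbove 0 i)) (fun i => ν (Fin.succAbove 0 i))
        (fun i => S (Fin.succAbove 0 i)) (fun i => hS _) (fun i => T (Fin.succAbove 0 i))
        (fun i => hT _) (fun i => F (Fin.succAbove 0 i)) (fun i => c (Fin.succAbove 0 i))
        (fun i => h _) G' (by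
          rintro _ ⟨y, hy, -, rfl⟩ i
          exact hG y hy _)
      refine le_trans (measure_mono ?_) (this.trans ?_)
      · rintro x ⟨y, hy, h1, h2⟩
        exact ⟨_, ⟨y, hy, h1, rfl⟩, h2⟩
      · gcongr
        · simp
        · rintro x ⟨_, ⟨y, hy, h1, rfl⟩, h2⟩
          exact ⟨y, hy, h1, h2⟩
    rw [Fin.prod_univ_succ, mul_assoc]
    exact step1.trans (by gcongr)

/-- This is where independence enters: the joint law of the sets is the product of their laws on
`Set V`, so everything can be computed in product spaces. -/
lemma measure_exists_mem_eq_pi {n : ℕ} {Ω : Type*} [MeasurableSpace Ω] (P : Measure Ω)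
    [IsProbabilityMeasure P] (R : Fin n → Ω → Set V) (hR : ∀ i, Measurable (R i))
    (hind : iIndepFun R P) (G : Set (Fin n → V)) :
    P {ω | ∃ y ∈ G, ∀ i, y i ∈ R i ω} =
      Measure.pi (fun i => P.map (R i)) {T : Fin n → Set V | ∃ y ∈ G, ∀ i, y i ∈ T i} := by
  rw [← (iIndepFun_iff_map_fun_eq_pi_map fun i => (hR i).aemeasurable).1 hind,
    Measure.map_apply (measurable_pi_lambda _ hR)]
  · rfl
  · exact measurableSet_exists_mem (fun _ T => T) (fun _ v => measurableSet_setOfPred.2 (measurable_set_mem v)) G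

end Replacement

/-! ### The second moment inequality. -/

section SecondMoment

/-- Cauchy–Schwarz for Z = ∑ c_j 1_{E_j}, which vanishes off U: (∫ Z)² ≤ m(U) ∫ Z². The coefficients
may have any sign. -/
lemma sq_sum_measure_le {X ι : Type*} [MeasurableSpace X] (m : Measure X) [IsFiniteMeasure m]
    (s : Finset ι) (c : ι → ℝ) (E : ι → Set X) (hE : ∀ j, MeasurableSet (E j)) {U : Set X}
    (hU : MeasurableSet U) (hEU : ∀ j ∈ s, E j ⊆ U) :
    (∑ j ∈ s, c j * m.real (E j)) ^ 2 ≤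
      m.real U * ∑ j ∈ s, ∑ l ∈ s, c j * c l * m.real (E j ∩ E l) := by
  classical
  set B := ∑ j ∈ s, c j * m.real (E j) with hB
  set A := ∑ j ∈ s, ∑ l ∈ s, c j * c l * m.real (E j ∩ E l) with hA
  have hint : ∀ S : Set X, MeasurableSet S → Integrable (S.indicator fun _ => (1 : ℝ)) m :=
    fun S hS => (integrable_const 1).indicator hS
  have hval : ∀ S : Set X, MeasurableSet S → ∫ x, S.indicator (fun _ => (1 : ℝ)) x ∂m = m.real S :=
    fun S hS => integral_indicator_one hS
  -- The quadratic polynomial is ∫ (t Z - 1_U)²; its discriminant gives the claim.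
  have key : ∀ t : ℝ, 0 ≤ A * (t * t) + (-2 * B) * t + m.real U := by
    intro t
    have h1 : ∫ x, (∑ j ∈ s, ∑ l ∈ s, (t * t * (c j * c l)) * (E j ∩ E l).indicator (fun _ => (1 : ℝ)) x
        + ∑ j ∈ s, (-2 * t * c j) * (E j).indicator (fun _ => (1 : ℝ)) x
        + U.indicator (fun _ => (1 : ℝ)) x) ∂m = A * (t * t) + (-2 * B) * t + m.real U := by
      have i1 : Integrable (fun x => ∑ j ∈ s, ∑ l ∈ s,
          (t * t * (c j * c l)) * (E j ∩ E l).indicator (fun _ => (1 : ℝ)) x) m :=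
        integrable_finsetSum _ fun j _ => integrable_finsetSum _ fun l _ =>
          (hint _ ((hE j).inter (hE l))).const_mul _
      have i2 : Integrable (fun x => ∑ j ∈ s,
          (-2 * t * c j) * (E j).indicator (fun _ => (1 : ℝ)) x) m :=
        integrable_finsetSum _ fun j _ => (hint _ (hE j)).const_mul _
      have i3 : Integrable (fun x => ∑ j ∈ s, ∑ l ∈ s,
          (t * t * (c j * c l)) * (E j ∩ E l).indicator (fun _ => (1 : ℝ)) x +
          ∑ j ∈ s, (-2 * t * c j) * (E j).indicator (fun _ => (1 : ℝ)) x) m := i1.add i2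
      rw [integral_add i3 (hint _ hU), integral_add i1 i2, hval _ hU,
        integral_finsetSum _ fun j _ => integrable_finsetSum _ fun l _ =>
          (hint _ ((hE j).inter (hE l))).const_mul _,
        integral_finsetSum _ fun j _ => (hint _ (hE j)).const_mul _]
      congr 2
      · rw [hA, Finset.sum_mul]
        refine Finset.sum_congr rfl fun j _ => ?_
        rw [integral_finsetSum _ fun l _ => (hint _ ((hE j).inter (hE l))).const_mul _,
          Finset.sum_mul]
        refine Finset.sum_congr rfl fun l _ => ?_
        rw [integral_const_mul, hval _ ((hE j).inter (hE l))]; ring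
      · rw [hB, Finset.mul_sum, Finset.sum_mul]
        refine Finset.sum_congr rfl fun j _ => ?_
        rw [integral_const_mul, hval _ (hE j)]; ring
    rw [← h1]
    refine integral_nonneg fun x => ?_
    have e1 : ∀ j l, (E j ∩ E l).indicator (fun _ => (1 : ℝ)) x =
        (E j).indicator (fun _ => (1 : ℝ)) x * (E l).indicator (fun _ => (1 : ℝ)) x := by
      intro j l
      by_cases a : x ∈ E j <;> by_cases b : x ∈ E l <;> simp [a, b]
    have e2 : ∀ j ∈ s, (E j).indicator (fun _ => (1 : ℝ)) x =
        U.indicator (fun _ => (1 : ℝ)) x * (E j).indicator (fun _ => (1 : ℝ)) x := by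
      intro j hj
      by_cases a : x ∈ E j
      · simp [a, hEU j hj a]
      · simp [a]
    have e3 : U.indicator (fun _ => (1 : ℝ)) x =
        U.indicator (fun _ => (1 : ℝ)) x * U.indicator (fun _ => (1 : ℝ)) x := by
      by_cases a : x ∈ U <;> simp [a]
    have e4 : (∑ j ∈ s, ∑ l ∈ s, (t * t * (c j * c l)) * (E j ∩ E l).indicator (fun _ => (1 : ℝ)) x
        + ∑ j ∈ s, (-2 * t * c j) * (E j).indicator (fun _ => (1 : ℝ)) x
        + U.indicator (fun _ => (1 : ℝ)) x) =
        (t * (∑ j ∈ s, c j * (E j).indicator (fun _ => (1 : ℝ)) x) -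
          U.indicator (fun _ => (1 : ℝ)) x) ^ 2 := by
      have f1 : ∑ j ∈ s, ∑ l ∈ s, (t * t * (c j * c l)) * (E j ∩ E l).indicator (fun _ => (1 : ℝ)) x
          = (t * (∑ j ∈ s, c j * (E j).indicator (fun _ => (1 : ℝ)) x)) *
            (t * (∑ j ∈ s, c j * (E j).indicator (fun _ => (1 : ℝ)) x)) := by
        simp only [Finset.mul_sum, Finset.sum_mul]
        rw [Finset.sum_comm]
        refine Finset.sum_congr rfl fun j _ => Finset.sum_congr rfl fun l _ => ?_
        rw [e1]; ring
      have f2 : ∑ j ∈ s, (-2 * t * c j) * (E j).indicator (fun _ => (1 : ℝ)) x =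
          -2 * (t * (∑ j ∈ s, c j * (E j).indicator (fun _ => (1 : ℝ)) x)) *
            U.indicator (fun _ => (1 : ℝ)) x := by
        simp only [Finset.mul_sum, Finset.sum_mul]
        refine Finset.sum_congr rfl fun j hj => ?_
        rw [e2 j hj]
        by_cases a : x ∈ U <;> simp [a]
        ring
      rw [f1, f2]
      nth_rewrite 2 [e3]
      ring
    rw [e4]
    exact sq_nonneg _
  have := discrim_le_zero key
  rw [discrim] at this
  nlinarith

end SecondMoment

/-! ### Dyadic boxes and their subdivision into children. -/

section DyadicBox

variable {d : ℕ}

/-- The dyadic box `[0, 2^n)^d`. -/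
noncomputable def dyadicBox (d n : ℕ) : Finset (Fin d → ℤ) := Fintype.piFinset fun _ => Finset.Ico 0 (2 ^ n)

lemma mem_dyadicBox {n : ℕ} {y : Fin d → ℤ} : y ∈ dyadicBox d n ↔ ∀ i, 0 ≤ y i ∧ y i < 2 ^ n := by
  simp [dyadicBox, Fintype.mem_piFinset]

/-- The corner of the child of `[0, 2^(n+1))^d` with index `ε`. -/
def boxCorner (n : ℕ) (ε : Fin d → Bool) : Fin d → ℤ := fun i => if ε i then 2 ^ n else 0

/-- The index of the child of `[0, 2^(n+1))^d` that contains `y`. -/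
def boxChild (n : ℕ) (y : Fin d → ℤ) : Fin d → Bool := fun i => decide (2 ^ n ≤ y i)

/-- The position of `y` relative to the corner of its child. -/
def boxRest (n : ℕ) (y : Fin d → ℤ) : Fin d → ℤ := y - boxCorner n (boxChild n y)

lemma boxCorner_add_boxRest (n : ℕ) (y : Fin d → ℤ) :
    boxCorner n (boxChild n y) + boxRest n y = y := by
  simp [boxRest]

lemma boxRest_mem {n : ℕ} {y : Fin d → ℤ} (hy : y ∈ dyadicBox d (n + 1)) :
    boxRest n y ∈ dyadicBox d n := by
  rw [mem_dyadicBox] at hy ⊢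
  intro i
  have h := hy i
  rw [pow_succ] at h
  simp only [boxRest, boxCorner, boxChild, Pi.sub_apply, decide_eq_true_eq]
  split_ifs with h1
  · constructor <;> linarith
  · constructor <;> linarith

lemma boxCorner_add_mem {n : ℕ} {z : Fin d → ℤ} (hz : z ∈ dyadicBox d n) (ε : Fin d → Bool) :
    boxCorner n ε + z ∈ dyadicBox d (n + 1) := by
  rw [mem_dyadicBox] at hz ⊢
  intro i
  have h := hz i
  have h2 : (0 : ℤ) < 2 ^ n := by positivity
  rw [pow_succ]
  simp only [boxCorner, Pi.add_apply]
  split_ifs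
  · constructor <;> linarith
  · constructor <;> linarith

lemma boxChild_add {n : ℕ} {z : Fin d → ℤ} (hz : z ∈ dyadicBox d n) (ε : Fin d → Bool) :
    boxChild n (boxCorner n ε + z) = ε := by
  rw [mem_dyadicBox] at hz
  funext i
  have h := hz i
  simp only [boxChild, boxCorner, Pi.add_apply]
  by_cases hε : ε i = true
  · simp [hε, h.1]
  · simp [hε, h.2]

lemma boxRest_add {n : ℕ} {z : Fin d → ℤ} (hz : z ∈ dyadicBox d n) (ε : Fin d → Bool) :
    boxRest n (boxCorner n ε + z) = z := by
  rw [boxRest, boxChild_add hz]; simp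

lemma boxRest_sub_boxRest {n : ℕ} {y y' : Fin d → ℤ} (h : boxChild n y = boxChild n y') :
    boxRest n y - boxRest n y' = y - y' := by
  simp [boxRest, h]

lemma boxRest_injOn {n : ℕ} {y y' : Fin d → ℤ} (h : boxChild n y = boxChild n y')
    (h' : boxRest n y = boxRest n y') : y = y' := by
  rw [← boxCorner_add_boxRest n y, ← boxCorner_add_boxRest n y', h, h']

lemma abs_sub_lt_of_mem_dyadicBox {n : ℕ} {y y' : Fin d → ℤ} (hy : y ∈ dyadicBox d n)
    (hy' : y' ∈ dyadicBox d n) (i : Fin d) : |y i - y' i| < 2 ^ n := by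
  have h1 := mem_dyadicBox.1 hy i
  have h2 := mem_dyadicBox.1 hy' i
  rw [abs_lt]
  constructor <;> linarith

lemma bracket_sub_le_of_mem_dyadicBox {n : ℕ} {y y' : Fin d → ℤ} (hy : y ∈ dyadicBox d n)
    (hy' : y' ∈ dyadicBox d n) : bracket (y - y') ≤ (Real.sqrt d + 1) * 2 ^ n := by
  refine bracket_le_of_abs_le (one_le_pow₀ (by norm_num)) fun i => ?_
  exact_mod_cast (abs_sub_lt_of_mem_dyadicBox hy hy' i).le

lemma dyadicBox_zero : dyadicBox d 0 = {0} := by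
  ext y
  rw [mem_dyadicBox, Finset.mem_singleton, funext_iff]
  refine forall_congr' fun i => ?_
  simp only [pow_zero, Pi.zero_apply]
  omega

lemma card_dyadicBox (d n : ℕ) : (dyadicBox d n).card = (2 ^ n) ^ d := by
  rw [dyadicBox, Fintype.card_piFinset]
  have : ((2 : ℤ) ^ n).toNat = 2 ^ n := by
    rw [← Int.toNat_natCast (2 ^ n)]; push_cast; rfl
  simp [this]

end DyadicBox

/-! ### Random subsets of dyadic boxes: branching, choosing one child, thinning. -/

lemma measureReal_pi_forall_mem {ι Ω : Type*} [Fintype ι] [MeasurableSpace Ω] (μ : Measure Ω)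
    [IsProbabilityMeasure μ] (T : Finset ι) (E : ι → Set Ω) :
    (Measure.pi fun _ : ι => μ).real {ω | ∀ i ∈ T, ω i ∈ E i} = ∏ i ∈ T, μ.real (E i) := by
  classical
  have h1 : {ω : ι → Ω | ∀ i ∈ T, ω i ∈ E i} =
      Set.univ.pi fun i => if i ∈ T then E i else Set.univ := by
    ext ω
    simp only [Set.mem_ofPred_eq, Set.mem_univ_pi]
    refine forall_congr' fun i => ?_
    by_cases hi : i ∈ T <;> simp [hi]
  rw [h1, measureReal_def, Measure.pi_pi, ENNReal.toReal_prod, ← Finset.prod_subset T.subset_univ]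
  · exact Finset.prod_congr rfl fun i hi => by rw [if_pos hi]; rfl
  · intro i _ hi
    simp [hi]

/-- A random subset of the dyadic box `[0, 2^n)^d`. -/
structure BoxRandomSet (d n : ℕ) where
  /-- The sample space. -/
  Sample : Type
  /-- The events. -/
  [measurableSpace : MeasurableSpace Sample]
  /-- The probability. -/
  law : Measure Sample
  [isProb : IsProbabilityMeasure law]
  /-- The random set. -/
  set : Sample → Finset (Fin d → ℤ)
  measurable_mem : ∀ y, MeasurableSet {ω | y ∈ set ω}
  subset_box : ∀ ω, set ω ⊆ dyadicBox d n

attribute [instance] BoxRandomSet.measurableSpace BoxRandomSet.isProb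

namespace BoxRandomSet

variable {d n : ℕ}

/-- The probability that the random set contains `y`. -/
noncomputable def one (X : BoxRandomSet d n) (y : Fin d → ℤ) : ℝ := X.law.real {ω | y ∈ X.set ω}

/-- The probability that the random set contains `y` and `y'`. -/
noncomputable def two (X : BoxRandomSet d n) (y y' : Fin d → ℤ) : ℝ :=
  X.law.real {ω | y ∈ X.set ω ∧ y' ∈ X.set ω}

/-- The probability that the random set meets `K`. -/
noncomputable def hit (X : BoxRandomSet d n) (K : Finset (Fin d → ℤ)) : ℝ :=
  X.law.real {ω | ∃ y ∈ K, y ∈ X.set ω}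

lemma two_nonneg (X : BoxRandomSet d n) (y y' : Fin d → ℤ) : 0 ≤ X.two y y' := measureReal_nonneg

lemma hit_nonneg (X : BoxRandomSet d n) (K : Finset (Fin d → ℤ)) : 0 ≤ X.hit K :=
  measureReal_nonneg

lemma hit_le_one (X : BoxRandomSet d n) (K : Finset (Fin d → ℤ)) : X.hit K ≤ 1 :=
  measureReal_le_one

lemma measurable_hit (X : BoxRandomSet d n) (K : Finset (Fin d → ℤ)) :
    MeasurableSet {ω | ∃ y ∈ K, y ∈ X.set ω} := by
  have : {ω | ∃ y ∈ K, y ∈ X.set ω} = ⋃ y ∈ K, {ω | y ∈ X.set ω} := by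
    ext ω; simp
  rw [this]
  exact Finset.measurableSet_biUnion K fun y _ => X.measurable_mem y

/-- The random set at scale `0`: the origin. -/
noncomputable def point (d : ℕ) : BoxRandomSet d 0 where
  Sample := Unit
  law := Measure.dirac ()
  set _ := {0}
  measurable_mem _ := MeasurableSet.of_discrete
  subset_box _ := by rw [dyadicBox_zero]

lemma point_two (d : ℕ) : (point d).two 0 0 = 1 := by
  have : {ω | (0 : Fin d → ℤ) ∈ (point d).set ω ∧ (0 : Fin d → ℤ) ∈ (point d).set ω} = Set.univ :=
    Set.eq_univ_of_forall fun ω => ⟨Finset.mem_singleton_self _, Finset.mem_singleton_self _⟩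
  rw [two, this, probReal_univ]

lemma point_one (d : ℕ) : (point d).one 0 = 1 := by
  have : {ω | (0 : Fin d → ℤ) ∈ (point d).set ω} = Set.univ :=
    Set.eq_univ_of_forall fun ω => Finset.mem_singleton_self _
  rw [one, this, probReal_univ]

/-- Independent copies of a random set in all the children of the box of the next scale. -/
noncomputable def branch (X : BoxRandomSet d n) : BoxRandomSet d (n + 1) where
  Sample := (Fin d → Bool) → X.Sample
  law := Measure.pi fun _ => X.law
  set ω := (dyadicBox d (n + 1)).filter fun y => boxRest n y ∈ X.set (ω (boxChild n y))
  measurable_mem y := by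
    simp only [Finset.mem_filter]
    have h : MeasurableSet {ω : (Fin d → Bool) → X.Sample | boxRest n y ∈ X.set (ω (boxChild n y))} :=
      (measurable_pi_apply (boxChild n y) : Measurable fun ω : (Fin d → Bool) → X.Sample =>
        ω (boxChild n y)) (X.measurable_mem (boxRest n y))
    exact (MeasurableSet.const _).inter h
  subset_box _ := Finset.filter_subset _ _

lemma mem_branch {X : BoxRandomSet d n} {ω : X.branch.Sample} {y : Fin d → ℤ} :
    y ∈ X.branch.set ω ↔
      y ∈ dyadicBox d (n + 1) ∧ boxRest n y ∈ X.set (ω (boxChild n y)) := by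
  simp only [branch, Finset.mem_filter]

lemma branch_one (X : BoxRandomSet d n) {y : Fin d → ℤ} (hy : y ∈ dyadicBox d (n + 1)) :
    X.branch.one y = X.one (boxRest n y) := by
  have := measureReal_pi_forall_mem X.law {boxChild n y}
    (fun _ => {ω | boxRest n y ∈ X.set ω})
  rw [Finset.prod_singleton] at this
  rw [one, one, ← this]
  simp only [mem_branch, hy, true_and, Finset.mem_singleton, forall_eq]
  rfl

lemma branch_two_of_eq (X : BoxRandomSet d n) {y y' : Fin d → ℤ} (hy : y ∈ dyadicBox d (n + 1))
    (hy' : y' ∈ dyadicBox d (n + 1)) (h : boxChild n y = boxChild n y') :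
    X.branch.two y y' = X.two (boxRest n y) (boxRest n y') := by
  have := measureReal_pi_forall_mem X.law {boxChild n y'}
    (fun _ => {ω | boxRest n y ∈ X.set ω ∧ boxRest n y' ∈ X.set ω})
  rw [Finset.prod_singleton] at this
  rw [two, two, ← this]
  simp only [mem_branch, hy, hy', true_and, Finset.mem_singleton, forall_eq, h]
  rfl

lemma branch_two_of_ne (X : BoxRandomSet d n) {y y' : Fin d → ℤ} (hy : y ∈ dyadicBox d (n + 1))
    (hy' : y' ∈ dyadicBox d (n + 1)) (h : boxChild n y ≠ boxChild n y') :
    X.branch.two y y' = X.one (boxRest n y) * X.one (boxRest n y') := by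
  have := measureReal_pi_forall_mem X.law {boxChild n y, boxChild n y'}
    (fun ε => {ω | (if ε = boxChild n y then boxRest n y else boxRest n y') ∈ X.set ω})
  rw [Finset.prod_pair h] at this
  simp only [if_true, if_neg h.symm] at this
  rw [two, one, one, ← this]
  simp only [mem_branch, hy, hy', true_and, Finset.mem_insert, Finset.mem_singleton, forall_eq_or_imp,
    forall_eq, Set.mem_ofPred_eq, if_true, if_neg h.symm]
  rfl

/-- The part of `K` in the child with index `ε`, moved to the origin. -/
def childPart (n : ℕ) (K : Finset (Fin d → ℤ)) (ε : Fin d → Bool) : Finset (Fin d → ℤ) :=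
  (K.filter fun y => boxChild n y = ε).image (boxRest n)

lemma childPart_subset {K : Finset (Fin d → ℤ)} (hK : K ⊆ dyadicBox d (n + 1))
    (ε : Fin d → Bool) : childPart n K ε ⊆ dyadicBox d n := by
  intro z hz
  obtain ⟨y, hy, rfl⟩ := Finset.mem_image.1 hz
  exact boxRest_mem (hK (Finset.mem_filter.1 hy).1)

/-- To miss K, the independent copies in all the children must miss their parts of K. -/
lemma branch_hit (X : BoxRandomSet d n) {K : Finset (Fin d → ℤ)}
    (hK : K ⊆ dyadicBox d (n + 1)) :
    X.branch.hit K = 1 - ∏ ε : Fin d → Bool, (1 - X.hit (childPart n K ε)) := by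
  have h1 := measureReal_pi_forall_mem X.law (Finset.univ : Finset (Fin d → Bool))
    (fun ε => {ω | ∃ y ∈ childPart n K ε, y ∈ X.set ω}ᶜ)
  have h2 : ∀ ε, X.law.real {ω | ∃ y ∈ childPart n K ε, y ∈ X.set ω}ᶜ =
      1 - X.hit (childPart n K ε) := fun ε => probReal_compl_eq_one_sub (X.measurable_hit _)
  simp only [h2] at h1
  have h3 : X.branch.law.real {ω | ∃ y ∈ K, y ∈ X.branch.set ω}ᶜ = 1 - X.branch.hit K :=
    probReal_compl_eq_one_sub (X.branch.measurable_hit _)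
  have h4 : {ω : X.branch.Sample | ∃ y ∈ K, y ∈ X.branch.set ω}ᶜ =
      {ω : (Fin d → Bool) → X.Sample | ∀ ε ∈ (Finset.univ : Finset (Fin d → Bool)),
        ω ε ∈ {ω | ∃ y ∈ childPart n K ε, y ∈ X.set ω}ᶜ} := by
    ext ω
    simp only [Set.mem_compl_iff, Set.mem_ofPred_eq, Finset.mem_univ, true_imp_iff]
    constructor
    · rintro h ε ⟨z, hz, hzω⟩
      obtain ⟨y, hy, rfl⟩ := Finset.mem_image.1 hz
      obtain ⟨hyK, rfl⟩ := Finset.mem_filter.1 hy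
      exact h ⟨y, hyK, mem_branch.2 ⟨hK hyK, hzω⟩⟩
    · rintro h ⟨y, hyK, hy⟩
      exact h (boxChild n y) ⟨_, Finset.mem_image_of_mem _ (Finset.mem_filter.2 ⟨hyK, rfl⟩),
        (mem_branch.1 hy).2⟩
  rw [h4] at h3
  have h5 := h1.symm.trans h3
  linarith

/-- A copy of a random set in a uniformly chosen child of the box of the next scale. -/
noncomputable def single (X : BoxRandomSet d n) : BoxRandomSet d (n + 1) where
  Sample := (Fin d → Bool) × X.Sample
  law := (uniformOn (Set.univ : Set (Fin d → Bool))).prod X.law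
  set ω := (dyadicBox d (n + 1)).filter fun y => boxChild n y = ω.1 ∧ boxRest n y ∈ X.set ω.2
  measurable_mem y := by
    simp only [Finset.mem_filter]
    exact (MeasurableSet.const _).inter ((measurable_fst (measurableSet_eq_fun measurable_const
      measurable_id)).inter (measurable_snd (X.measurable_mem _)))
  subset_box _ := Finset.filter_subset _ _

lemma mem_single {X : BoxRandomSet d n} {ω : X.single.Sample} {y : Fin d → ℤ} :
    y ∈ X.single.set ω ↔
      y ∈ dyadicBox d (n + 1) ∧ boxChild n y = ω.1 ∧ boxRest n y ∈ X.set ω.2 := by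
  simp only [single, Finset.mem_filter]

lemma uniformOn_univ_singleton (ε : Fin d → Bool) :
    (uniformOn (Set.univ : Set (Fin d → Bool))).real {ε} = (2 ^ d)⁻¹ := by
  rw [measureReal_def, uniformOn_univ]
  simp

lemma single_one (X : BoxRandomSet d n) {y : Fin d → ℤ} (hy : y ∈ dyadicBox d (n + 1)) :
    X.single.one y = (2 ^ d)⁻¹ * X.one (boxRest n y) := by
  have h : {ω : X.single.Sample | y ∈ X.single.set ω} =
      ({boxChild n y} : Set (Fin d → Bool)) ×ˢ {ω | boxRest n y ∈ X.set ω} := by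
    ext ω
    exact ⟨fun h => ⟨(mem_single.1 h).2.1.symm, (mem_single.1 h).2.2⟩,
      fun h => mem_single.2 ⟨hy, h.1.symm, h.2⟩⟩
  rw [one, h]
  change ((uniformOn (Set.univ : Set (Fin d → Bool))).prod X.law).real _ = _
  rw [measureReal_prod_prod, uniformOn_univ_singleton, one]

lemma single_two_of_eq (X : BoxRandomSet d n) {y y' : Fin d → ℤ} (hy : y ∈ dyadicBox d (n + 1))
    (hy' : y' ∈ dyadicBox d (n + 1)) (h : boxChild n y = boxChild n y') :
    X.single.two y y' = (2 ^ d)⁻¹ * X.two (boxRest n y) (boxRest n y') := by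
  have h : {ω : X.single.Sample | y ∈ X.single.set ω ∧ y' ∈ X.single.set ω} =
      ({boxChild n y} : Set (Fin d → Bool)) ×ˢ
        {ω | boxRest n y ∈ X.set ω ∧ boxRest n y' ∈ X.set ω} := by
    ext ω
    exact ⟨fun h => ⟨(mem_single.1 h.1).2.1.symm, (mem_single.1 h.1).2.2, (mem_single.1 h.2).2.2⟩,
      fun h' => ⟨mem_single.2 ⟨hy, h'.1.symm, h'.2.1⟩, mem_single.2 ⟨hy', h.symm.trans h'.1.symm, h'.2.2⟩⟩⟩
  rw [two, h]
  change ((uniformOn (Set.univ : Set (Fin d → Bool))).prod X.law).real _ = _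
  rw [measureReal_prod_prod, uniformOn_univ_singleton, two]

lemma single_two_of_ne (X : BoxRandomSet d n) {y y' : Fin d → ℤ}
    (h : boxChild n y ≠ boxChild n y') : X.single.two y y' = 0 := by
  have h : {ω : X.single.Sample | y ∈ X.single.set ω ∧ y' ∈ X.single.set ω} = ∅ := by
    ext ω
    simp only [mem_single, Set.mem_ofPred_eq, Set.mem_empty_iff_false, iff_false]
    rintro ⟨⟨-, h1, -⟩, ⟨-, h2, -⟩⟩
    exact h (h1.trans h2.symm)
  rw [two, h, measureReal_empty]

/-- The random set that is kept with probability `p` and is empty otherwise. -/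
noncomputable def thin (X : BoxRandomSet d n) (p : unitInterval) : BoxRandomSet d n where
  Sample := X.Sample × Bool
  law := X.law.prod (ENNReal.ofReal p • Measure.dirac true +
    ENNReal.ofReal (unitInterval.symm p) • Measure.dirac false)
  isProb := by
    have : IsProbabilityMeasure (ENNReal.ofReal p • Measure.dirac true +
        ENNReal.ofReal (unitInterval.symm p) • Measure.dirac false : Measure Bool) := by
      constructor
      simp only [Measure.coe_add, Measure.coe_smul, Pi.add_apply, Pi.smul_apply, measure_univ,
        smul_eq_mul, mul_one]
      rw [← ENNReal.ofReal_add p.2.1 (unitInterval.symm p).2.1]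
      simp
    infer_instance
  set ω := if ω.2 then X.set ω.1 else ∅
  measurable_mem y := by
    have : {ω : X.Sample × Bool | y ∈ if ω.2 then X.set ω.1 else ∅} =
        {ω | y ∈ X.set ω} ×ˢ {true} := by
      ext ⟨ω, b⟩
      cases b <;> simp
    rw [this]
    exact (X.measurable_mem y).prod MeasurableSet.of_discrete
  subset_box ω := by
    split_ifs
    · exact X.subset_box _
    · exact Finset.empty_subset _

lemma thin_law_real (X : BoxRandomSet d n) (p : unitInterval) (E : Set X.Sample) :
    (X.thin p).law.real (E ×ˢ {true}) = p * X.law.real E := by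
  change (X.law.prod (ENNReal.ofReal p • Measure.dirac true +
    ENNReal.ofReal (unitInterval.symm p) • Measure.dirac false)).real _ = _
  have : (ENNReal.ofReal p • Measure.dirac true +
      ENNReal.ofReal (unitInterval.symm p) • Measure.dirac false : Measure Bool).real {true} = p := by
    rw [measureReal_def]
    simp [p.2.1]
  rw [measureReal_prod_prod, this, mul_comm]

lemma mem_thin {X : BoxRandomSet d n} {p : unitInterval} {ω : (X.thin p).Sample} {y : Fin d → ℤ} :
    y ∈ (X.thin p).set ω ↔ y ∈ X.set ω.1 ∧ ω.2 = true := by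
  obtain ⟨ω, b⟩ := ω
  cases b <;> simp [thin]

lemma thin_one (X : BoxRandomSet d n) (p : unitInterval) (y : Fin d → ℤ) :
    (X.thin p).one y = p * X.one y := by
  rw [one, one, ← thin_law_real]
  congr 1
  ext ω
  exact mem_thin

lemma thin_two (X : BoxRandomSet d n) (p : unitInterval) (y y' : Fin d → ℤ) :
    (X.thin p).two y y' = p * X.two y y' := by
  rw [two, two, ← thin_law_real]
  congr 1
  ext ω
  exact ⟨fun h => ⟨⟨(mem_thin.1 h.1).1, (mem_thin.1 h.2).1⟩, (mem_thin.1 h.1).2⟩,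
    fun h => ⟨mem_thin.2 ⟨h.1.1, h.2⟩, mem_thin.2 ⟨h.1.2, h.2⟩⟩⟩

lemma thin_hit (X : BoxRandomSet d n) (p : unitInterval) (K : Finset (Fin d → ℤ)) :
    (X.thin p).hit K = p * X.hit K := by
  rw [hit, hit, ← thin_law_real]
  congr 1
  ext ω
  constructor
  · rintro ⟨y, h1, h2⟩
    exact ⟨⟨y, h1, (mem_thin.1 h2).1⟩, (mem_thin.1 h2).2⟩
  · rintro ⟨⟨y, h1, h2⟩, h3⟩
    exact ⟨y, h1, mem_thin.2 ⟨h2, h3⟩⟩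

end BoxRandomSet

/-! ### Random sets with deterministic ball counts. -/

namespace BoxRandomSet

variable {d n : ℕ}

lemma image_corner_subset_branch (X : BoxRandomSet d n) (ω : X.branch.Sample) (ε : Fin d → Bool) :
    (X.set (ω ε)).image (boxCorner n ε + ·) ⊆ X.branch.set ω := by
  intro y hy
  obtain ⟨z, hz, rfl⟩ := Finset.mem_image.1 hy
  have hzb := X.subset_box _ hz
  rw [mem_branch]
  refine ⟨boxCorner_add_mem hzb ε, ?_⟩
  rw [boxChild_add hzb, boxRest_add hzb]
  exact hz

lemma branch_filter_child (X : BoxRandomSet d n) (ω : X.branch.Sample) (ε : Fin d → Bool) :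
    (X.branch.set ω).filter (fun y => boxChild n y = ε) =
      (X.set (ω ε)).image (boxCorner n ε + ·) := by
  ext y
  rw [Finset.mem_filter]
  constructor
  · rintro ⟨hy, rfl⟩
    exact Finset.mem_image.2 ⟨_, (mem_branch.1 hy).2, boxCorner_add_boxRest n y⟩
  · intro hy
    refine ⟨X.image_corner_subset_branch ω ε hy, ?_⟩
    obtain ⟨z, hz, rfl⟩ := Finset.mem_image.1 hy
    exact boxChild_add (X.subset_box _ hz) ε

lemma single_set_eq (X : BoxRandomSet d n) (ω : X.single.Sample) :
    X.single.set ω = (X.set ω.2).image (boxCorner n ω.1 + ·) := by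
  ext y
  constructor
  · intro hy
    obtain ⟨-, h1, h2⟩ := mem_single.1 hy
    refine Finset.mem_image.2 ⟨_, h2, ?_⟩
    rw [← h1]
    exact boxCorner_add_boxRest n y
  · intro hy
    obtain ⟨z, hz, rfl⟩ := Finset.mem_image.1 hy
    have hzb := X.subset_box _ hz
    refine mem_single.2 ⟨boxCorner_add_mem hzb _, boxChild_add hzb _, ?_⟩
    rw [boxRest_add hzb]
    exact hz

lemma card_branch (X : BoxRandomSet d n) {N : ℕ} (h : ∀ ω, (X.set ω).card = N)
    (ω : X.branch.Sample) : (X.branch.set ω).card = 2 ^ d * N := by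
  rw [Finset.card_eq_sum_card_fiberwise (f := boxChild n) (t := Finset.univ)
    (fun y _ => Finset.mem_coe.2 (Finset.mem_univ _))]
  simp only [branch_filter_child, Finset.card_image_of_injective _ (add_right_injective _), h]
  simp

lemma card_single (X : BoxRandomSet d n) {N : ℕ} (h : ∀ ω, (X.set ω).card = N)
    (ω : X.single.Sample) : (X.single.set ω).card = N := by
  rw [single_set_eq, Finset.card_image_of_injective _ (add_right_injective _), h]

/-- The points of the random set in the sup-norm ball of radius `2^m` around `r`. -/
def near (S : Finset (Fin d → ℤ)) (r : Fin d → ℤ) (m : ℕ) : Finset (Fin d → ℤ) :=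
  S.filter fun r' => ∀ i, |r i - r' i| < 2 ^ m

lemma card_near_le_of_image_subset {S S' : Finset (Fin d → ℤ)} {v r : Fin d → ℤ} (m : ℕ)
    (h : S.image (v + ·) ⊆ S') : (near S r m).card ≤ (near S' (v + r) m).card := by
  rw [← Finset.card_image_of_injective (near S r m) (add_right_injective v)]
  refine Finset.card_le_card fun y hy => ?_
  obtain ⟨z, hz, rfl⟩ := Finset.mem_image.1 hy
  rw [near, Finset.mem_filter] at hz ⊢
  refine ⟨h (Finset.mem_image_of_mem _ hz.1), fun i => ?_⟩
  have := hz.2 i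
  simpa using this

/-- The random set at scale `n` that branches fully at the scales where `f` jumps and chooses a
single child at the other scales. -/
noncomputable def regularSet (d : ℕ) (f : ℕ → ℕ) : (n : ℕ) → BoxRandomSet d n
  | 0 => point d
  | n + 1 => if f (n + 1) = f n then (regularSet d f n).single else (regularSet d f n).branch

lemma regularSet_succ_of_eq {f : ℕ → ℕ} (h : f (n + 1) = f n) :
    regularSet d f (n + 1) = (regularSet d f n).single := by
  rw [regularSet, if_pos h]

lemma regularSet_succ_of_ne {f : ℕ → ℕ} (h : f (n + 1) = f n + 1) :
    regularSet d f (n + 1) = (regularSet d f n).branch := by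
  rw [regularSet, if_neg (by omega)]

variable {f : ℕ → ℕ} (h0 : f 0 = 0) (hf : ∀ n, f (n + 1) = f n ∨ f (n + 1) = f n + 1)

include h0 hf

lemma card_regularSet (n : ℕ) : ∀ ω, ((regularSet d f n).set ω).card = 2 ^ (d * f n) := by
  induction n with
  | zero => intro ω; rw [h0]; rfl
  | succ n ih =>
    rcases hf n with h | h
    · rw [regularSet_succ_of_eq h, h]
      exact card_single _ ih
    · rw [regularSet_succ_of_ne h, h, mul_add, mul_one, pow_add, mul_comm]
      exact card_branch _ ih

/-- Inside the dyadic cube of side 2^m containing r the set is a translate of a realisation at scale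
m, with exactly 2^(d f(m)) points, all at sup-distance less than 2^m from r. -/
lemma near_regularSet (n : ℕ) : ∀ ω, ∀ r ∈ (regularSet d f n).set ω, ∀ m ≤ n,
    2 ^ (d * f m) ≤ (near ((regularSet d f n).set ω) r m).card := by
  have htop : ∀ n, ∀ ω, ∀ r ∈ (regularSet d f n).set ω,
      2 ^ (d * f n) ≤ (near ((regularSet d f n).set ω) r n).card := by
    intro n ω r hr
    rw [← card_regularSet h0 hf n ω, near, Finset.filter_true_of_mem]
    intro r' hr' i
    exact abs_sub_lt_of_mem_dyadicBox (subset_box _ ω hr) (subset_box _ ω hr') i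
  induction n with
  | zero =>
    intro ω r hr m hm
    obtain rfl : m = 0 := by omega
    exact htop 0 ω r hr
  | succ n ih =>
    intro ω r hr m hm
    rcases hm.lt_or_eq with hm | rfl
    · have hm : m ≤ n := by omega
      rcases hf n with h | h
      · revert ω
        rw [regularSet_succ_of_eq h]
        intro ω hr
        rw [single_set_eq] at hr ⊢
        obtain ⟨z, hz, rfl⟩ := Finset.mem_image.1 hr
        exact (ih _ z hz m hm).trans (card_near_le_of_image_subset m subset_rfl)
      · revert ω
        rw [regularSet_succ_of_ne h]
        intro ω hr
        have h1 := (mem_branch.1 hr).2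
        have h2 := (ih _ _ h1 m hm).trans
          (card_near_le_of_image_subset m (image_corner_subset_branch _ ω _))
        rwa [boxCorner_add_boxRest] at h2
    · exact htop _ ω r hr

/-- Every point of the box is equally likely: choosing one child divides the probability by 2^d,
full branching leaves it unchanged. -/
lemma regularSet_one (n : ℕ) : ∀ y ∈ dyadicBox d n,
    (regularSet d f n).one y = 2 ^ (d * f n) / 2 ^ (d * n) := by
  induction n with
  | zero =>
    intro y hy
    rw [dyadicBox_zero, Finset.mem_singleton] at hy
    subst hy
    rw [regularSet, point_one, h0]; simp
  | succ n ih =>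
    intro y hy
    rcases hf n with h | h
    · rw [regularSet_succ_of_eq h, single_one _ hy, ih _ (boxRest_mem hy), h, mul_add, mul_one,
        pow_add]
      field_simp
    · rw [regularSet_succ_of_ne h, branch_one _ hy, ih _ (boxRest_mem hy), h, mul_add, mul_one,
        pow_add, mul_add, mul_one, pow_add]
      field_simp

omit h0 hf

/-- The constant in the bounds for two-point functions. -/
noncomputable def twoPointConst (d : ℕ) (α : ℝ) : ℝ := ((Real.sqrt d + 1) * 2) ^ α

lemma twoPointConst_pos (d : ℕ) (α : ℝ) : 0 < twoPointConst d α := by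
  have := Real.sqrt_nonneg (d : ℝ)
  exact Real.rpow_pos_of_pos (by positivity) _

lemma one_le_twoPointConst (d : ℕ) {α : ℝ} (hα : 0 ≤ α) : 1 ≤ twoPointConst d α := by
  have := Real.sqrt_nonneg (d : ℝ)
  exact Real.one_le_rpow (by linarith) hα

lemma le_twoPointConst_mul {α : ℝ} (hα : 0 ≤ α) {y y' : Fin d → ℤ}
    (hy : y ∈ dyadicBox d (n + 1)) (hy' : y' ∈ dyadicBox d (n + 1)) :
    ((2 : ℝ) ^ n) ^ (-α) ≤ twoPointConst d α * bracket (y - y') ^ (-α) := by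
  have hs := Real.sqrt_nonneg (d : ℝ)
  have h1 := bracket_sub_le_of_mem_dyadicBox hy hy'
  have h2 : ((Real.sqrt d + 1) * 2 ^ (n + 1)) ^ (-α) ≤ bracket (y - y') ^ (-α) :=
    Real.rpow_le_rpow_of_nonpos (bracket_pos _) h1 (by linarith)
  have h3 : (Real.sqrt d + 1) * 2 ^ (n + 1) = ((Real.sqrt d + 1) * 2) * 2 ^ n := by ring
  rw [h3, Real.mul_rpow (by positivity) (by positivity)] at h2
  have h4 : (0 : ℝ) < (Real.sqrt d + 1) * 2 := by positivity
  calc ((2 : ℝ) ^ n) ^ (-α) = twoPointConst d α *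
        (((Real.sqrt d + 1) * 2) ^ (-α) * ((2 : ℝ) ^ n) ^ (-α)) := by
        rw [twoPointConst, ← mul_assoc, ← Real.rpow_add h4]; simp
    _ ≤ _ := mul_le_mul_of_nonneg_left h2 (twoPointConst_pos d α).le

/-- Points in different children are independent, so their two-point function is q². One factor q is
at most 2^(-nα), and hence at most a constant times the kernel, because the box has diameter of
order 2^n. -/
lemma branch_two_le (X : BoxRandomSet d n) {α q : ℝ} (hα : 0 ≤ α) (hq : 0 ≤ q)
    (hqn : q ≤ ((2 : ℝ) ^ n) ^ (-α)) (h1 : ∀ y ∈ dyadicBox d n, X.one y = q)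
    (h2 : ∀ y ∈ dyadicBox d n, ∀ y' ∈ dyadicBox d n,
      X.two y y' ≤ q * (twoPointConst d α * bracket (y - y') ^ (-α)))
    {y y' : Fin d → ℤ} (hy : y ∈ dyadicBox d (n + 1)) (hy' : y' ∈ dyadicBox d (n + 1)) :
    X.branch.two y y' ≤ q * (twoPointConst d α * bracket (y - y') ^ (-α)) := by
  by_cases h : boxChild n y = boxChild n y'
  · rw [branch_two_of_eq _ hy hy' h, ← boxRest_sub_boxRest h]
    exact h2 _ (boxRest_mem hy) _ (boxRest_mem hy')
  · rw [branch_two_of_ne _ hy hy' h, h1 _ (boxRest_mem hy), h1 _ (boxRest_mem hy')]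
    gcongr
    exact hqn.trans (le_twoPointConst_mul hα hy hy')

/-- Choosing one child divides the two-point function by 2^d within a child, as it does the density,
and excludes pairs in different children. Full branching is `branch_two_le`, for which `hfα` bounds
the density. -/
lemma regularSet_two_le (h0 : f 0 = 0) (hf : ∀ n, f (n + 1) = f n ∨ f (n + 1) = f n + 1) {α : ℝ}
    (hα : 0 ≤ α) (hfα : ∀ n, (2 : ℝ) ^ (d * f n) / 2 ^ (d * n) ≤ (2 ^ n) ^ (-α)) (n : ℕ) :
    ∀ y ∈ dyadicBox d n, ∀ y' ∈ dyadicBox d n, (regularSet d f n).two y y' ≤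
      2 ^ (d * f n) / 2 ^ (d * n) * (twoPointConst d α * bracket (y - y') ^ (-α)) := by
  induction n with
  | zero =>
    intro y hy y' hy'
    rw [dyadicBox_zero, Finset.mem_singleton] at hy hy'
    subst hy hy'
    rw [regularSet, point_two, h0, sub_zero, bracket_zero]
    simpa using one_le_twoPointConst d hα
  | succ n ih =>
    intro y hy y' hy'
    rcases hf n with h | h
    · rw [regularSet_succ_of_eq h]
      by_cases hc : boxChild n y = boxChild n y'
      · rw [single_two_of_eq _ hy hy' hc, ← boxRest_sub_boxRest hc]
        have := ih _ (boxRest_mem hy) _ (boxRest_mem hy')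
        calc _ ≤ ((2 : ℝ) ^ d)⁻¹ * (2 ^ (d * f n) / 2 ^ (d * n) * (twoPointConst d α *
              bracket (boxRest n y - boxRest n y') ^ (-α))) := by gcongr
          _ = _ := by
              rw [h, mul_add, mul_one, pow_add]
              field_simp
      · rw [single_two_of_ne _ hc]
        have := twoPointConst_pos d α
        have := bracket_rpow_nonneg (y - y') (-α)
        positivity
    · rw [regularSet_succ_of_ne h]
      have e : (2 : ℝ) ^ (d * f (n + 1)) / 2 ^ (d * (n + 1)) = 2 ^ (d * f n) / 2 ^ (d * n) := by
        rw [h, mul_add, mul_one, pow_add, mul_add, mul_one, pow_add]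
        field_simp
      rw [e]
      exact branch_two_le _ hα (by positivity) (hfα n) (regularSet_one h0 hf n) ih hy hy'

/-- The second moment bound: a random set with the two-point function of a set of codimension `α`
meets `K` with probability at least of order `q Cap_α(K)`. -/
lemma mul_newtonCap_le_hit (X : BoxRandomSet d n) {α q C : ℝ} (hq : 0 < q) (hC : 0 ≤ C)
    (h1 : ∀ y ∈ dyadicBox d n, X.one y = q)
    (h2 : ∀ y ∈ dyadicBox d n, ∀ y' ∈ dyadicBox d n,
      X.two y y' ≤ q * (C * bracket (y - y') ^ (-α)))
    {K : Finset (Fin d → ℤ)} (hK : K ⊆ dyadicBox d n) :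
    q * newtonCap α K ≤ C * X.hit K := by
  have hhit := X.hit_nonneg K
  have key : newtonCap α K ≤ C * X.hit K / q := by
    refine newtonCap_le_of_forall (by positivity) fun μ hμ => ?_
    -- The μ-mass of the random set has mean q and second moment at most q C times the energy of μ,
    -- while it is positive only on the hitting event.
    have := sq_sum_measure_le X.law K μ (fun y => {ω | y ∈ X.set ω}) X.measurable_mem
      (X.measurable_hit K) (fun y hy ω hω => ⟨y, hy, hω⟩)
    have e1 : ∑ y ∈ K, μ y * X.law.real {ω | y ∈ X.set ω} = q := by
      calc _ = ∑ y ∈ K, μ y * q := Finset.sum_congr rfl fun y hy => by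
            rw [← h1 y (hK hy)]; rfl
        _ = q := by rw [← Finset.sum_mul, hμ.2, one_mul]
    have e2 : ∑ y ∈ K, ∑ y' ∈ K, μ y * μ y' *
        X.law.real ({ω | y ∈ X.set ω} ∩ {ω | y' ∈ X.set ω}) ≤ q * C * rieszEnergy α K μ := by
      rw [rieszEnergy_eq, Finset.mul_sum]
      refine Finset.sum_le_sum fun y hy => ?_
      rw [Finset.mul_sum]
      refine Finset.sum_le_sum fun y' hy' => ?_
      have hnn := mul_nonneg (hμ.1 y hy) (hμ.1 y' hy')
      calc μ y * μ y' * X.law.real ({ω | y ∈ X.set ω} ∩ {ω | y' ∈ X.set ω})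
          ≤ μ y * μ y' * (q * (C * bracket (y - y') ^ (-α))) := by
            gcongr
            exact h2 y (hK hy) y' (hK hy')
        _ = _ := by ring
    rw [e1] at this
    have h3 : q ^ 2 ≤ X.hit K * (q * C * rieszEnergy α K μ) :=
      this.trans (mul_le_mul_of_nonneg_left e2 hhit)
    rw [div_mul_eq_mul_div, le_div_iff₀ hq, one_mul]
    nlinarith
  rw [le_div_iff₀ hq] at key
  linarith

end BoxRandomSet

/-- For every scale there is a random set with deterministic lower ball counts of a set of
dimension `d - α` that meets every `K` with probability at least of order `2^(-nα) Cap_α(K)`. -/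
theorem exists_regular_randomSet (d : ℕ) (hd : 1 ≤ d) (α : ℝ) (hα : 0 < α) (hαd : α < d) :
    ∃ C : ℝ, 0 < C ∧ ∀ n : ℕ, ∃ X : BoxRandomSet d n,
      (∀ ω, ((X.set ω).card : ℝ) ≤ (2 ^ n) ^ ((d : ℝ) - α)) ∧
      (∀ ω, ∀ r ∈ X.set ω, ∀ m ≤ n, (2 ^ m) ^ ((d : ℝ) - α) ≤
        2 ^ d * ((BoxRandomSet.near (X.set ω) r m).card : ℝ)) ∧
      ∀ K ⊆ dyadicBox d n, (2 ^ n) ^ (-α) * newtonCap α K ≤ C * X.hit K := by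
  have hd0 : (0 : ℝ) < d := by exact_mod_cast hd
  set θ : ℝ := (d - α) / d with hθ
  have hθ0 : 0 < θ := div_pos (by linarith) hd0
  have hθ1 : θ < 1 := by rw [hθ, div_lt_one hd0]; linarith
  -- Since 0 < θ < 1 this f jumps by 0 or 1, and d f(n) lies between n (d - α) - d and n (d - α).
  -- The rounding error d is the source of the factors 2^d.
  set f : ℕ → ℕ := fun n => ⌊(n : ℝ) * θ⌋₊ with hfdef
  have h0 : f 0 = 0 := by simp [hfdef]
  have hf : ∀ n, f (n + 1) = f n ∨ f (n + 1) = f n + 1 := by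
    intro n
    have h1 : f n ≤ f (n + 1) := Nat.floor_mono (by push_cast; nlinarith)
    have h2 : f (n + 1) < f n + 2 := by
      rw [hfdef, Nat.floor_lt (by positivity)]
      have := Nat.lt_floor_add_one ((n : ℝ) * θ)
      push_cast
      nlinarith
    omega
  have hup : ∀ n : ℕ, (d : ℝ) * f n ≤ n * (d - α) := by
    intro n
    have h1 : (f n : ℝ) ≤ n * θ := Nat.floor_le (by positivity)
    calc (d : ℝ) * f n ≤ d * (n * θ) := by gcongr
      _ = n * (d - α) := by rw [hθ]; field_simp
  have hlo : ∀ n : ℕ, (n : ℝ) * (d - α) ≤ d + d * f n := by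
    intro n
    have h1 : (n : ℝ) * θ ≤ f n + 1 := (Nat.lt_floor_add_one _).le
    calc (n : ℝ) * (d - α) = d * (n * θ) := by rw [hθ]; field_simp
      _ ≤ d * (f n + 1) := by gcongr
      _ = _ := by ring
  have hpow : ∀ (n : ℕ) (a : ℝ), ((2 : ℝ) ^ n) ^ a = 2 ^ ((n : ℝ) * a) := by
    intro n a
    rw [← Real.rpow_natCast, ← Real.rpow_mul (by norm_num)]
  have hcard : ∀ n, (2 : ℝ) ^ (d * f n) ≤ (2 ^ n) ^ ((d : ℝ) - α) := by
    intro n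
    rw [hpow, ← Real.rpow_natCast]
    exact Real.rpow_le_rpow_of_exponent_le (by norm_num) (by push_cast; exact hup n)
  have hcard' : ∀ n, (2 ^ n) ^ ((d : ℝ) - α) ≤ (2 : ℝ) ^ d * 2 ^ (d * f n) := by
    intro n
    rw [hpow, ← pow_add, ← Real.rpow_natCast]
    exact Real.rpow_le_rpow_of_exponent_le (by norm_num) (by push_cast; exact hlo n)
  have hsplit : ∀ n : ℕ, ((2 : ℝ) ^ n) ^ ((d : ℝ) - α) = 2 ^ (d * n) * (2 ^ n) ^ (-α) := by
    intro n
    rw [sub_eq_add_neg, Real.rpow_add (by positivity), Real.rpow_natCast, ← pow_mul, mul_comm n d]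
  have hfα : ∀ n, (2 : ℝ) ^ (d * f n) / 2 ^ (d * n) ≤ (2 ^ n) ^ (-α) := by
    intro n
    rw [div_le_iff₀ (by positivity), mul_comm (((2 : ℝ) ^ n) ^ (-α)), ← hsplit]
    exact hcard n
  refine ⟨2 ^ d * BoxRandomSet.twoPointConst d α,
    mul_pos (by positivity) (BoxRandomSet.twoPointConst_pos d α), fun n =>
      ⟨BoxRandomSet.regularSet d f n, fun ω => ?_, fun ω r hr m hm => ?_, fun K hK => ?_⟩⟩
  · rw [BoxRandomSet.card_regularSet h0 hf]
    push_cast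
    exact hcard n
  · refine (hcard' m).trans ?_
    gcongr
    exact_mod_cast BoxRandomSet.near_regularSet h0 hf n ω r hr m hm
  · have h1 := BoxRandomSet.mul_newtonCap_le_hit (BoxRandomSet.regularSet d f n) (α := α)
      (q := 2 ^ (d * f n) / 2 ^ (d * n)) (by positivity) (BoxRandomSet.twoPointConst_pos d α).le
      (BoxRandomSet.regularSet_one h0 hf n) (BoxRandomSet.regularSet_two_le h0 hf hα.le hfα n) hK
    have h2 : ((2 : ℝ) ^ n) ^ (-α) ≤ 2 ^ d * (2 ^ (d * f n) / 2 ^ (d * n)) := by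
      rw [← mul_div_assoc, le_div_iff₀ (by positivity), mul_comm, ← hsplit]
      exact hcard' n
    have h3 := newtonCap_nonneg α K
    calc ((2 : ℝ) ^ n) ^ (-α) * newtonCap α K
        ≤ 2 ^ d * (2 ^ (d * f n) / 2 ^ (d * n)) * newtonCap α K := by gcongr
      _ = 2 ^ d * (2 ^ (d * f n) / 2 ^ (d * n) * newtonCap α K) := by ring
      _ ≤ 2 ^ d * (BoxRandomSet.twoPointConst d α * _) := by gcongr
      _ = _ := by ring

/-! ### Fractal percolation and its hitting probabilities. -/

namespace BoxRandomSet

variable {d n : ℕ}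

/-- Fractal percolation with retention probability `p`. -/
noncomputable def percolation (d : ℕ) (p : unitInterval) : (n : ℕ) → BoxRandomSet d n
  | 0 => point d
  | n + 1 => (percolation d p n).branch.thin p

lemma percolation_one (p : unitInterval) (n : ℕ) : ∀ y ∈ dyadicBox d n,
    (percolation d p n).one y = (p : ℝ) ^ n := by
  induction n with
  | zero =>
    intro y hy
    rw [dyadicBox_zero, Finset.mem_singleton] at hy
    subst hy
    rw [percolation, point_one, pow_zero]
  | succ n ih =>
    intro y hy
    rw [percolation, thin_one, branch_one _ hy, ih _ (boxRest_mem hy), pow_succ, mul_comm]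

lemma percolation_two_le (p : unitInterval) {α : ℝ} (hα : 0 ≤ α) (hp : (p : ℝ) = 2 ^ (-α)) (n : ℕ) :
    ∀ y ∈ dyadicBox d n, ∀ y' ∈ dyadicBox d n, (percolation d p n).two y y' ≤
      (p : ℝ) ^ n * (twoPointConst d α * bracket (y - y') ^ (-α)) := by
  have hp0 : (0 : ℝ) ≤ p := p.2.1
  induction n with
  | zero =>
    intro y hy y' hy'
    rw [dyadicBox_zero, Finset.mem_singleton] at hy hy'
    subst hy hy'
    rw [percolation, point_two, sub_zero, bracket_zero]
    simpa using one_le_twoPointConst d hα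
  | succ n ih =>
    intro y hy y' hy'
    rw [percolation, thin_two, pow_succ, mul_comm ((p : ℝ) ^ n), mul_assoc]
    gcongr
    exact branch_two_le _ hα (by positivity) (by rw [two_rpow_mul_nat, hp])
      (percolation_one p n) ih hy hy'

lemma boxChild_eq_of_ediv_eq {m : ℕ} {y y' : Fin d → ℤ} (hm : m ≤ n)
    (h : ∀ i, y i / 2 ^ m = y' i / 2 ^ m) : boxChild n y = boxChild n y' := by
  funext i
  have key : ∀ z : ℤ, 2 ^ n ≤ z ↔ 2 ^ (n - m) ≤ z / 2 ^ m := by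
    intro z
    rw [Int.le_ediv_iff_mul_le (by positivity), ← pow_add, Nat.sub_add_cancel hm]
  simp only [boxChild, key, h i]

lemma boxRest_ediv_eq {m : ℕ} {y y' : Fin d → ℤ} (hm : m ≤ n)
    (h : ∀ i, y i / 2 ^ m = y' i / 2 ^ m) (i : Fin d) :
    boxRest n y i / 2 ^ m = boxRest n y' i / 2 ^ m := by
  have h2 : (2 : ℤ) ^ m ≠ 0 := by positivity
  rw [boxRest, boxRest, boxChild_eq_of_ediv_eq hm h, Pi.sub_apply, Pi.sub_apply]
  generalize boxChild n y' = ε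
  simp only [boxCorner]
  split_ifs
  · have e : (2 : ℤ) ^ n = 2 ^ (n - m) * 2 ^ m := by rw [← pow_add, Nat.sub_add_cancel hm]
    rw [e, Int.sub_mul_ediv_right _ _ h2, Int.sub_mul_ediv_right _ _ h2, h i]
  · simpa using h i

/-- Two points in a common dyadic cube of side 2^m share the retentions above that scale, so at most
(n - m) + 2m retentions are needed for both to survive. -/
lemma le_percolation_two (p : unitInterval) (n : ℕ) :
    ∀ y ∈ dyadicBox d n, ∀ y' ∈ dyadicBox d n, ∀ m ≤ n, (∀ i, y i / 2 ^ m = y' i / 2 ^ m) →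
      (p : ℝ) ^ (n + m) ≤ (percolation d p n).two y y' := by
  have hp0 : (0 : ℝ) ≤ p := p.2.1
  have hp1 : (p : ℝ) ≤ 1 := p.2.2
  induction n with
  | zero =>
    intro y hy y' hy' m hm _
    rw [dyadicBox_zero, Finset.mem_singleton] at hy hy'
    subst hy hy'
    obtain rfl : m = 0 := by omega
    rw [percolation, point_two]; simp
  | succ n ih =>
    intro y hy y' hy' m hm h
    rw [percolation, thin_two]
    rcases hm.lt_or_eq with hm | rfl
    · have hm : m ≤ n := by omega
      have hc := boxChild_eq_of_ediv_eq hm h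
      rw [branch_two_of_eq _ hy hy' hc]
      calc (p : ℝ) ^ (n + 1 + m) = p * p ^ (n + m) := by ring
        _ ≤ _ := by
          gcongr
          exact ih _ (boxRest_mem hy) _ (boxRest_mem hy') m hm (boxRest_ediv_eq hm h)
    · have h1 : (p : ℝ) ^ (n + 1 + (n + 1)) ≤ p * p ^ (n + n) := by
        rw [← pow_succ']
        exact pow_le_pow_of_le_one hp0 hp1 (by omega)
      refine h1.trans ?_
      gcongr
      by_cases hc : boxChild n y = boxChild n y'
      · rw [branch_two_of_eq _ hy hy' hc]
        refine ih _ (boxRest_mem hy) _ (boxRest_mem hy') n le_rfl fun i => ?_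
        have a1 := mem_dyadicBox.1 (boxRest_mem hy) i
        have a2 := mem_dyadicBox.1 (boxRest_mem hy') i
        rw [Int.ediv_eq_zero_of_lt a1.1 a1.2, Int.ediv_eq_zero_of_lt a2.1 a2.2]
      · rw [branch_two_of_ne _ hy hy' hc, percolation_one p n _ (boxRest_mem hy),
          percolation_one p n _ (boxRest_mem hy'), pow_add]

/-- Transport of a sum over the part of `K` in one child. -/
lemma sum_ite_child (K : Finset (Fin d → ℤ)) (ε : Fin d → Bool) (g : (Fin d → ℤ) → ℝ) :
    ∑ y ∈ K, (if boxChild n y = ε then g (boxRest n y) else 0) = ∑ z ∈ childPart n K ε, g z := by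
  rw [← Finset.sum_filter, childPart, Finset.sum_image]
  intro y hy y' hy' h
  exact boxRest_injOn ((Finset.mem_filter.1 hy).2.trans (Finset.mem_filter.1 hy').2.symm) h

/-- The measures of the children of a box combine into a measure whose mass is the hitting
probability and whose energy is at most of the order of its mass. -/
lemma exists_branch_measure (X : BoxRandomSet d n) {q : ℝ}
    (h1 : ∀ y ∈ dyadicBox d n, X.one y = q)
    (h2 : ∀ K ⊆ dyadicBox d n, ∃ ν : (Fin d → ℤ) → ℝ, (∀ y, 0 ≤ ν y) ∧ ∑ y ∈ K, ν y = X.hit K ∧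
      ∑ y ∈ K, ∑ y' ∈ K, ν y * ν y' * X.two y y' ≤ 2 * q ^ 2 * X.hit K)
    {K : Finset (Fin d → ℤ)} (hK : K ⊆ dyadicBox d (n + 1)) :
    ∃ ν : (Fin d → ℤ) → ℝ, (∀ y, 0 ≤ ν y) ∧ ∑ y ∈ K, ν y = X.branch.hit K ∧
      ∑ y ∈ K, ∑ y' ∈ K, ν y * ν y' * X.branch.two y y' ≤ 2 * q ^ 2 * X.branch.hit K := by
  -- The children are explored one after another, T being the set already explored.
  suffices H : ∀ T : Finset (Fin d → Bool), ∃ ν : (Fin d → ℤ) → ℝ, (∀ y, 0 ≤ ν y) ∧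
      (∀ y, ν y ≠ 0 → boxChild n y ∈ T) ∧
      ∑ y ∈ K, ν y = 1 - ∏ ε ∈ T, (1 - X.hit (childPart n K ε)) ∧
      ∑ y ∈ K, ∑ y' ∈ K, ν y * ν y' * X.branch.two y y' ≤
        2 * q ^ 2 * (1 - ∏ ε ∈ T, (1 - X.hit (childPart n K ε))) by
    rw [branch_hit X hK]
    obtain ⟨ν, hν, -, hs, hE⟩ := H Finset.univ
    exact ⟨ν, hν, hs, hE⟩
  intro T
  induction T using Finset.induction_on with
  | empty => exact ⟨0, by simp, by simp, by simp, by simp⟩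
  | insert ε T hε ih =>
    obtain ⟨ν, hν, hνT, hs, hE⟩ := ih
    obtain ⟨ν₀, hν₀, hs₀, hE₀⟩ := h2 _ (childPart_subset hK ε)
    rw [Finset.prod_insert hε]
    set h := X.hit (childPart n K ε) with hh
    set Q := ∏ ε ∈ T, (1 - X.hit (childPart n K ε)) with hQ
    have hQ0 : 0 ≤ Q := Finset.prod_nonneg fun ε _ => sub_nonneg.2 (X.hit_le_one _)
    set ν₁ : (Fin d → ℤ) → ℝ := fun y => if boxChild n y = ε then ν₀ (boxRest n y) else 0 with hν₁
    have hν₁0 : ∀ y, 0 ≤ ν₁ y := by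
      intro y
      simp only [hν₁]
      split_ifs
      · exact hν₀ _
      · exact le_rfl
    have hs₁ : ∑ y ∈ K, ν₁ y = h := by rw [← hs₀]; exact sum_ite_child K ε ν₀
    have hcross : ∀ y ∈ K, ∀ y' ∈ K, ν y * ν₁ y' ≠ 0 →
        boxChild n y ≠ boxChild n y' := by
      intro y _ y' _ hne heq
      have a1 := hνT y (left_ne_zero_of_mul hne)
      have a2 : boxChild n y' = ε := by
        by_contra hc
        exact right_ne_zero_of_mul hne (if_neg hc)
      rw [heq, a2] at a1
      exact hε a1
    have hcr1 : ∑ y ∈ K, ∑ y' ∈ K, ν y * ν₁ y' * X.branch.two y y' =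
        q ^ 2 * ((∑ y ∈ K, ν y) * ∑ y ∈ K, ν₁ y) := by
      rw [Finset.sum_mul_sum, Finset.mul_sum]
      refine Finset.sum_congr rfl fun y hy => ?_
      rw [Finset.mul_sum]
      refine Finset.sum_congr rfl fun y' hy' => ?_
      by_cases hne : ν y * ν₁ y' = 0
      · rw [hne]; ring
      · rw [branch_two_of_ne X (hK hy) (hK hy') (hcross y hy y' hy' hne), h1 _ (boxRest_mem (hK hy)),
          h1 _ (boxRest_mem (hK hy'))]
        ring
    have hcr2 : ∑ y ∈ K, ∑ y' ∈ K, ν₁ y * ν y' * X.branch.two y y' =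
        q ^ 2 * ((∑ y ∈ K, ν y) * ∑ y ∈ K, ν₁ y) := by
      rw [← hcr1, Finset.sum_comm]
      refine Finset.sum_congr rfl fun y hy => Finset.sum_congr rfl fun y' hy' => ?_
      have : X.branch.two y' y = X.branch.two y y' := by
        simp only [two, and_comm]
      rw [this]; ring
    have hdiag : ∑ y ∈ K, ∑ y' ∈ K, ν₁ y * ν₁ y' * X.branch.two y y' =
        ∑ z ∈ childPart n K ε, ∑ z' ∈ childPart n K ε, ν₀ z * ν₀ z' * X.two z z' := by
      rw [← sum_ite_child]
      refine Finset.sum_congr rfl fun y hy => ?_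
      split_ifs with hc
      · rw [← sum_ite_child]
        refine Finset.sum_congr rfl fun y' hy' => ?_
        simp only [hν₁]
        rw [if_pos hc]
        split_ifs with hc'
        · rw [branch_two_of_eq X (hK hy) (hK hy') (hc.trans hc'.symm)]
        · simp
      · refine Finset.sum_eq_zero fun y' _ => ?_
        simp [hν₁, hc]
    -- A new child receives its measure weighted by the probability Q that all explored children
    -- miss K, as in a decomposition by the first child that is hit.
    refine ⟨fun y => ν y + Q * ν₁ y, fun y => add_nonneg (hν y) (mul_nonneg hQ0 (hν₁0 y)),
      fun y hy => ?_, ?_, ?_⟩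
    · rw [Finset.mem_insert]
      by_contra hc
      push Not at hc
      have a1 : ν y = 0 := by
        by_contra h0
        exact hc.2 (hνT y h0)
      have a2 : ν₁ y = 0 := if_neg hc.1
      exact hy (by simp [a1, a2])
    · rw [Finset.sum_add_distrib, ← Finset.mul_sum, hs, hs₁]; ring
    · have expand : ∑ y ∈ K, ∑ y' ∈ K, (ν y + Q * ν₁ y) * (ν y' + Q * ν₁ y') * X.branch.two y y' =
          ∑ y ∈ K, ∑ y' ∈ K, ν y * ν y' * X.branch.two y y' +
          Q * ∑ y ∈ K, ∑ y' ∈ K, ν y * ν₁ y' * X.branch.two y y' +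
          Q * ∑ y ∈ K, ∑ y' ∈ K, ν₁ y * ν y' * X.branch.two y y' +
          Q ^ 2 * ∑ y ∈ K, ∑ y' ∈ K, ν₁ y * ν₁ y' * X.branch.two y y' := by
        simp only [Finset.mul_sum, ← Finset.sum_add_distrib]
        refine Finset.sum_congr rfl fun y _ => Finset.sum_congr rfl fun y' _ => ?_
        ring
      rw [expand, hcr1, hcr2, hdiag, hs, hs₁]
      have e0 : Q ^ 2 * ∑ z ∈ childPart n K ε, ∑ z' ∈ childPart n K ε, ν₀ z * ν₀ z' * X.two z z' ≤
          Q ^ 2 * (2 * q ^ 2 * h) := mul_le_mul_of_nonneg_left hE₀ (by positivity)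
      -- The two cross terms add up to 2 q² Q (1 - Q) h. With the constant 2 in the energy bound the
      -- right-hand side is exactly 2 q² (1 - (1 - h) Q), so the induction closes without loss.
      calc _ ≤ 2 * q ^ 2 * (1 - Q) + Q * (q ^ 2 * ((1 - Q) * h)) + Q * (q ^ 2 * ((1 - Q) * h)) +
            Q ^ 2 * (2 * q ^ 2 * h) := by gcongr
        _ = _ := by ring

/-- This is a converse to the second moment method. Under thinning by p, the measure is multiplied
by p and so is the two-point function: the energy gains p³, exactly the p² of the squared density
times the p of the hitting probability. -/
lemma exists_percolation_measure (p : unitInterval) (n : ℕ) :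
    ∀ K ⊆ dyadicBox d n, ∃ ν : (Fin d → ℤ) → ℝ, (∀ y, 0 ≤ ν y) ∧
      ∑ y ∈ K, ν y = (percolation d p n).hit K ∧
      ∑ y ∈ K, ∑ y' ∈ K, ν y * ν y' * (percolation d p n).two y y' ≤
        2 * ((p : ℝ) ^ n) ^ 2 * (percolation d p n).hit K := by
  have hp0 : (0 : ℝ) ≤ p := p.2.1
  induction n with
  | zero =>
    intro K hK
    rw [dyadicBox_zero, Finset.subset_singleton_iff] at hK
    rcases hK with rfl | rfl
    · exact ⟨0, by simp, by simp [hit], by simp [hit]⟩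
    · have hh : (percolation d p 0).hit {0} = 1 := by
        rw [percolation, ← point_one d, hit, one]
        simp
      refine ⟨fun _ => 1, fun _ => zero_le_one, by simp [hh], ?_⟩
      rw [hh, percolation]
      simp [point_two]
  | succ n ih =>
    intro K hK
    obtain ⟨ν, hν, hs, hE⟩ := exists_branch_measure (percolation d p n) (q := (p : ℝ) ^ n)
      (percolation_one p n) ih hK
    refine ⟨fun y => p * ν y, fun y => mul_nonneg hp0 (hν y), ?_, ?_⟩
    · rw [percolation, thin_hit, ← Finset.mul_sum, hs]
    · rw [percolation]
      simp only [thin_two, thin_hit]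
      calc _ = (p : ℝ) ^ 3 * ∑ y ∈ K, ∑ y' ∈ K, ν y * ν y' * (percolation d p n).branch.two y y' := by
            simp only [Finset.mul_sum]
            refine Finset.sum_congr rfl fun y _ => Finset.sum_congr rfl fun y' _ => ?_
            ring
        _ ≤ (p : ℝ) ^ 3 * (2 * ((p : ℝ) ^ n) ^ 2 * (percolation d p n).branch.hit K) := by gcongr
        _ = _ := by ring

end BoxRandomSet

/-! ### Comparison of the Euclidean kernel with dyadic kernels. -/

section KernelComparison

/-- Cauchy–Schwarz for translates of a partition. -/
lemma sum_sum_ite_add_le {V W : Type*} [AddGroup W] [DecidableEq W] (K : Finset V) (ν : V → ℝ)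
    (c : V → W) (e : W) :
    ∑ y ∈ K, ∑ y' ∈ K, ν y * ν y' * (if c y' = c y + e then 1 else 0) ≤
      ∑ y ∈ K, ∑ y' ∈ K, ν y * ν y' * (if c y' = c y then 1 else 0) := by
  set F : W → ℝ := fun w => ∑ y ∈ K, ν y * (if c y = w then 1 else 0) with hF
  have hF0 : ∀ w, w ∉ K.image c → F w = 0 := by
    intro w hw
    refine Finset.sum_eq_zero fun y hy => ?_
    rw [if_neg, mul_zero]
    rintro rfl
    exact hw (Finset.mem_image_of_mem _ hy)
  have key : ∀ e : W, ∑ y ∈ K, ∑ y' ∈ K, ν y * ν y' * (if c y' = c y + e then 1 else 0) =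
      ∑ w ∈ K.image c, F w * F (w + e) := by
    intro e
    have : ∀ w ∈ K.image c, F w * F (w + e) =
        ∑ y ∈ K, ν y * F (w + e) * (if c y = w then 1 else 0) := by
      intro w _
      simp only [hF]
      rw [Finset.sum_mul]
      exact Finset.sum_congr rfl fun y _ => by ring
    rw [Finset.sum_congr rfl this]
    symm
    rw [Finset.sum_comm]
    refine Finset.sum_congr rfl fun y hy => ?_
    rw [Finset.sum_eq_single (c y)]
    · simp only [hF, if_true, mul_one]
      rw [Finset.mul_sum]
      exact Finset.sum_congr rfl fun y' _ => by ring
    · intro w _ hw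
      rw [if_neg (Ne.symm hw), mul_zero]
    · intro h
      exact absurd (Finset.mem_image_of_mem _ hy) h
  have h0 := key 0
  simp only [add_zero] at h0
  rw [key e, h0]
  -- F w is the mass of the class w and vanishes off the image of c, so a translation cannot
  -- increase the sum of squares.
  have hshift : ∑ w ∈ K.image c, F (w + e) * F (w + e) ≤ ∑ w ∈ K.image c, F w * F w := by
    have h1 : ∑ w ∈ (K.image c).image (fun w => w + e), F w * F w =
        ∑ w ∈ K.image c, F (w + e) * F (w + e) := Finset.sum_image (add_left_injective e).injOn
    rw [← h1]
    calc _ ≤ ∑ w ∈ (K.image c).image (fun w => w + e) ∪ K.image c, F w * F w :=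
          Finset.sum_le_sum_of_subset_of_nonneg (Finset.subset_union_left)
            (fun w _ _ => mul_self_nonneg (F w))
      _ = ∑ w ∈ K.image c, F w * F w := by
          refine (Finset.sum_subset Finset.subset_union_right fun w _ hw => ?_).symm
          rw [hF0 w hw, mul_zero]
  calc ∑ w ∈ K.image c, F w * F (w + e)
      ≤ ∑ w ∈ K.image c, (F w * F w + F (w + e) * F (w + e)) / 2 :=
        Finset.sum_le_sum fun w _ => by nlinarith [sq_nonneg (F w - F (w + e))]
    _ = (∑ w ∈ K.image c, F w * F w + ∑ w ∈ K.image c, F (w + e) * F (w + e)) / 2 := by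
        rw [← Finset.sum_add_distrib, Finset.sum_div]
    _ ≤ _ := by linarith

variable {d n : ℕ}

/-- The index of the dyadic cube of side `2^m` that contains `y`. -/
def cubeIndex (m : ℕ) (y : Fin d → ℤ) : Fin d → ℤ := fun i => y i / 2 ^ m

/-- The Euclidean kernel is dominated by dyadic kernels of neighbouring cubes. -/
lemma bracket_rpow_le_sum {p α : ℝ} (hα : 0 ≤ α) (hp : p = 2 ^ (-α)) {y y' : Fin d → ℤ}
    (hy : y ∈ dyadicBox d n) (hy' : y' ∈ dyadicBox d n) :
    bracket (y - y') ^ (-α) ≤ 2 ^ α * ∑ m ∈ Finset.range (n + 1),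
      p ^ m * ∑ e ∈ Fintype.piFinset fun _ : Fin d => Finset.Icc (-1 : ℤ) 1,
        (if cubeIndex m y' = cubeIndex m y + e then 1 else 0) := by
  have hp0 : 0 < p := by rw [hp]; positivity
  have hp1 : p ≤ 1 := by rw [hp]; exact Real.rpow_le_one_of_one_le_of_nonpos (by norm_num) (by linarith)
  set L := dyadicLevel (y - y') with hL
  -- Cubes of side 2^(L+1) > |y - y'| containing y and y' coincide or are neighbours. The cap at n
  -- is harmless, since at that scale the whole box is one cube.
  set m := min (L + 1) n with hm
  set e : Fin d → ℤ := cubeIndex m y' - cubeIndex m y with he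
  have hemem : e ∈ Fintype.piFinset fun _ : Fin d => Finset.Icc (-1 : ℤ) 1 := by
    rw [Fintype.mem_piFinset]
    intro i
    rw [Finset.mem_Icc]
    have hd : |y i - y' i| ≤ 2 ^ m := by
      rcases le_total (L + 1) n with h | h
      · rw [hm, min_eq_left h]
        have h1 := (abs_le_latticeNorm (y - y') i).trans ((latticeNorm_le_bracket _).trans
          (bracket_lt_two_pow (y - y')).le)
        rw [← hL] at h1
        exact_mod_cast h1
      · rw [hm, min_eq_right h]
        exact (abs_sub_lt_of_mem_dyadicBox hy hy' i).le
    rw [abs_le] at hd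
    have hpos : (0 : ℤ) < 2 ^ m := by positivity
    have b1 : y' i / 2 ^ m ≤ (y i + 1 * 2 ^ m) / 2 ^ m :=
      Int.ediv_le_ediv hpos (by linarith)
    have b2 : y i / 2 ^ m ≤ (y' i + 1 * 2 ^ m) / 2 ^ m :=
      Int.ediv_le_ediv hpos (by linarith)
    rw [Int.add_mul_ediv_right _ _ hpos.ne'] at b1 b2
    simp only [he, cubeIndex, Pi.sub_apply]
    constructor <;> linarith
  have h1 : bracket (y - y') ^ (-α) ≤ 2 ^ α * p ^ m := by
    calc bracket (y - y') ^ (-α) ≤ ((2 : ℝ) ^ L) ^ (-α) :=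
          Real.rpow_le_rpow_of_nonpos (by positivity) (two_pow_dyadicLevel_le _) (by linarith)
      _ = p ^ L := by rw [two_rpow_mul_nat, hp]
      _ = 2 ^ α * p ^ (L + 1) := by
          rw [pow_succ, mul_comm (p ^ L), ← mul_assoc, hp, ← Real.rpow_add (by norm_num)]
          simp
      _ ≤ 2 ^ α * p ^ m := by
          gcongr 2 ^ α * ?_
          exact pow_le_pow_of_le_one hp0.le hp1 (min_le_left _ _)
  refine h1.trans ?_
  gcongr
  calc p ^ m = p ^ m * (if cubeIndex m y' = cubeIndex m y + e then 1 else 0) := by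
        rw [if_pos (by rw [he]; abel), mul_one]
    _ ≤ p ^ m * ∑ e ∈ Fintype.piFinset fun _ : Fin d => Finset.Icc (-1 : ℤ) 1,
        (if cubeIndex m y' = cubeIndex m y + e then 1 else 0) := by
        gcongr
        exact Finset.single_le_sum (f := fun e : Fin d → ℤ =>
          (if cubeIndex m y' = cubeIndex m y + e then (1 : ℝ) else 0))
          (fun e _ => by split_ifs <;> norm_num) hemem
    _ ≤ _ := by
        refine Finset.single_le_sum (f := fun m => p ^ m *
          ∑ e ∈ Fintype.piFinset fun _ : Fin d => Finset.Icc (-1 : ℤ) 1,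
          (if cubeIndex m y' = cubeIndex m y + e then (1 : ℝ) else 0)) (fun m _ => ?_)
          (Finset.mem_range.2 (Nat.lt_succ_of_le (min_le_right _ _)))
        exact mul_nonneg (by positivity) (Finset.sum_nonneg fun e _ => by split_ifs <;> norm_num)

/-- Each of the 3^d neighbour offsets contributes at most the diagonal term, by
`sum_sum_ite_add_le`. -/
lemma rieszEnergy_le_dyadic {p α : ℝ} (hα : 0 ≤ α) (hp : p = 2 ^ (-α))
    {K : Finset (Fin d → ℤ)} (hK : K ⊆ dyadicBox d n) {ν : (Fin d → ℤ) → ℝ} (hν : ∀ y, 0 ≤ ν y) :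
    rieszEnergy α K ν ≤ 2 ^ α * 3 ^ d * ∑ y ∈ K, ∑ y' ∈ K, ν y * ν y' *
      ∑ m ∈ Finset.range (n + 1), p ^ m * (if cubeIndex m y' = cubeIndex m y then 1 else 0) := by
  have hp0 : 0 < p := by rw [hp]; positivity
  set N := Fintype.piFinset fun _ : Fin d => Finset.Icc (-1 : ℤ) 1 with hN
  have hcard : (N.card : ℝ) = 3 ^ d := by
    rw [hN, Fintype.card_piFinset]; simp
  have swap : ∀ g : ℕ → (Fin d → ℤ) → (Fin d → ℤ) → ℝ,
      ∑ y ∈ K, ∑ y' ∈ K, ν y * ν y' * ∑ m ∈ Finset.range (n + 1), p ^ m * g m y y' =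
      ∑ m ∈ Finset.range (n + 1), p ^ m * ∑ y ∈ K, ∑ y' ∈ K, ν y * ν y' * g m y y' := by
    intro g
    simp only [Finset.mul_sum]
    rw [Finset.sum_comm' (t' := Finset.range (n + 1)) (s' := fun _ => K)
      (f := fun y m => ∑ y' ∈ K, p ^ m * (ν y * ν y' * g m y y')) (by tauto) |>.symm]
    refine Finset.sum_congr rfl fun y _ => ?_
    rw [Finset.sum_comm]
    refine Finset.sum_congr rfl fun m _ => Finset.sum_congr rfl fun y' _ => ?_
    ring
  calc rieszEnergy α K ν ≤ ∑ y ∈ K, ∑ y' ∈ K, ν y * ν y' * (2 ^ α * ∑ m ∈ Finset.range (n + 1),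
        p ^ m * ∑ e ∈ N, (if cubeIndex m y' = cubeIndex m y + e then 1 else 0)) := by
        rw [rieszEnergy_eq]
        refine Finset.sum_le_sum fun y hy => Finset.sum_le_sum fun y' hy' => ?_
        have := mul_nonneg (hν y) (hν y')
        gcongr
        exact bracket_rpow_le_sum hα hp (hK hy) (hK hy')
    _ = 2 ^ α * ∑ y ∈ K, ∑ y' ∈ K, ν y * ν y' * ∑ m ∈ Finset.range (n + 1),
        p ^ m * ∑ e ∈ N, (if cubeIndex m y' = cubeIndex m y + e then 1 else 0) := by
        simp only [Finset.mul_sum (a := (2 : ℝ) ^ α)]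
        refine Finset.sum_congr rfl fun y _ => Finset.sum_congr rfl fun y' _ => ?_
        rw [← Finset.mul_sum]
        ring
    _ = 2 ^ α * ∑ m ∈ Finset.range (n + 1), p ^ m * ∑ e ∈ N, ∑ y ∈ K, ∑ y' ∈ K, ν y * ν y' *
          (if cubeIndex m y' = cubeIndex m y + e then 1 else 0) := by
        rw [swap]
        congr 1
        refine Finset.sum_congr rfl fun m _ => ?_
        congr 1
        symm
        rw [Finset.sum_comm]
        refine Finset.sum_congr rfl fun y _ => ?_
        rw [Finset.sum_comm]
        refine Finset.sum_congr rfl fun y' _ => ?_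
        rw [Finset.mul_sum]
    _ ≤ 2 ^ α * ∑ m ∈ Finset.range (n + 1), p ^ m * ∑ e ∈ N, ∑ y ∈ K, ∑ y' ∈ K, ν y * ν y' *
          (if cubeIndex m y' = cubeIndex m y then 1 else 0) := by
        refine mul_le_mul_of_nonneg_left (Finset.sum_le_sum fun m _ =>
          mul_le_mul_of_nonneg_left (Finset.sum_le_sum fun e _ => ?_) (by positivity)) (by positivity)
        exact sum_sum_ite_add_le K ν (cubeIndex m) e
    _ = _ := by
        rw [swap]
        simp only [Finset.sum_const, nsmul_eq_mul, hcard]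
        rw [mul_assoc, Finset.mul_sum (a := (3 : ℝ) ^ d)]
        congr 1
        refine Finset.sum_congr rfl fun m _ => ?_
        ring

end KernelComparison

/-- For every scale there is a random set with the two-point function of a set of codimension `α`
that meets every `K` with probability at most of order `2^(-nα) Cap_α(K)`. -/
theorem exists_percolation_randomSet (d : ℕ) (α : ℝ) (hα : 0 < α) :
    ∃ C : ℝ, 0 < C ∧ ∀ n : ℕ, ∃ X : BoxRandomSet d n,
      (∀ y ∈ dyadicBox d n, X.one y = (2 ^ n) ^ (-α)) ∧
      (∀ y ∈ dyadicBox d n, ∀ y' ∈ dyadicBox d n,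
        X.two y y' ≤ (2 ^ n) ^ (-α) * (C * bracket (y - y') ^ (-α))) ∧
      ∀ K ⊆ dyadicBox d n, X.hit K ≤ C * ((2 ^ n) ^ (-α) * newtonCap α K) := by
  set p : ℝ := 2 ^ (-α) with hp
  have hp0 : 0 < p := by positivity
  have hp1 : p < 1 := Real.rpow_lt_one_of_one_lt_of_neg (by norm_num) (by linarith)
  have hp2 : 0 < 1 - p := by linarith
  set P : unitInterval := ⟨p, hp0.le, hp1.le⟩ with hP
  have hC1 := BoxRandomSet.twoPointConst_pos d α
  set C₂ := 2 * (2 ^ α * 3 ^ d * (1 / (1 - p))) with hC₂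
  have hC2 : 0 < C₂ := by positivity
  refine ⟨BoxRandomSet.twoPointConst d α + C₂, by positivity, fun n =>
    ⟨BoxRandomSet.percolation d P n, ?_, ?_, ?_⟩⟩
  · intro y hy
    rw [BoxRandomSet.percolation_one P n y hy, two_rpow_mul_nat]
  · intro y hy y' hy'
    refine (BoxRandomSet.percolation_two_le P hα.le rfl n y hy y' hy').trans ?_
    rw [two_rpow_mul_nat]
    have := bracket_rpow_nonneg (y - y') (-α)
    have h3 : (P : ℝ) = 2 ^ (-α) := rfl
    rw [h3]
    gcongr
    linarith
  · intro K hK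
    obtain ⟨ν, hν, hs, hE⟩ := BoxRandomSet.exists_percolation_measure P n K hK
    set X := BoxRandomSet.percolation d P n with hX
    -- The smallest shared scale m₀ dominates the geometric sum of the p^m, while the two-point
    -- function is at least p^(n+m₀).
    have hker : ∀ y ∈ K, ∀ y' ∈ K, ∑ m ∈ Finset.range (n + 1),
        p ^ m * (if cubeIndex m y' = cubeIndex m y then 1 else 0) ≤
        1 / (1 - p) * (p ^ n)⁻¹ * X.two y y' := by
      intro y hy y' hy'
      have htwo := X.two_nonneg y y'
      set M := (Finset.range (n + 1)).filter fun m => cubeIndex m y' = cubeIndex m y with hM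
      have e1 : ∑ m ∈ Finset.range (n + 1),
          p ^ m * (if cubeIndex m y' = cubeIndex m y then (1 : ℝ) else 0) = ∑ m ∈ M, p ^ m := by
        rw [hM, Finset.sum_filter]
        exact Finset.sum_congr rfl fun m _ => by split_ifs <;> simp
      rw [e1]
      rcases M.eq_empty_or_nonempty with h0 | hne
      · rw [h0, Finset.sum_empty]; positivity
      set m₀ := M.min' hne with hm₀
      have hm₀M := M.min'_mem hne
      rw [← hm₀, hM, Finset.mem_filter, Finset.mem_range] at hm₀M
      have e2 : p ^ (n + m₀) ≤ X.two y y' :=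
        BoxRandomSet.le_percolation_two P n y (hK hy) y' (hK hy') m₀ (by omega)
          fun i => (congrFun hm₀M.2 i).symm
      calc ∑ m ∈ M, p ^ m ≤ ∑ m ∈ Finset.Ico m₀ (n + 1), p ^ m := by
            refine Finset.sum_le_sum_of_subset_of_nonneg (fun m hm => ?_)
              fun m _ _ => by positivity
            rw [Finset.mem_Ico]
            exact ⟨M.min'_le m hm, Finset.mem_range.1 (Finset.mem_filter.1 hm).1⟩
        _ ≤ p ^ m₀ / (1 - p) := geom_sum_Ico_le_of_lt_one hp0.le hp1
        _ = 1 / (1 - p) * (p ^ n)⁻¹ * p ^ (n + m₀) := by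
            rw [pow_add]; field_simp
        _ ≤ _ := by gcongr
    -- The percolation measure has mass `X.hit K` and, by this bound, Riesz energy at most p^n times
    -- its mass up to a constant. This bounds the hitting probability by the capacity.
    have hEn : rieszEnergy α K ν ≤ C₂ * p ^ n * X.hit K := by
      calc rieszEnergy α K ν ≤ _ := rieszEnergy_le_dyadic hα.le hp hK hν
        _ ≤ 2 ^ α * 3 ^ d * ∑ y ∈ K, ∑ y' ∈ K, ν y * ν y' *
            (1 / (1 - p) * (p ^ n)⁻¹ * X.two y y') := by
            gcongr with y hy y' hy'
            · exact mul_nonneg (hν y) (hν y')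
            · exact hker y hy y' hy'
        _ = 2 ^ α * 3 ^ d * (1 / (1 - p)) * (p ^ n)⁻¹ *
            ∑ y ∈ K, ∑ y' ∈ K, ν y * ν y' * X.two y y' := by
            simp only [Finset.mul_sum]
            refine Finset.sum_congr rfl fun y _ => Finset.sum_congr rfl fun y' _ => ?_
            ring
        _ ≤ 2 ^ α * 3 ^ d * (1 / (1 - p)) * (p ^ n)⁻¹ * (2 * (p ^ n) ^ 2 * X.hit K) := by
            gcongr
        _ = _ := by rw [hC₂]; field_simp
    have := le_newtonCap_of_energy_le (β := α) (by positivity) (fun y _ => hν y) hs hEn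
    have hcap := newtonCap_nonneg α K
    rw [two_rpow_mul_nat]
    calc X.hit K ≤ C₂ * p ^ n * newtonCap α K := this
      _ = C₂ * (p ^ n * newtonCap α K) := by ring
      _ ≤ _ := by gcongr; linarith

/-! ### Capacity of sums with regular sets. -/

section RegularSums

variable {d : ℕ}

/-- The capacity of `x + A - S₁ - ⋯ - Sₘ` for sets `Sᵢ` with the ball counts of sets of dimension
`d - αᵢ`. -/
lemma exists_newtonCap_sub_sum_le (d m : ℕ) (α : Fin m → ℝ) (hα : ∀ i, α i < d) (a : ℝ)
    (ha : 0 ≤ a) :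
    ∃ C : ℝ, 0 < C ∧ ∀ (A : Finset (Fin d → ℤ)) (D : ℝ), A.Nonempty →
      (∀ y ∈ A, ∀ y' ∈ A, bracket (y - y') ≤ D) →
      ∀ (M : Fin m → ℕ) (S : Fin m → Finset (Fin d → ℤ)),
        (∀ i, ((S i).card : ℝ) ≤ (2 ^ M i) ^ ((d : ℝ) - α i)) →
        (∀ i, ∀ r ∈ S i, ∀ l ≤ M i, (2 ^ l) ^ ((d : ℝ) - α i) ≤
          2 ^ d * ((BoxRandomSet.near (S i) r l).card : ℝ)) →
        ∀ (x : Fin d → ℤ) (K : Finset (Fin d → ℤ)),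
          (∀ y ∈ K, ∃ b ∈ A, ∃ r : Fin m → Fin d → ℤ, (∀ i, r i ∈ S i) ∧ y = x + b - ∑ i, r i) →
          newtonCap a K ≤ C * ((∏ i, (max (2 ^ M i) D) ^ ((d : ℝ) - α i)) *
            newtonCap (a + ∑ i, α i - m * d) A) := by
  set c₀ : ℝ := 1 + m * Real.sqrt d with hc₀
  have hsd := Real.sqrt_nonneg (d : ℝ)
  have hc₀1 : 1 ≤ c₀ := by
    have : 0 ≤ m * Real.sqrt d := by positivity
    linarith
  set κ : ℝ := (∏ i : Fin m, ((2 : ℝ) ^ d)⁻¹ * (1 / 2) ^ ((d : ℝ) - α i)) * c₀ ^ (-a) with hκ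
  have hκ0 : 0 < κ := mul_pos (Finset.prod_pos fun i _ => by positivity) (by positivity)
  refine ⟨2 ^ a * κ⁻¹, by positivity, fun A D hA hD M S hcard hnear x K hK => ?_⟩
  set γ : ℝ := a + ∑ i, α i - m * d with hγ
  obtain ⟨b₀, hb₀⟩ := hA
  have hD1 : 1 ≤ D := (one_le_bracket _).trans (hD b₀ hb₀ b₀ hb₀)
  obtain ⟨e, he, I, hI, hcap, -, hpot, -⟩ := exists_equilibrium (β := γ) ⟨b₀, hb₀⟩
  -- The ball counts of S i are known only up to scale 2^(M i), whereas distances in A go up to D.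
  -- The factor ρ i is the loss when D exceeds that scale.
  set ρ : Fin m → ℝ := fun i => 2 ^ M i / max (2 ^ M i) D with hρ
  have hρ0 : ∀ i, 0 < ρ i := fun i => by
    have : (0 : ℝ) < max (2 ^ M i) D := lt_max_of_lt_left (by positivity)
    simp only [hρ]; positivity
  set P : ℝ := ∏ i, ρ i ^ ((d : ℝ) - α i) with hP
  have hP0 : 0 < P := Finset.prod_pos fun i _ => Real.rpow_pos_of_pos (hρ0 i) _
  -- The test measure puts the equilibrium mass e b' at each x + b' - ∑ r' i. At y = x + b - ∑ r i,
  -- keep only those r' i within distance t = |b - b'| ∨ 1 of r i: up to ρ they number about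
  -- t^(d-α_i) for each i, with kernel of order t^(-a). The product is t^(-γ), and summing over b'
  -- gives the equilibrium potential of A, which is at least I.
  have key : ∀ y ∈ K, 1 ≤ (κ * P * I)⁻¹ * ∑ j ∈ A ×ˢ Fintype.piFinset S,
      e j.1 * bracket (y - (x + j.1 - ∑ i, j.2 i)) ^ (-a) := by
    intro y hy
    obtain ⟨b, hb, r, hr, rfl⟩ := hK y hy
    rw [← div_eq_inv_mul, le_div_iff₀ (by positivity), one_mul, Finset.sum_product]
    have hin : ∀ b' ∈ A, κ * P * bracket (b - b') ^ (-γ) ≤ ∑ r' ∈ Fintype.piFinset S,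
        bracket (x + b - ∑ i, r i - (x + b' - ∑ i, r' i)) ^ (-a) := by
      intro b' hb'
      set t := bracket (b - b') with ht
      have ht1 : 1 ≤ t := one_le_bracket _
      have ht0 : 0 < t := by linarith
      have htD : t ≤ D := hD b hb b' hb'
      set l : Fin m → ℕ := fun i => min (M i) (Nat.log 2 ⌊t⌋₊) with hl
      have hlt : ∀ i, (2 : ℝ) ^ l i ≤ t := fun i =>
        (pow_le_pow_right₀ (by norm_num) (min_le_right _ _)).trans (two_pow_log_floor_le ht1)
      have hlρ : ∀ i, t * (1 / 2) * ρ i ≤ (2 : ℝ) ^ l i := by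
        intro i
        have hρ1 : ρ i ≤ 1 := by
          simp only [hρ]
          exact div_le_one_of_le₀ (le_max_left _ _) (le_max_of_le_left (by positivity))
        rcases le_total (M i) (Nat.log 2 ⌊t⌋₊) with h | h
        · simp only [hl, min_eq_left h]
          have h1 : ρ i ≤ 2 ^ M i / D := by
            simp only [hρ]
            exact div_le_div_of_nonneg_left (by positivity) (by linarith) (le_max_right _ _)
          have h2 : t * ρ i ≤ 2 ^ M i := by
            calc t * ρ i ≤ D * (2 ^ M i / D) := mul_le_mul htD h1 (hρ0 i).le (by linarith)
              _ = 2 ^ M i := by field_simp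
          have := mul_pos ht0 (hρ0 i)
          linarith
        · simp only [hl, min_eq_right h]
          have h1 := lt_two_pow_log_floor t
          rw [pow_succ] at h1
          have := hρ0 i
          nlinarith
      have hker : ∀ r' ∈ Fintype.piFinset fun i => BoxRandomSet.near (S i) (r i) (l i),
          (c₀ * t) ^ (-a) ≤ bracket (x + b - ∑ i, r i - (x + b' - ∑ i, r' i)) ^ (-a) := by
        intro r' hr'
        rw [Fintype.mem_piFinset] at hr'
        refine Real.rpow_le_rpow_of_nonpos (bracket_pos _) ?_ (by linarith)
        have e1 : x + b - ∑ i, r i - (x + b' - ∑ i, r' i) = (b - b') + ∑ i, (r' i - r i) := by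
          rw [Finset.sum_sub_distrib]; abel
        rw [e1]
        refine (bracket_add_le _ _).trans ?_
        have h1 : latticeNorm (∑ i, (r' i - r i)) ≤ ∑ i : Fin m, Real.sqrt d * t := by
          refine (latticeNorm_sum_le _ _).trans (Finset.sum_le_sum fun i _ => ?_)
          refine latticeNorm_le_of_abs_le ht0.le fun q => ?_
          have h2 := (Finset.mem_filter.1 (hr' i)).2 q
          rw [abs_sub_comm] at h2
          refine le_trans ?_ (hlt i)
          exact_mod_cast h2.le
        rw [Finset.sum_const, Finset.card_univ, Fintype.card_fin, nsmul_eq_mul] at h1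
        rw [hc₀, ← ht]
        linarith
      have hsub : (Fintype.piFinset fun i => BoxRandomSet.near (S i) (r i) (l i)) ⊆
          Fintype.piFinset S := Fintype.piFinset_subset _ _ fun i => Finset.filter_subset _ _
      have hcards : ∀ i, (((2 : ℝ) ^ d)⁻¹ * (1 / 2) ^ ((d : ℝ) - α i)) *
          (ρ i ^ ((d : ℝ) - α i) * t ^ ((d : ℝ) - α i)) ≤
          ((BoxRandomSet.near (S i) (r i) (l i)).card : ℝ) := by
        intro i
        have h1 := hnear i (r i) (hr i) (l i) (min_le_left _ _)
        have h2 : (t * (1 / 2) * ρ i) ^ ((d : ℝ) - α i) ≤ (2 ^ l i) ^ ((d : ℝ) - α i) :=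
          Real.rpow_le_rpow (by have := hρ0 i; positivity) (hlρ i) (by linarith [hα i])
        rw [Real.mul_rpow (by positivity) (hρ0 i).le, Real.mul_rpow ht0.le (by norm_num)] at h2
        calc _ = ((2 : ℝ) ^ d)⁻¹ * (t ^ ((d : ℝ) - α i) * (1 / 2) ^ ((d : ℝ) - α i) *
              ρ i ^ ((d : ℝ) - α i)) := by ring
          _ ≤ ((2 : ℝ) ^ d)⁻¹ * (2 ^ d * ((BoxRandomSet.near (S i) (r i) (l i)).card : ℝ)) := by
              exact mul_le_mul_of_nonneg_left (h2.trans h1) (by positivity)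
          _ = _ := by field_simp
      calc κ * P * t ^ (-γ)
          = (∏ i, (((2 : ℝ) ^ d)⁻¹ * (1 / 2) ^ ((d : ℝ) - α i)) *
              (ρ i ^ ((d : ℝ) - α i) * t ^ ((d : ℝ) - α i))) * (c₀ * t) ^ (-a) := by
            rw [Finset.prod_mul_distrib, Finset.prod_mul_distrib (f := fun i => ρ i ^ ((d : ℝ) - α i)),
              ← hP, ← Real.rpow_sum_of_pos ht0, Real.mul_rpow (by linarith) ht0.le, hκ]
            have : t ^ (-γ) = t ^ (∑ i : Fin m, ((d : ℝ) - α i)) * t ^ (-a) := by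
              rw [← Real.rpow_add ht0]
              congr 1
              rw [hγ, Finset.sum_sub_distrib]
              simp
              ring
            rw [this]; ring
        _ ≤ (∏ i, ((BoxRandomSet.near (S i) (r i) (l i)).card : ℝ)) * (c₀ * t) ^ (-a) := by
            gcongr with i _
            exact hcards i
        _ = ∑ r' ∈ Fintype.piFinset fun i => BoxRandomSet.near (S i) (r i) (l i),
            (c₀ * t) ^ (-a) := by
            rw [Finset.sum_const, Fintype.card_piFinset, nsmul_eq_mul]
            push_cast; rfl
        _ ≤ ∑ r' ∈ Fintype.piFinset fun i => BoxRandomSet.near (S i) (r i) (l i),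
            bracket (x + b - ∑ i, r i - (x + b' - ∑ i, r' i)) ^ (-a) := Finset.sum_le_sum hker
        _ ≤ _ := Finset.sum_le_sum_of_subset_of_nonneg hsub fun _ _ _ => bracket_rpow_nonneg _ _
    calc κ * P * I ≤ κ * P * rieszPotential γ A e b := by
          gcongr
          exact hpot b hb
      _ = ∑ b' ∈ A, e b' * (κ * P * bracket (b - b') ^ (-γ)) := by
          rw [rieszPotential, Finset.mul_sum]
          exact Finset.sum_congr rfl fun _ _ => by ring
      _ ≤ ∑ b' ∈ A, e b' * ∑ r' ∈ Fintype.piFinset S,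
            bracket (x + b - ∑ i, r i - (x + b' - ∑ i, r' i)) ^ (-a) :=
          Finset.sum_le_sum fun b' hb' => mul_le_mul_of_nonneg_left (hin b' hb') (he.1 b' hb')
      _ = _ := Finset.sum_congr rfl fun b' _ => by rw [Finset.mul_sum]
  have h1 := newtonCap_le_of_potential ha (by positivity) (A ×ˢ Fintype.piFinset S)
    (fun j => e j.1) (fun j => x + j.1 - ∑ i, j.2 i)
    (fun j hj => he.1 _ (Finset.mem_product.1 hj).1) key
  refine h1.trans ?_
  -- The mass of the test measure. The factor P cancels below, because |S i| ≤ (ρ i · max (2^(M i))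
  -- D)^(d-α_i).
  have h2 : ∑ j ∈ A ×ˢ Fintype.piFinset S, e j.1 = ∏ i, ((S i).card : ℝ) := by
    rw [Finset.sum_product]
    simp only [Finset.sum_const, nsmul_eq_mul, ← Finset.mul_sum, he.2, mul_one,
      Fintype.card_piFinset]
    push_cast; rfl
  rw [h2, hcap]
  have h3 : (∏ i, ((S i).card : ℝ)) ≤ P * ∏ i, (max (2 ^ M i) D) ^ ((d : ℝ) - α i) := by
    rw [hP, ← Finset.prod_mul_distrib]
    refine Finset.prod_le_prod (fun _ _ => by positivity) fun i _ => (hcard i).trans (le_of_eq ?_)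
    have hmax : (0 : ℝ) < max (2 ^ M i) D := lt_max_of_lt_left (by positivity)
    rw [← Real.mul_rpow (hρ0 i).le hmax.le]
    congr 1
    simp only [hρ]
    field_simp
  calc 2 ^ a * (κ * P * I)⁻¹ * ∏ i, ((S i).card : ℝ)
      ≤ 2 ^ a * (κ * P * I)⁻¹ * (P * ∏ i, (max (2 ^ M i) D) ^ ((d : ℝ) - α i)) := by gcongr
    _ = _ := by field_simp

end RegularSums

/-! ### The hitting hypothesis for sets in general position. -/

section Hitting

variable {d : ℕ}

/-- Translating by -y, for any y ∈ K, puts the origin in the set without changing its capacity. -/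
lemma HasCapacityHitting.bounds {Ω : Type*} [MeasurableSpace Ω] {P : Measure Ω}
    {R : Ω → Set (Fin d → ℤ)} {α β c C : ℝ} (h : HasCapacityHitting P R α β c C)
    {K : Finset (Fin d → ℤ)} {y : Fin d → ℤ} (hy : y ∈ K) (hy0 : y ≠ 0) {r : ℝ} (hr : 0 ≤ r)
    (hK : ∀ u ∈ K, ∀ w ∈ K, latticeNorm (u - w) ≤ r) (hry : 2 * r ≤ latticeNorm y) :
    c * (latticeNorm y ^ (-β) * newtonCap α K) ≤ P.real {ω | (R ω ∩ (K : Set (Fin d → ℤ))).Nonempty} ∧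
      P.real {ω | (R ω ∩ (K : Set (Fin d → ℤ))).Nonempty} ≤
        C * (latticeNorm y ^ (-β) * newtonCap α K) := by
  have h1 := h (K.image (-y + ·)) y (Finset.mem_image.2 ⟨y, hy, neg_add_cancel y⟩) hy0 (by
    have : latticeDiam (K.image (-y + ·)) ≤ r := by
      refine latticeDiam_le hr fun u hu w hw => ?_
      obtain ⟨u', hu', rfl⟩ := Finset.mem_image.1 hu
      obtain ⟨w', hw', rfl⟩ := Finset.mem_image.1 hw
      rw [add_sub_add_left_eq_sub]
      exact hK u' hu' w' hw'
    linarith)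
  have h2 : y +ᵥ ((K.image (-y + ·) : Finset (Fin d → ℤ)) : Set (Fin d → ℤ)) = K := by
    ext z
    simp only [Finset.coe_image, Set.mem_vadd_set, Set.mem_image, vadd_eq_add,
      exists_exists_and_eq_and, add_neg_cancel_left, exists_eq_right]
  rw [newtonCap_image_add, hitProb, h2] at h1
  exact h1

end Hitting

/-! ### Replacement of all factors but one. -/

section PartialReplacement

variable {V : Type*} [Countable V]

/-- Replace all factors but the one with index `j`, then condition on the replaced factors. -/
lemma measure_pi_exists_mem_le_mul_of_forall {n : ℕ} {X : Fin (n + 1) → Type*} {Y : Fin n → Type*}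
    [∀ i, MeasurableSpace (X i)] [∀ i, MeasurableSpace (Y i)]
    (μ : ∀ i, Measure (X i)) [∀ i, IsProbabilityMeasure (μ i)]
    (ν : ∀ i, Measure (Y i)) [∀ i, IsProbabilityMeasure (ν i)]
    (S : ∀ i, X i → Set V) (hS : ∀ i v, MeasurableSet {x | v ∈ S i x})
    (T : ∀ i, Y i → Set V) (hT : ∀ i v, MeasurableSet {x | v ∈ T i x})
    (j : Fin (n + 1)) (F : Fin n → Set V) (c : Fin n → ENNReal)
    (h : ∀ i, ∀ K ⊆ F i, μ (j.succAbove i) {x | (S (j.succAbove i) x ∩ K).Nonempty} ≤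
      c i * ν i {x | (T i x ∩ K).Nonempty})
    (G : Set (Fin (n + 1) → V)) (hG : ∀ y ∈ G, ∀ i, y (j.succAbove i) ∈ F i) (b : ENNReal)
    (hb : ∀ t : ∀ i, Y i, μ j {x₀ | (S j x₀ ∩ {v | ∃ y ∈ G, y j = v ∧
      ∀ i, y (j.succAbove i) ∈ T i (t i)}).Nonempty} ≤ b) :
    Measure.pi μ {x | ∃ y ∈ G, ∀ i, y i ∈ S i (x i)} ≤ (∏ i, c i) * b := by
  obtain ⟨hm, he⟩ := measure_pi_exists_mem_eq_lintegral μ S hS G j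
  set E : Set (X j × ∀ i, Y i) := {p | ∃ y ∈ G, y j ∈ S j p.1 ∧
    ∀ i, y (j.succAbove i) ∈ T i (p.2 i)} with hE
  have hmE : MeasurableSet E := by
    have : E = ⋃ y ∈ G, Prod.fst ⁻¹' {x | y j ∈ S j x} ∩ ⋂ i,
        (fun p : X j × ∀ i, Y i => p.2 i) ⁻¹' {x | y (j.succAbove i) ∈ T i x} := by
      ext x
      simp only [hE, Set.mem_ofPred_eq, Set.mem_iUnion, Set.mem_inter_iff, Set.mem_preimage,
        Set.mem_iInter, exists_prop]
    rw [this]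
    refine MeasurableSet.biUnion (Set.to_countable G) fun y _ =>
      (measurable_fst (hS _ _)).inter (MeasurableSet.iInter fun i => ?_)
    exact ((measurable_pi_apply i).comp measurable_snd) (hT _ _)
  have step1 : Measure.pi μ {x | ∃ y ∈ G, ∀ i, y i ∈ S i (x i)} ≤
      (∏ i, c i) * ((μ j).prod (Measure.pi ν)) E := by
    rw [he, Measure.prod_apply hm, Measure.prod_apply hmE,
      ← lintegral_const_mul _ (measurable_measure_prodMk_left hmE)]
    refine lintegral_mono fun x₀ => ?_
    set G' : Set (Fin n → V) := {y' | ∃ y ∈ G, y j ∈ S j x₀ ∧ y' = fun i => y (j.succAbove i)}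
      with hG'
    have := measure_pi_exists_mem_le (fun i => μ (j.succAbove i)) ν
      (fun i => S (j.succAbove i)) (fun i => hS _) T hT F c h G' (by
        rintro _ ⟨y, hy, -, rfl⟩ i
        exact hG y hy i)
    refine le_trans (measure_mono ?_) (this.trans ?_)
    · rintro x ⟨y, hy, h1, h2⟩
      exact ⟨_, ⟨y, hy, h1, rfl⟩, h2⟩
    · gcongr
      rintro x ⟨_, ⟨y, hy, h1, rfl⟩, h2⟩
      exact ⟨y, hy, h1, h2⟩
  refine step1.trans ?_
  gcongr
  rw [Measure.prod_apply_symm hmE]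
  calc _ ≤ ∫⁻ _, b ∂(Measure.pi ν) := by
        refine lintegral_mono fun t => le_trans (measure_mono ?_) (hb t)
        rintro x₀ ⟨y, hy, h1, h2⟩
        exact ⟨y j, h1, y, hy, rfl, h2⟩
    _ = b := by simp

end PartialReplacement

universe u

/-! ### Dyadic annuli cut into small cubes. -/

section DyadicPieces

variable {d : ℕ}

/-- The part of the dyadic annulus `2^n ≤ |y| ∨ 1 < 2^(n+1)` in one cube of a much smaller side. -/
def dyadicPiece (d n : ℕ) (v : Fin d → ℤ) : Set (Fin d → ℤ) :=
  {y | dyadicLevel y = n ∧ cubeIndex (n - (d + 1)) y = v}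

lemma sub_smul_cubeIndex_mem (m : ℕ) (y : Fin d → ℤ) :
    y - (2 ^ m : ℤ) • cubeIndex m y ∈ dyadicBox d m := by
  rw [mem_dyadicBox]
  intro i
  have h : (0 : ℤ) < 2 ^ m := by positivity
  have e : (y - (2 ^ m : ℤ) • cubeIndex m y) i = y i % 2 ^ m := by
    have := Int.emod_add_mul_ediv (y i) (2 ^ m)
    simp only [Pi.sub_apply, Pi.smul_apply, smul_eq_mul, cubeIndex]
    linarith
  rw [e]
  exact ⟨Int.emod_nonneg _ h.ne', Int.emod_lt_of_pos _ h⟩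

lemma sub_mem_dyadicBox_of_mem_dyadicPiece {n : ℕ} {v y : Fin d → ℤ} (hy : y ∈ dyadicPiece d n v) :
    y - (2 ^ (n - (d + 1)) : ℤ) • v ∈ dyadicBox d (n - (d + 1)) := by
  have := sub_smul_cubeIndex_mem (n - (d + 1)) y
  rwa [hy.2] at this

lemma finite_dyadicPiece (n : ℕ) (v : Fin d → ℤ) : (dyadicPiece d n v).Finite := by
  refine (((dyadicBox d (n - (d + 1))).image
    ((2 ^ (n - (d + 1)) : ℤ) • v + ·)).finite_toSet).subset fun y hy => ?_
  rw [Finset.mem_coe]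
  exact Finset.mem_image.2 ⟨_, sub_mem_dyadicBox_of_mem_dyadicPiece hy, by simp⟩

/-- This explains the cube side 2^(n-(d+1)): at level n > d + 1, twice the diameter of a piece is at
most 2^n, so the hitting hypothesis applies to its subsets. -/
lemma two_mul_sqrt_le (d : ℕ) : 2 * Real.sqrt d ≤ 2 ^ (d + 1) := by
  have h1 : Real.sqrt d ≤ 2 ^ d := by
    rw [Real.sqrt_le_left (by positivity)]
    have h2 : (d : ℝ) ≤ 2 ^ d := by exact_mod_cast Nat.lt_two_pow_self.le
    have h3 : (1 : ℝ) ≤ 2 ^ d := one_le_pow₀ (by norm_num)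
    nlinarith
  rw [pow_succ]; linarith

/-- The indices of the cubes that meet a dyadic annulus. -/
noncomputable def pieceIndices (d : ℕ) : Finset (Fin d → ℤ) :=
  Fintype.piFinset fun _ => Finset.Icc (-2 ^ (d + 2)) (2 ^ (d + 2))

/-- The number of cubes needed to cover an annulus does not depend on its level. -/
lemma cubeIndex_mem_pieceIndices (y : Fin d → ℤ) :
    cubeIndex (dyadicLevel y - (d + 1)) y ∈ pieceIndices d := by
  rw [pieceIndices, Fintype.mem_piFinset]
  intro i
  set n := dyadicLevel y
  set m := n - (d + 1) with hm
  have h1 := (abs_le_latticeNorm y i).trans ((latticeNorm_le_bracket y).trans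
    (bracket_lt_two_pow y).le)
  have h2 : |y i| ≤ 2 ^ (n + 1) := by exact_mod_cast h1
  have h3 : (2 : ℤ) ^ (n + 1) ≤ 2 ^ (d + 2) * 2 ^ m := by
    rw [← pow_add]
    exact pow_le_pow_right₀ (by norm_num) (by omega)
  have hpos : (0 : ℤ) < 2 ^ m := by positivity
  rw [abs_le] at h2
  rw [Finset.mem_Icc, cubeIndex]
  constructor
  · rw [Int.le_ediv_iff_mul_le hpos]; linarith
  · exact Int.ediv_le_of_le_mul hpos (by linarith)

lemma newtonCap_singleton (α : ℝ) (y : Fin d → ℤ) :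
    newtonCap α {y} = newtonCap α ({0} : Finset (Fin d → ℤ)) := by
  have := newtonCap_image_add α ({0} : Finset (Fin d → ℤ)) y
  simpa using this

/-- Upper bound for hitting probabilities in a dyadic piece. -/
lemma exists_hit_dyadicPiece_le (d : ℕ) (α β c C : ℝ) (hβ : 0 < β) (hC : 0 < C) :
    ∃ C' : ℝ, 0 < C' ∧ ∀ (Ω : Type u) [MeasurableSpace Ω] (P : Measure Ω) [IsProbabilityMeasure P]
      (R : Ω → Set (Fin d → ℤ)), HasCapacityHitting P R α β c C →
      ∀ (n : ℕ) (v : Fin d → ℤ) (K : Finset (Fin d → ℤ)), (K : Set (Fin d → ℤ)) ⊆ dyadicPiece d n v →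
        P.real {ω | (R ω ∩ (K : Set (Fin d → ℤ))).Nonempty} ≤
          C' * ((2 ^ n) ^ (-β) * newtonCap α K) := by
  set κ := newtonCap α ({0} : Finset (Fin d → ℤ)) with hκ
  have hκ0 : 0 < κ := newtonCap_pos (Finset.singleton_nonempty 0)
  refine ⟨C + (2 ^ (d + 1)) ^ β * κ⁻¹, by positivity, fun Ω _ P _ R hR n v K hK => ?_⟩
  have hcap := newtonCap_nonneg α K
  rcases K.eq_empty_or_nonempty with rfl | ⟨y, hy⟩
  · simp [newtonCap_empty]
  have hyp := hK hy
  have h2n : (0 : ℝ) ≤ (2 ^ n) ^ (-β) := by positivity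
  -- For n ≤ d + 1 the truncated subtraction makes the pieces single points. The trivial bound 1
  -- then suffices, at the cost of the second summand of the constant.
  rcases le_or_gt n (d + 1) with hn | hn
  · have hm : n - (d + 1) = 0 := by omega
    have hKy : K = {y} := by
      refine Finset.eq_singleton_iff_unique_mem.2 ⟨hy, fun z hz => ?_⟩
      have h1 := (hK hz).2.trans hyp.2.symm
      rw [hm] at h1
      funext i
      simpa [cubeIndex] using congrFun h1 i
    rw [hKy, newtonCap_singleton, ← hκ]
    have h1 : ((2 : ℝ) ^ (d + 1)) ^ (-β) ≤ (2 ^ n) ^ (-β) :=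
      Real.rpow_le_rpow_of_nonpos (by positivity) (pow_le_pow_right₀ (by norm_num) hn) (by linarith)
    have h2 : ((2 : ℝ) ^ (d + 1)) ^ β * (2 ^ (d + 1)) ^ (-β) = 1 := by
      rw [← Real.rpow_add (by positivity)]; simp
    calc _ ≤ (1 : ℝ) := measureReal_le_one
      _ = ((2 : ℝ) ^ (d + 1)) ^ β * κ⁻¹ * ((2 ^ (d + 1)) ^ (-β) * κ) := by
          rw [← h2]; field_simp
      _ ≤ ((2 : ℝ) ^ (d + 1)) ^ β * κ⁻¹ * ((2 ^ n) ^ (-β) * κ) := by gcongr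
      _ ≤ _ := by gcongr; linarith
  · have hlev : (2 : ℝ) ^ n ≤ latticeNorm y := by
      have h1 := two_pow_dyadicLevel_le y
      rw [hyp.1] at h1
      have h2 : (1 : ℝ) < 2 ^ n := one_lt_pow₀ (by norm_num) (by omega)
      rcases le_max_iff.1 h1 with h | h
      · exact h
      · linarith
    have hy0 : y ≠ 0 := by
      rintro rfl
      rw [latticeNorm_zero] at hlev
      have : (0 : ℝ) < 2 ^ n := by positivity
      linarith
    have hb := (hR.bounds hy hy0 (r := Real.sqrt d * 2 ^ (n - (d + 1))) (by positivity)
      (fun u hu w hw => by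
        refine latticeNorm_le_of_abs_le (by positivity) fun i => ?_
        have h1 := abs_sub_lt_of_mem_dyadicBox (sub_mem_dyadicBox_of_mem_dyadicPiece (hK hu))
          (sub_mem_dyadicBox_of_mem_dyadicPiece (hK hw)) i
        rw [Pi.sub_apply, Pi.sub_apply, sub_sub_sub_cancel_right] at h1
        exact_mod_cast h1.le)
      (by
        refine le_trans ?_ hlev
        calc 2 * (Real.sqrt d * 2 ^ (n - (d + 1))) = (2 * Real.sqrt d) * 2 ^ (n - (d + 1)) := by ring
          _ ≤ 2 ^ (d + 1) * 2 ^ (n - (d + 1)) := by gcongr; exact two_mul_sqrt_le d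
          _ = 2 ^ n := by rw [← pow_add]; congr 1; omega)).2
    have h1 : latticeNorm y ^ (-β) ≤ (2 ^ n) ^ (-β) :=
      Real.rpow_le_rpow_of_nonpos (by positivity) hlev (by linarith)
    calc _ ≤ C * (latticeNorm y ^ (-β) * newtonCap α K) := hb
      _ ≤ C * ((2 ^ n) ^ (-β) * newtonCap α K) := by gcongr
      _ ≤ _ := by
          gcongr
          have : 0 < ((2 : ℝ) ^ (d + 1)) ^ β * κ⁻¹ := by positivity
          linarith

/-- In a dyadic piece a random set with capacity hitting probabilities is dominated by a random
set with deterministic ball counts. -/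
lemma exists_regular_domination (d : ℕ) (hd : 1 ≤ d) (α β c C : ℝ) (hα : 0 < α ∧ α < d)
    (hβ : 0 < β) (hC : 0 < C) :
    ∃ C' : ℝ, 0 < C' ∧ ∀ n : ℕ, ∃ X : BoxRandomSet d (n - (d + 1)),
      (∀ ω, ((X.set ω).card : ℝ) ≤ (2 ^ (n - (d + 1))) ^ ((d : ℝ) - α)) ∧
      (∀ ω, ∀ r ∈ X.set ω, ∀ m ≤ n - (d + 1), (2 ^ m) ^ ((d : ℝ) - α) ≤
        2 ^ d * ((BoxRandomSet.near (X.set ω) r m).card : ℝ)) ∧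
      ∀ (v : Fin d → ℤ) (Ω : Type u) [MeasurableSpace Ω] (P : Measure Ω) [IsProbabilityMeasure P]
        (R : Ω → Set (Fin d → ℤ)), HasCapacityHitting P R α β c C →
        ∀ K ⊆ dyadicPiece d n v, P {ω | (R ω ∩ K).Nonempty} ≤
          ENNReal.ofReal (C' * (2 ^ n) ^ (α - β)) * X.law {ω |
            ((((X.set ω).image ((2 ^ (n - (d + 1)) : ℤ) • v + ·) : Finset (Fin d → ℤ)) :
              Set (Fin d → ℤ)) ∩ K).Nonempty} := by
  obtain ⟨C₁, hC₁, h₁⟩ := exists_hit_dyadicPiece_le d α β c C hβ hC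
  obtain ⟨C₂, hC₂, h₂⟩ := exists_regular_randomSet d hd α hα.1 hα.2
  refine ⟨C₁ * C₂, by positivity, fun n => ?_⟩
  set m := n - (d + 1) with hm
  obtain ⟨X, hX1, hX2, hX3⟩ := h₂ m
  refine ⟨X, hX1, hX2, fun v Ω _ P _ R hR K hK => ?_⟩
  set w := (2 ^ m : ℤ) • v with hw
  obtain ⟨K, rfl⟩ := ((finite_dyadicPiece n v).subset hK).exists_finset_coe
  have hb := h₁ Ω P R hR n v K hK
  set K' := K.image (-w + ·) with hK'
  have hK'b : K' ⊆ dyadicBox d m := by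
    intro z hz
    obtain ⟨y, hy, rfl⟩ := Finset.mem_image.1 hz
    have := sub_mem_dyadicBox_of_mem_dyadicPiece (hK hy)
    rwa [neg_add_eq_sub]
  have hc := hX3 K' hK'b
  rw [hK', newtonCap_image_add, ← hK'] at hc
  have hevent : {ω | ((((X.set ω).image (w + ·) : Finset (Fin d → ℤ)) : Set (Fin d → ℤ)) ∩
      (K : Set (Fin d → ℤ))).Nonempty} = {ω | ∃ y ∈ K', y ∈ X.set ω} := by
    ext ω
    constructor
    · rintro ⟨y, hy, hyK⟩
      obtain ⟨z, hz, rfl⟩ := Finset.mem_image.1 (Finset.mem_coe.1 hy)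
      exact ⟨z, Finset.mem_image.2 ⟨_, hyK, neg_add_cancel_left w z⟩, hz⟩
    · rintro ⟨z, hz, hzω⟩
      obtain ⟨y, hy, rfl⟩ := Finset.mem_image.1 hz
      exact ⟨y, Finset.mem_coe.2 (Finset.mem_image.2 ⟨_, hzω, add_neg_cancel_left w y⟩), hy⟩
  have hXr : X.law {ω | ∃ y ∈ K', y ∈ X.set ω} = ENNReal.ofReal (X.hit K') := by
    rw [BoxRandomSet.hit, ofReal_measureReal]
  have hPr : P {ω | (R ω ∩ (K : Set (Fin d → ℤ))).Nonempty} =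
      ENNReal.ofReal (P.real {ω | (R ω ∩ (K : Set (Fin d → ℤ))).Nonempty}) := by
    rw [ofReal_measureReal]
  rw [hevent, hXr, hPr, ← ENNReal.ofReal_mul (by positivity)]
  refine ENNReal.ofReal_le_ofReal (hb.trans ?_)
  have hcap := newtonCap_nonneg α K
  have hhit := X.hit_nonneg K'
  have e1 : newtonCap α K ≤ (2 ^ m) ^ α * (C₂ * X.hit K') := by
    calc newtonCap α K = (2 ^ m) ^ α * ((2 ^ m) ^ (-α) * newtonCap α K) := by
          rw [← mul_assoc, ← Real.rpow_add (by positivity)]; simp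
      _ ≤ _ := by gcongr
  have e2 : ((2 : ℝ) ^ m) ^ α ≤ (2 ^ n) ^ α :=
    Real.rpow_le_rpow (by positivity) (pow_le_pow_right₀ (by norm_num) (Nat.sub_le _ _)) hα.1.le
  calc C₁ * ((2 ^ n) ^ (-β) * newtonCap α K)
      ≤ C₁ * ((2 ^ n) ^ (-β) * ((2 ^ n) ^ α * (C₂ * X.hit K'))) := by
        gcongr
        exact e1.trans (by gcongr)
    _ = _ := by
        rw [sub_eq_neg_add, Real.rpow_add (by positivity)]; ring

/-- Upper bound for the probability that independent random sets, each restricted to a dyadic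
piece, have a sum that meets `x + A`. -/
lemma exists_measure_dyadicPieces_le (d : ℕ) (hd : 1 ≤ d) (k : ℕ) (α β : Fin (k + 1) → ℝ)
    (hα : ∀ i, 0 < α i ∧ α i < d) (hβ : ∀ i, 0 < β i) (c C : ℝ) (hC : 0 < C) (j : Fin (k + 1)) :
    ∃ C' : ℝ, 0 < C' ∧ ∀ (Ω : Type u) [MeasurableSpace Ω] (P : Measure Ω) [IsProbabilityMeasure P]
      (R : Fin (k + 1) → Ω → Set (Fin d → ℤ)), (∀ i, Measurable (R i)) → iIndepFun R P →
      (∀ i, HasCapacityHitting P (R i) (α i) (β i) c C) →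
      ∀ (A : Finset (Fin d → ℤ)) (x : Fin d → ℤ), A.Nonempty →
      ∀ (n : Fin (k + 1) → ℕ) (v : Fin (k + 1) → Fin d → ℤ),
        P {ω | ∃ y ∈ {y : Fin (k + 1) → Fin d → ℤ | (∀ i, y i ∈ dyadicPiece d (n i) (v i)) ∧
            ∃ b ∈ A, ∑ i, y i = x + b}, ∀ i, y i ∈ R i ω} ≤
          ENNReal.ofReal (C' * (newtonCap (∑ i, α i - k * d) A * ((2 ^ n j) ^ (-β j) *
            ∏ i, (2 ^ n (j.succAbove i)) ^ (α (j.succAbove i) - β (j.succAbove i)) *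
              (max (2 ^ n (j.succAbove i)) (max (latticeDiam A) 1)) ^
                ((d : ℝ) - α (j.succAbove i))))) := by
  obtain ⟨C₁, hC₁, h₁⟩ := exists_newtonCap_sub_sum_le d k (fun i => α (j.succAbove i))
    (fun i => (hα _).2) (α j) (hα j).1.le
  obtain ⟨C₂, hC₂, h₂⟩ := exists_hit_dyadicPiece_le.{u} d (α j) (β j) c C (hβ j) hC
  choose C₃ hC₃ h₃ using fun i : Fin k => exists_regular_domination.{u} d hd (α (j.succAbove i))
    (β (j.succAbove i)) c C (hα _) (hβ _) hC
  refine ⟨(∏ i, C₃ i) * (C₂ * C₁), mul_pos (Finset.prod_pos fun i _ => hC₃ i) (by positivity),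
    fun Ω _ P _ R hRm hind hR A x hA n v => ?_⟩
  choose X hX1 hX2 hX3 using fun i : Fin k => h₃ i (n (j.succAbove i))
  set G := {y : Fin (k + 1) → Fin d → ℤ | (∀ i, y i ∈ dyadicPiece d (n i) (v i)) ∧
            ∃ b ∈ A, ∑ i, y i = x + b} with hG
  set D := max (latticeDiam A) 1 with hD
  have hD1 : 1 ≤ D := le_max_right _ _
  set Q := ∏ i : Fin k, (max (2 ^ n (j.succAbove i)) D) ^ ((d : ℝ) - α (j.succAbove i)) with hQ
  set γ := ∑ i, α i - k * d with hγ
  have hγ' : α j + ∑ i : Fin k, α (j.succAbove i) - k * d = γ := by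
    rw [hγ, Fin.sum_univ_succAbove α j]
  have hcapA := newtonCap_nonneg γ A
  set b : ENNReal := ENNReal.ofReal (C₂ * ((2 ^ n j) ^ (-β j) * (C₁ * (Q * newtonCap γ A)))) with hb
  have hprob : ∀ i, IsProbabilityMeasure (P.map (R i)) := fun i =>
    Measure.isProbabilityMeasure_map (hRm i).aemeasurable
  have hmapnonempty : ∀ i (K : Set (Fin d → ℤ)),
      P.map (R i) {T | (T ∩ K).Nonempty} = P {ω | (R i ω ∩ K).Nonempty} := fun i K =>
    Measure.map_apply (hRm i) (measurableSet_inter_nonempty (fun T => T)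
      (fun v => measurableSet_setOfPred.2 (measurable_set_mem v)) K)
  rw [measure_exists_mem_eq_pi P R hRm hind G]
  set T : ∀ i : Fin k, (X i).Sample → Finset (Fin d → ℤ) := fun i ω =>
    ((X i).set ω).image ((2 ^ (n (j.succAbove i) - (d + 1)) : ℤ) • v (j.succAbove i) + ·) with hT
  -- All sets but R j become regular sets. For every realisation of these, R j has to hit a subset
  -- of x + A - ∑ T i, whose capacity is bounded deterministically.
  have hmain := measure_pi_exists_mem_le_mul_of_forall (fun i => P.map (R i))
    (fun i : Fin k => (X i).law) (fun _ T => T)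
    (fun _ v => measurableSet_setOfPred.2 (measurable_set_mem v))
    (fun i ω => (T i ω : Set (Fin d → ℤ))) (fun i z => by
      have : {ω | z ∈ (T i ω : Set (Fin d → ℤ))} =
          {ω | z - (2 ^ (n (j.succAbove i) - (d + 1)) : ℤ) • v (j.succAbove i) ∈ (X i).set ω} := by
        ext ω
        simp only [hT, Set.mem_ofPred_eq, Finset.mem_coe, Finset.mem_image]
        constructor
        · rintro ⟨u, hu, rfl⟩
          simpa using hu
        · intro h
          exact ⟨_, h, by simp⟩
      rw [this]
      exact (X i).measurable_mem _) j
    (fun i => dyadicPiece d (n (j.succAbove i)) (v (j.succAbove i)))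
    (fun i => ENNReal.ofReal (C₃ i * (2 ^ n (j.succAbove i)) ^ (α (j.succAbove i) -
      β (j.succAbove i))))
    (fun i K hK => by
      rw [hmapnonempty]
      exact hX3 i _ Ω P _ (hR _) K hK)
    G (fun y hy i => hy.1 _) b (fun t => by
      have hfin : {z | ∃ y ∈ G, y j = z ∧ ∀ i, y (j.succAbove i) ∈ (T i (t i) : Set (Fin d → ℤ))} ⊆
          dyadicPiece d (n j) (v j) := by
        rintro z ⟨y, hy, rfl, -⟩
        exact hy.1 j
      obtain ⟨K, hK⟩ := ((finite_dyadicPiece (n j) (v j)).subset hfin).exists_finset_coe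
      rw [← hK] at hfin ⊢
      rw [hmapnonempty, ← ofReal_measureReal]
      refine ENNReal.ofReal_le_ofReal ((h₂ Ω P (R j) (hR j) (n j) (v j) K hfin).trans ?_)
      gcongr
      have h4 := h₁ A D hA (fun y hy y' hy' => max_le_max (latticeNorm_sub_le_diam hy hy') le_rfl)
        (fun i => n (j.succAbove i) - (d + 1)) (fun i => T i (t i))
        (fun i => by
          simp only [hT]
          rw [Finset.card_image_of_injective _ (add_right_injective _)]
          exact hX1 i _)
        (fun i r hr l hl => by
          simp only [hT] at hr ⊢
          obtain ⟨z, hz, rfl⟩ := Finset.mem_image.1 hr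
          refine (hX2 i _ z hz l hl).trans ?_
          refine mul_le_mul_of_nonneg_left ?_ (by positivity)
          exact_mod_cast BoxRandomSet.card_near_le_of_image_subset l subset_rfl)
        x K (fun z hz => by
          have hz' : z ∈ (K : Set (Fin d → ℤ)) := hz
          rw [hK] at hz'
          obtain ⟨y, ⟨-, b, hb, hsum⟩, rfl, hyT⟩ := hz'
          refine ⟨b, hb, fun i => y (j.succAbove i), hyT, ?_⟩
          rw [← hsum, Fin.sum_univ_succAbove y j]; simp)
      rw [hγ'] at h4
      refine h4.trans ?_
      gcongr
      rw [hQ]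
      refine Finset.prod_le_prod (fun i _ => by positivity) fun i _ => ?_
      refine Real.rpow_le_rpow (by positivity) ?_ (by linarith [(hα (j.succAbove i)).2])
      gcongr
      · norm_num
      · omega)
  refine hmain.trans (le_of_eq ?_)
  rw [hb, ← ENNReal.ofReal_prod_of_nonneg (fun i _ => by have := hC₃ i; positivity),
    ← ENNReal.ofReal_mul (Finset.prod_nonneg fun i _ => by have := hC₃ i; positivity)]
  congr 1
  rw [Finset.prod_mul_distrib, Finset.prod_mul_distrib (g := fun i : Fin k =>
    (max (2 ^ n (j.succAbove i)) D) ^ ((d : ℝ) - α (j.succAbove i))), ← hQ]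
  ring

end DyadicPieces

/-! ### Summation over the scales of the summands. -/

section ScaleSums

/-- These are the scales below the diameter D. If α > β the largest scale dominates and gives
D^(d-β). If α ≤ β each of about log D scales contributes at most D^(d-α); the condition on X, raised
to the power d - β, says that D^(d-α) log(D+1) ≤ X^(d-β). -/
lemma exists_sum_small_scales_le (d : ℕ) (α β : ℝ) (hβ : β < d) :
    ∃ C : ℝ, 0 < C ∧ ∀ D X : ℝ, 1 ≤ D → D ≤ X →
      (α ≤ β → D ^ (((d : ℝ) - α) / ((d : ℝ) - β)) * Real.log (D + 1) ^ (1 / ((d : ℝ) - β)) ≤ X) →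
      ∑ n ∈ Finset.range (Nat.log 2 ⌊D⌋₊ + 1), ((2 : ℝ) ^ n) ^ (α - β) * D ^ ((d : ℝ) - α) ≤
        C * X ^ ((d : ℝ) - β) := by
  rcases lt_or_ge β α with hlt | hle
  · set s : ℝ := 2 ^ (α - β) with hs
    have hs1 : 1 < s := Real.one_lt_rpow (by norm_num) (by linarith)
    have hs2 : 0 < s - 1 := by linarith
    refine ⟨s / (s - 1), by positivity, fun D X hD hDX _ => ?_⟩
    have hD0 : 0 < D := by linarith
    set N := Nat.log 2 ⌊D⌋₊ with hN
    rw [← Finset.sum_mul]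
    simp only [two_rpow_mul_nat, ← hs]
    have h1 : s ^ N ≤ D ^ (α - β) := by
      rw [hs, ← two_rpow_mul_nat]
      exact Real.rpow_le_rpow (by positivity) (two_pow_log_floor_le hD) (by linarith)
    calc _ ≤ s / (s - 1) * s ^ N * D ^ ((d : ℝ) - α) := by
          gcongr
          exact sum_range_pow_le hs1 N
      _ ≤ s / (s - 1) * D ^ (α - β) * D ^ ((d : ℝ) - α) := by gcongr
      _ = s / (s - 1) * D ^ ((d : ℝ) - β) := by
          rw [mul_assoc, ← Real.rpow_add hD0]; congr 2; ring
      _ ≤ _ := by gcongr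
  · have hlog2 : 0 < Real.log 2 := Real.log_pos (by norm_num)
    refine ⟨2 / Real.log 2, by positivity, fun D X hD hDX hX => ?_⟩
    have hD0 : 0 < D := by linarith
    have hdβ : 0 < (d : ℝ) - β := by linarith
    set N := Nat.log 2 ⌊D⌋₊ with hN
    have hlogD : 0 ≤ Real.log (D + 1) := Real.log_nonneg (by linarith)
    have h1 : (N : ℝ) * Real.log 2 ≤ Real.log (D + 1) := by
      rw [← Real.log_pow]
      exact Real.log_le_log (by positivity) ((two_pow_log_floor_le hD).trans (by linarith))
    have h2 : Real.log 2 ≤ Real.log (D + 1) := Real.log_le_log (by norm_num) (by linarith)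
    have h3 : (N : ℝ) + 1 ≤ 2 / Real.log 2 * Real.log (D + 1) := by
      rw [div_mul_eq_mul_div, le_div_iff₀ hlog2]
      linarith
    have h4 : D ^ ((d : ℝ) - α) * Real.log (D + 1) ≤ X ^ ((d : ℝ) - β) := by
      have h5 := Real.rpow_le_rpow (by positivity) (hX hle) hdβ.le
      rwa [Real.mul_rpow (by positivity) (by positivity), ← Real.rpow_mul hD0.le,
        ← Real.rpow_mul hlogD, div_mul_cancel₀ _ hdβ.ne', one_div_mul_cancel hdβ.ne',
        Real.rpow_one] at h5
    calc _ ≤ ∑ n ∈ Finset.range (N + 1), 1 * D ^ ((d : ℝ) - α) := by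
          gcongr with n _
          exact Real.rpow_le_one_of_one_le_of_nonpos (one_le_pow₀ (by norm_num)) (by linarith)
      _ = ((N : ℝ) + 1) * D ^ ((d : ℝ) - α) := by simp
      _ ≤ 2 / Real.log 2 * Real.log (D + 1) * D ^ ((d : ℝ) - α) := by gcongr
      _ = 2 / Real.log 2 * (D ^ ((d : ℝ) - α) * Real.log (D + 1)) := by ring
      _ ≤ _ := by gcongr

/-- The sum over the scales up to `2^J` for one of the random sets. -/
lemma exists_sum_scales_le (d : ℕ) (α β : ℝ) (hβ : β < d) (L : ℝ) (hL : 0 < L) :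
    ∃ C : ℝ, 0 < C ∧ ∀ (D X : ℝ) (J : ℕ), 1 ≤ X → D ≤ X →
      (α ≤ β → D ^ (((d : ℝ) - α) / ((d : ℝ) - β)) * Real.log (D + 1) ^ (1 / ((d : ℝ) - β)) ≤ X) →
      X ≤ L * 2 ^ J →
      ∑ n ∈ Finset.range (J + 1), ((2 : ℝ) ^ n) ^ (α - β) *
        (max (2 ^ n) (max D 1)) ^ ((d : ℝ) - α) ≤ C * (2 ^ J) ^ ((d : ℝ) - β) := by
  obtain ⟨C₁, hC₁, h₁⟩ := exists_sum_small_scales_le d α β hβ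
  set r : ℝ := 2 ^ ((d : ℝ) - β) with hr
  have hr1 : 1 < r := Real.one_lt_rpow (by norm_num) (by linarith)
  have hr2 : 0 < r - 1 := by linarith
  refine ⟨r / (r - 1) + C₁ * L ^ ((d : ℝ) - β), by positivity, fun D X J hX hDX hlog hXJ => ?_⟩
  -- Above D the powers combine to 2^(n(d-β)), a growing geometric series; the scales up to D are
  -- left to `exists_sum_small_scales_le`.
  have hpt : ∀ n ∈ Finset.range (J + 1), ((2 : ℝ) ^ n) ^ (α - β) *
      (max (2 ^ n) (max D 1)) ^ ((d : ℝ) - α) ≤ r ^ n +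
        (if (2 : ℝ) ^ n ≤ D then ((2 : ℝ) ^ n) ^ (α - β) * D ^ ((d : ℝ) - α) else 0) := by
    intro n _
    have h2n : (1 : ℝ) ≤ 2 ^ n := one_le_pow₀ (by norm_num)
    have e1 : ((2 : ℝ) ^ n) ^ (α - β) * (2 ^ n) ^ ((d : ℝ) - α) = r ^ n := by
      rw [← Real.rpow_add (by positivity), hr, ← two_rpow_mul_nat]; congr 1; ring
    have hrn : 0 ≤ r ^ n := by positivity
    split_ifs with h
    · have h3 : max ((2 : ℝ) ^ n) (max D 1) = D := by
        rw [max_eq_left (h2n.trans h : (1 : ℝ) ≤ D), max_eq_right h]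
      rw [h3]; linarith
    · have h3 : max ((2 : ℝ) ^ n) (max D 1) = 2 ^ n :=
        max_eq_left (max_le (not_le.1 h).le h2n)
      rw [h3, e1, add_zero]
  refine (Finset.sum_le_sum hpt).trans ?_
  rw [Finset.sum_add_distrib, add_mul]
  refine add_le_add ?_ ?_
  · refine (sum_range_pow_le hr1 J).trans (le_of_eq ?_)
    rw [hr, ← two_rpow_mul_nat]
  · have hXL : X ^ ((d : ℝ) - β) ≤ L ^ ((d : ℝ) - β) * (2 ^ J) ^ ((d : ℝ) - β) := by
      rw [← Real.mul_rpow hL.le (by positivity)]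
      exact Real.rpow_le_rpow (by linarith) hXJ (by linarith)
    rw [← Finset.sum_filter]
    rcases lt_or_ge D 1 with hD | hD
    · rw [Finset.filter_false_of_mem, Finset.sum_empty]
      · positivity
      · intro n _
        have h2n : (1 : ℝ) ≤ 2 ^ n := one_le_pow₀ (by norm_num)
        linarith
    · calc _ ≤ ∑ n ∈ Finset.range (Nat.log 2 ⌊D⌋₊ + 1), ((2 : ℝ) ^ n) ^ (α - β) *
            D ^ ((d : ℝ) - α) := by
            refine Finset.sum_le_sum_of_subset_of_nonneg (fun n hn => ?_)
              fun n _ _ => by positivity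
            rw [Finset.mem_filter] at hn
            rw [Finset.mem_range, Nat.lt_succ_iff]
            refine Nat.le_log_of_pow_le one_lt_two (Nat.le_floor ?_)
            push_cast
            exact hn.2
        _ ≤ C₁ * X ^ ((d : ℝ) - β) := h₁ D X hD hDX hlog
        _ ≤ C₁ * (L ^ ((d : ℝ) - β) * (2 ^ J) ^ ((d : ℝ) - β)) := by gcongr
        _ = _ := by ring

end ScaleSums

/-! ### The upper bound. -/

section UpperBound

/-- The upper bound for the probability that a sum of independent random sets meets `x + A`. -/
theorem exists_sum_hit_le (d : ℕ) (hd : 1 ≤ d) (k : ℕ) (α β : Fin (k + 1) → ℝ)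
    (hα : ∀ i, 0 < α i ∧ α i < d) (hβ : ∀ i, 0 < β i ∧ β i < d)
    (hβsum : (k : ℝ) * d < ∑ i, β i) (c C : ℝ) (hC : 0 < C) :
    ∃ C' : ℝ, 0 < C' ∧ ∀ (Ω : Type u) [MeasurableSpace Ω] (P : Measure Ω) [IsProbabilityMeasure P]
      (R : Fin (k + 1) → Ω → Set (Fin d → ℤ)), (∀ i, Measurable (R i)) → iIndepFun R P →
      (∀ i, HasCapacityHitting P (R i) (α i) (β i) c C) →
      ∀ (A : Finset (Fin d → ℤ)) (x : Fin d → ℤ), 0 ∈ A → x ≠ 0 →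
        2 * latticeDiam A ≤ latticeNorm x →
        (∀ i, α i ≤ β i → latticeDiam A ^ (((d : ℝ) - α i) / ((d : ℝ) - β i)) *
          Real.log (latticeDiam A + 1) ^ (1 / ((d : ℝ) - β i)) ≤ latticeNorm x) →
        P.real {ω | ∃ y : Fin (k + 1) → Fin d → ℤ, (∃ b ∈ A, ∑ i, y i = x + b) ∧
            ∀ i, y i ∈ R i ω} ≤
          C' * (latticeNorm x ^ ((k : ℝ) * d - ∑ i, β i) *
            newtonCap (∑ i, α i - k * d) A) := by
  choose C₁ hC₁ h₁ using fun j => exists_measure_dyadicPieces_le.{u} d hd k α β hα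
    (fun i => (hβ i).1) c C hC j
  -- If all summands have level at most J, then |x| ≤ (k+1) 2^(J+1) + diam(A) with diam(A) ≤ |x| /
  -- 2, so 2 |x| / L ≤ 2^J. Hence J ≥ J₀, where J₀ is defined below and satisfies |x| ≤ L 2^(J₀).
  set L : ℝ := 8 * (k + 1) with hL
  have hL0 : 0 < L := by positivity
  choose C₂ hC₂ h₂ using fun i => exists_sum_scales_le d (α i) (β i) (hβ i).2 L hL0
  set e : ℝ := (k : ℝ) * d - ∑ i, β i with he
  have he0 : e < 0 := by linarith
  set q : ℝ := 2 ^ e with hq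
  have hq0 : 0 < q := by positivity
  have hq1 : q < 1 := Real.rpow_lt_one_of_one_lt_of_neg (by norm_num) he0
  have hq2 : 0 < 1 - q := by linarith
  set N : ℝ := ((Fintype.piFinset fun _ : Fin (k + 1) => pieceIndices d).card : ℝ) with hN
  set B : ℝ := ∑ j, N * (C₁ j * ∏ i : Fin k, C₂ (j.succAbove i)) with hB
  have hB0 : 0 ≤ B := Finset.sum_nonneg fun j _ => mul_nonneg (by positivity)
    (mul_nonneg (hC₁ j).le (Finset.prod_nonneg fun i _ => (hC₂ _).le))
  refine ⟨(B + 1) * (L⁻¹) ^ e * (1 - q)⁻¹, by positivity,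
    fun Ω _ P _ R hRm hind hR A x hA hx hdiam hlog => ?_⟩
  set X := latticeNorm x with hX
  have hX1 : 1 ≤ X := one_le_latticeNorm hx
  set D := latticeDiam A with hD
  have hD0 : 0 ≤ D := latticeDiam_nonneg A
  set cap := newtonCap (∑ i, α i - k * d) A with hcap
  have hcap0 : 0 ≤ cap := newtonCap_nonneg _ _
  set J₀ := Nat.log 2 ⌊2 * X / L⌋₊ with hJ₀
  have hJ₀L : X ≤ L * 2 ^ J₀ := by
    have h3 := lt_two_pow_log_floor (2 * X / L)
    rw [← hJ₀, div_lt_iff₀ hL0, pow_succ] at h3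
    linarith
  set E : ℕ → Fin (k + 1) → (Fin k → ℕ) → (Fin (k + 1) → Fin d → ℤ) → Set Ω := fun J j n v =>
    {ω | ∃ y ∈ {y : Fin (k + 1) → Fin d → ℤ |
      (∀ i, y i ∈ dyadicPiece d ((j.insertNth J n : Fin (k + 1) → ℕ) i) (v i)) ∧
        ∃ b ∈ A, ∑ i, y i = x + b}, ∀ i, y i ∈ R i ω} with hE
  set g : Fin (k + 1) → ℕ → ℝ := fun i n =>
    ((2 : ℝ) ^ n) ^ (α i - β i) * (max (2 ^ n) (max D 1)) ^ ((d : ℝ) - α i) with hg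
  have hg0 : ∀ i n, 0 ≤ g i n := fun i n => by simp only [hg]; positivity
  have hEle : ∀ J j n v, P (E J j n v) ≤
      ENNReal.ofReal (C₁ j * (cap * ((2 ^ J) ^ (-β j) * ∏ i, g (j.succAbove i) (n i)))) := by
    intro J j n v
    have := h₁ j Ω P R hRm hind hR A x ⟨0, hA⟩ (j.insertNth J n) v
    simpa only [Fin.insertNth_apply_same, Fin.insertNth_apply_succAbove] using this
  -- J is the largest level and j an index attaining it; the levels n of the others are at most J,
  -- and v records the cubes.
  set U : ℕ → Set Ω := fun J => ⋃ j ∈ (Finset.univ : Finset (Fin (k + 1))),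
    ⋃ n ∈ Fintype.piFinset fun _ : Fin k => Finset.range (J + 1),
    ⋃ v ∈ Fintype.piFinset fun _ : Fin (k + 1) => pieceIndices d, E J j n v with hU
  have hUle : ∀ J, J₀ ≤ J → P (U J) ≤ ENNReal.ofReal (B * cap * q ^ J) := by
    intro J hJ
    have hXJ : X ≤ L * 2 ^ J := hJ₀L.trans (by gcongr; norm_num)
    have hj : ∀ j, ∑ n ∈ Fintype.piFinset fun _ : Fin k => Finset.range (J + 1),
        ∑ v ∈ Fintype.piFinset fun _ : Fin (k + 1) => pieceIndices d,
        C₁ j * (cap * ((2 ^ J) ^ (-β j) * ∏ i, g (j.succAbove i) (n i))) ≤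
        N * (C₁ j * ∏ i : Fin k, C₂ (j.succAbove i)) * (cap * q ^ J) := by
      intro j
      simp only [Finset.sum_const, nsmul_eq_mul, ← Finset.mul_sum, ← hN]
      rw [← Finset.prod_univ_sum (fun _ : Fin k => Finset.range (J + 1))
        fun i n => g (j.succAbove i) n]
      have h3 : ∏ i : Fin k, ∑ n ∈ Finset.range (J + 1), g (j.succAbove i) n ≤
          ∏ i : Fin k, C₂ (j.succAbove i) * (2 ^ J) ^ ((d : ℝ) - β (j.succAbove i)) :=
        Finset.prod_le_prod (fun i _ => Finset.sum_nonneg fun n _ => hg0 _ _) fun i _ =>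
          h₂ _ D X J hX1 (by linarith) (hlog _) hXJ
      -- The total exponent e = k d - ∑ β i does not depend on j and is negative, which makes the
      -- sum over J a convergent geometric series.
      have h4 : ((2 : ℝ) ^ J) ^ (-β j) * ∏ i : Fin k, ((2 : ℝ) ^ J) ^ ((d : ℝ) - β (j.succAbove i)) =
          q ^ J := by
        rw [← Real.rpow_sum_of_pos (by positivity), ← Real.rpow_add (by positivity), hq,
          ← two_rpow_mul_nat, he, Fin.sum_univ_succAbove β j, Finset.sum_sub_distrib]
        congr 1
        simp
        ring
      have hC1 := hC₁ j
      calc _ ≤ N * (C₁ j * (cap * ((2 ^ J) ^ (-β j) *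
            ∏ i : Fin k, C₂ (j.succAbove i) * (2 ^ J) ^ ((d : ℝ) - β (j.succAbove i))))) := by gcongr
        _ = _ := by rw [Finset.prod_mul_distrib, ← h4]; ring
    calc P (U J) ≤ ∑ j, ∑ n ∈ Fintype.piFinset fun _ : Fin k => Finset.range (J + 1),
          ∑ v ∈ Fintype.piFinset fun _ : Fin (k + 1) => pieceIndices d,
          ENNReal.ofReal (C₁ j * (cap * ((2 ^ J) ^ (-β j) * ∏ i, g (j.succAbove i) (n i)))) := by
          refine (measure_biUnion_finset_le _ _).trans (Finset.sum_le_sum fun j _ => ?_)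
          refine (measure_biUnion_finset_le _ _).trans (Finset.sum_le_sum fun n _ => ?_)
          exact (measure_biUnion_finset_le _ _).trans (Finset.sum_le_sum fun v _ => hEle J j n v)
      _ = ENNReal.ofReal (∑ j, ∑ n ∈ Fintype.piFinset fun _ : Fin k => Finset.range (J + 1),
          ∑ v ∈ Fintype.piFinset fun _ : Fin (k + 1) => pieceIndices d,
          C₁ j * (cap * ((2 ^ J) ^ (-β j) * ∏ i, g (j.succAbove i) (n i)))) := by
          have hnn : ∀ j (n : Fin k → ℕ),
              0 ≤ C₁ j * (cap * ((2 ^ J) ^ (-β j) * ∏ i, g (j.succAbove i) (n i))) := fun j n =>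
            mul_nonneg (hC₁ j).le (mul_nonneg hcap0 (mul_nonneg (by positivity)
              (Finset.prod_nonneg fun i _ => hg0 _ _)))
          rw [ENNReal.ofReal_sum_of_nonneg fun j _ => Finset.sum_nonneg fun n _ =>
            Finset.sum_nonneg fun v _ => hnn j n]
          refine Finset.sum_congr rfl fun j _ => ?_
          rw [ENNReal.ofReal_sum_of_nonneg fun n _ => Finset.sum_nonneg fun v _ => hnn j n]
          refine Finset.sum_congr rfl fun n _ => ?_
          rw [ENNReal.ofReal_sum_of_nonneg fun v _ => hnn j n]
      _ ≤ _ := by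
          refine ENNReal.ofReal_le_ofReal ((Finset.sum_le_sum fun j _ => hj j).trans (le_of_eq ?_))
          rw [← Finset.sum_mul, ← hB]; ring
  have hsub : {ω | ∃ y : Fin (k + 1) → Fin d → ℤ, (∃ b ∈ A, ∑ i, y i = x + b) ∧
      ∀ i, y i ∈ R i ω} ⊆ ⋃ l : ℕ, U (J₀ + l) := by
    rintro ω ⟨y, ⟨b, hb, hsum⟩, hyR⟩
    obtain ⟨j, hjmax⟩ := Finite.exists_max fun i => dyadicLevel (y i)
    set J := dyadicLevel (y j) with hJ
    have hJJ : J₀ ≤ J := by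
      have h3 : X ≤ latticeNorm (x + b) + D := by
        have h5 : latticeNorm (x + b - b) ≤ latticeNorm (x + b) + latticeNorm b :=
          latticeNorm_sub_le _ _
        have h6 := latticeNorm_sub_le_diam hb hA
        rw [add_sub_cancel_right] at h5
        rw [sub_zero] at h6
        linarith
      have h4 : latticeNorm (x + b) ≤ ∑ i : Fin (k + 1), (2 : ℝ) ^ (J + 1) := by
        rw [← hsum]
        refine (latticeNorm_sum_le _ _).trans (Finset.sum_le_sum fun i _ => ?_)
        refine (latticeNorm_le_bracket _).trans ((bracket_lt_two_pow _).le.trans ?_)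
        exact pow_le_pow_right₀ (by norm_num) (Nat.succ_le_succ (hjmax i))
      rw [Finset.sum_const, Finset.card_univ, Fintype.card_fin, nsmul_eq_mul, pow_succ] at h4
      push_cast at h4
      have h5 : 2 * X / L ≤ 2 ^ J := by
        rw [div_le_iff₀ hL0, hL]
        linarith
      have h6 : ⌊2 * X / L⌋₊ ≤ 2 ^ J := by
        have h7 : ((⌊2 * X / L⌋₊ : ℕ) : ℝ) ≤ 2 ^ J := (Nat.floor_le (by positivity)).trans h5
        exact_mod_cast h7
      calc J₀ ≤ Nat.log 2 (2 ^ J) := Nat.log_mono_right h6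
        _ = J := Nat.log_pow one_lt_two J
    refine Set.mem_iUnion.2 ⟨J - J₀, ?_⟩
    rw [Nat.add_sub_cancel' hJJ]
    simp only [hU, Set.mem_iUnion]
    refine ⟨j, Finset.mem_univ j, fun i => dyadicLevel (y (j.succAbove i)), ?_,
      fun i => cubeIndex (dyadicLevel (y i) - (d + 1)) (y i), ?_, ?_⟩
    · rw [Fintype.mem_piFinset]
      exact fun i => Finset.mem_range.2 (Nat.lt_succ_of_le (hjmax _))
    · rw [Fintype.mem_piFinset]
      exact fun i => cubeIndex_mem_pieceIndices _
    · refine ⟨y, ⟨fun i => ?_, b, hb, hsum⟩, hyR⟩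
      have hlev : (j.insertNth J (fun i => dyadicLevel (y (j.succAbove i))) : Fin (k + 1) → ℕ) i =
          dyadicLevel (y i) := by
        rcases Fin.eq_self_or_eq_succAbove j i with rfl | ⟨i, rfl⟩
        · simp [hJ]
        · simp
      rw [hlev]
      exact ⟨rfl, rfl⟩
  have hgeo : HasSum (fun l : ℕ => B * cap * q ^ (J₀ + l)) (B * cap * q ^ J₀ * (1 - q)⁻¹) := by
    have := (hasSum_geometric_of_lt_one hq0.le hq1).mul_left (B * cap * q ^ J₀)
    simpa only [pow_add, mul_assoc] using this
  have hP : P {ω | ∃ y : Fin (k + 1) → Fin d → ℤ, (∃ b ∈ A, ∑ i, y i = x + b) ∧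
      ∀ i, y i ∈ R i ω} ≤ ENNReal.ofReal (B * cap * q ^ J₀ * (1 - q)⁻¹) := by
    refine (measure_mono hsub).trans ((measure_iUnion_le _).trans ?_)
    rw [← hgeo.tsum_eq, ENNReal.ofReal_tsum_of_nonneg (fun l => by positivity) hgeo.summable]
    exact ENNReal.tsum_le_tsum fun l => hUle _ (Nat.le_add_right _ _)
  have hreal := ENNReal.toReal_mono ENNReal.ofReal_ne_top hP
  rw [ENNReal.toReal_ofReal (by positivity)] at hreal
  have hqJ : q ^ J₀ ≤ (L⁻¹) ^ e * X ^ e := by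
    rw [hq, ← two_rpow_mul_nat, ← Real.mul_rpow (by positivity) (by positivity)]
    refine Real.rpow_le_rpow_of_nonpos (by positivity) ?_ he0.le
    rw [inv_mul_le_iff₀ hL0]
    exact hJ₀L
  refine hreal.trans ?_
  have hXe : 0 ≤ X ^ e := by positivity
  calc B * cap * q ^ J₀ * (1 - q)⁻¹ ≤ (B + 1) * cap * ((L⁻¹) ^ e * X ^ e) * (1 - q)⁻¹ := by
        gcongr
        linarith
    _ = _ := by ring

end UpperBound

/-! ### Second moment for sums of percolation-type sets. -/

section SecondMomentOfSums

variable {d : ℕ}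

namespace BoxRandomSet

/-- The translate by `v` of a random subset of a dyadic box. -/
def shift {n : ℕ} (X : BoxRandomSet d n) (v : Fin d → ℤ) (ω : X.Sample) : Set (Fin d → ℤ) :=
  {y | y - v ∈ X.set ω}

lemma measurableSet_mem_shift {n : ℕ} (X : BoxRandomSet d n) (v y : Fin d → ℤ) :
    MeasurableSet {ω | y ∈ X.shift v ω} := X.measurable_mem (y - v)

lemma measureReal_pi_forall_mem_shift {ι : Type*} [Fintype ι] {n : ℕ} (X : ι → BoxRandomSet d n)
    (v y : ι → Fin d → ℤ) :
    (Measure.pi fun i => (X i).law).real {ω | ∀ i, y i ∈ (X i).shift (v i) (ω i)} =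
      ∏ i, (X i).one (y i - v i) := by
  have : {ω : ∀ i, (X i).Sample | ∀ i, y i ∈ (X i).shift (v i) (ω i)} =
      Set.univ.pi fun i => {ω | y i - v i ∈ (X i).set ω} := by
    ext ω; simp [shift]
  rw [this, measureReal_def, Measure.pi_pi, ENNReal.toReal_prod]
  rfl

lemma measureReal_pi_forall_mem_shift_inter {ι : Type*} [Fintype ι] {n : ℕ}
    (X : ι → BoxRandomSet d n) (v y y' : ι → Fin d → ℤ) :
    (Measure.pi fun i => (X i).law).real ({ω | ∀ i, y i ∈ (X i).shift (v i) (ω i)} ∩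
      {ω | ∀ i, y' i ∈ (X i).shift (v i) (ω i)}) =
      ∏ i, (X i).two (y i - v i) (y' i - v i) := by
  have : {ω : ∀ i, (X i).Sample | ∀ i, y i ∈ (X i).shift (v i) (ω i)} ∩
      {ω | ∀ i, y' i ∈ (X i).shift (v i) (ω i)} =
      Set.univ.pi fun i => {ω | y i - v i ∈ (X i).set ω ∧ y' i - v i ∈ (X i).set ω} := by
    ext ω; simp [shift, forall_and]
  rw [this, measureReal_def, Measure.pi_pi, ENNReal.toReal_prod]
  rfl

end BoxRandomSet

/-- The second moment bound for the probability that a sum of independent random sets with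
one-point and two-point functions of percolation type meets a translate of `A`. -/
lemma exists_newtonCap_le_measureReal_pi (d k : ℕ) (α : Fin (k + 1) → ℝ)
    (hα : ∀ i, 0 < α i ∧ α i < d) (hαsum : (k : ℝ) * d < ∑ i, α i)
    (C : Fin (k + 1) → ℝ) (hC : ∀ i, 0 < C i) :
    ∃ B : ℝ, 0 < B ∧ ∀ (m n : ℕ) (X : Fin (k + 1) → BoxRandomSet d n),
      (∀ i, ∀ y ∈ dyadicBox d n, (X i).one y = (2 ^ n) ^ (-α i)) →
      (∀ i, ∀ y ∈ dyadicBox d n, ∀ y' ∈ dyadicBox d n,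
        (X i).two y y' ≤ (2 ^ n) ^ (-α i) * (C i * bracket (y - y') ^ (-α i))) →
      ∀ (v z : Fin (k + 1) → Fin d → ℤ) (A : Finset (Fin d → ℤ))
        (G : Set (Fin (k + 1) → Fin d → ℤ)),
        (∀ y ∈ G, ∀ i, y i - v i ∈ dyadicBox d n) →
        (∀ a ∈ A, ∀ u ∈ Fintype.piFinset fun _ : Fin k => dyadicBox d m,
          (Fin.cons (z 0 + a - ∑ i, u i) fun i => z i.succ + u i) ∈ G) →
        ((2 ^ m) ^ d) ^ k * (∏ i, ((2 : ℝ) ^ n) ^ (-α i)) * newtonCap (∑ i, α i - k * d) A ≤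
          B * (Measure.pi fun i => (X i).law).real
            {ω | ∃ y ∈ G, ∀ i, y i ∈ (X i).shift (v i) (ω i)} := by
  obtain ⟨C₂, hC₂, h₂⟩ := exists_sum_prod_bracket_le d k (fun i => α i.succ) (α 0) (hα 0).1
    (hα 0).2 (fun i => hα _) (by rw [← Fin.sum_univ_succ]; exact hαsum)
  have hCC : 0 < ∏ i, C i := Finset.prod_pos fun i _ => hC i
  refine ⟨(∏ i, C i) * C₂, by positivity, fun m n X h1 h2 v z A G hbox hG => ?_⟩
  set U := {ω : ∀ i, (X i).Sample | ∃ y ∈ G, ∀ i, y i ∈ (X i).shift (v i) (ω i)} with hU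
  set pr : ℝ := (Measure.pi fun i => (X i).law).real U with hpr
  set p : ℝ := ∏ i, ((2 : ℝ) ^ n) ^ (-α i) with hp
  have hp0 : 0 < p := Finset.prod_pos fun i _ => by positivity
  set N : ℝ := (((2 : ℝ) ^ m) ^ d) ^ k with hN
  have hN0 : 0 < N := by positivity
  set W := Fintype.piFinset fun _ : Fin k => dyadicBox d m with hW
  have hWcard : (W.card : ℝ) = N := by
    rw [hW, Fintype.card_piFinset, hN]
    simp [card_dyadicBox]
  -- Solutions are parametrised by a ∈ A and free displacements u of all summands but the first,
  -- which absorbs them. They are weighted by μ(a).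
  set Y : (Fin d → ℤ) × (Fin k → Fin d → ℤ) → Fin (k + 1) → Fin d → ℤ := fun j =>
    Fin.cons (z 0 + j.1 - ∑ i, j.2 i) fun i => z i.succ + j.2 i with hY
  have hYG : ∀ j ∈ A ×ˢ W, Y j ∈ G := fun j hj =>
    hG _ (Finset.mem_product.1 hj).1 _ (Finset.mem_product.1 hj).2
  have hpr0 : 0 ≤ pr := measureReal_nonneg
  suffices h : newtonCap (∑ i, α i - k * d) A ≤ (∏ i, C i) * C₂ * pr / (N * p) by
    rw [le_div_iff₀ (by positivity)] at h
    linarith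
  refine newtonCap_le_of_forall (by positivity) fun μ hμ => ?_
  set I := rieszEnergy (∑ i, α i - k * d) A μ with hI
  have hmeasE : ∀ j, MeasurableSet {ω : ∀ i, (X i).Sample | ∀ i, Y j i ∈ (X i).shift (v i) (ω i)} := by
    intro j
    have : {ω : ∀ i, (X i).Sample | ∀ i, Y j i ∈ (X i).shift (v i) (ω i)} =
      ⋂ i, (fun ω : ∀ i, (X i).Sample => ω i) ⁻¹' {ω | Y j i ∈ (X i).shift (v i) ω} := by
      ext ω; simp
    rw [this]
    exact MeasurableSet.iInter fun i =>
      measurable_pi_apply i ((X i).measurableSet_mem_shift (v i) _)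
  have key := sq_sum_measure_le (Measure.pi fun i => (X i).law) (A ×ˢ W) (fun j => μ j.1)
    (fun j => {ω | ∀ i, Y j i ∈ (X i).shift (v i) (ω i)}) hmeasE
    (measurableSet_exists_mem (fun i => (X i).shift (v i))
      (fun i y => (X i).measurableSet_mem_shift (v i) y) G)
    (fun j hj ω hω => ⟨Y j, hYG j hj, hω⟩)
  rw [← hU, ← hpr] at key
  have hone : ∑ j ∈ A ×ˢ W, μ j.1 * (Measure.pi fun i => (X i).law).real
      {ω | ∀ i, Y j i ∈ (X i).shift (v i) (ω i)} = N * p := by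
    calc _ = ∑ j ∈ A ×ˢ W, μ j.1 * p := by
          refine Finset.sum_congr rfl fun j hj => ?_
          rw [BoxRandomSet.measureReal_pi_forall_mem_shift, hp]
          congr 1
          exact Finset.prod_congr rfl fun i _ => h1 i _ (hbox _ (hYG j hj) i)
      _ = _ := by
          rw [← Finset.sum_mul, Finset.sum_product]
          simp only [Finset.sum_const, nsmul_eq_mul, ← Finset.mul_sum, hμ.2, hWcard, mul_one]
  have htwo : ∑ j ∈ A ×ˢ W, ∑ l ∈ A ×ˢ W, μ j.1 * μ l.1 * (Measure.pi fun i => (X i).law).real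
      ({ω | ∀ i, Y j i ∈ (X i).shift (v i) (ω i)} ∩
        {ω | ∀ i, Y l i ∈ (X i).shift (v i) (ω i)}) ≤ p * (∏ i, C i) * C₂ * N * I := by
    have hpt : ∀ j ∈ A ×ˢ W, ∀ l ∈ A ×ˢ W, (Measure.pi fun i => (X i).law).real
        ({ω | ∀ i, Y j i ∈ (X i).shift (v i) (ω i)} ∩
          {ω | ∀ i, Y l i ∈ (X i).shift (v i) (ω i)}) ≤ p * (∏ i, C i) *
          ((∏ i, bracket (j.2 i - l.2 i) ^ (-α i.succ)) *
            bracket (j.1 - l.1 - ∑ i, (j.2 i - l.2 i)) ^ (-α 0)) := by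
      intro j hj l hl
      rw [BoxRandomSet.measureReal_pi_forall_mem_shift_inter]
      calc _ ≤ ∏ i, (((2 : ℝ) ^ n) ^ (-α i) * (C i * bracket (Y j i - Y l i) ^ (-α i))) := by
            refine Finset.prod_le_prod (fun i _ => (X i).two_nonneg _ _) fun i _ => ?_
            refine (h2 i _ (hbox _ (hYG j hj) i) _ (hbox _ (hYG l hl) i)).trans (le_of_eq ?_)
            rw [sub_sub_sub_cancel_right]
        _ = _ := by
            rw [Finset.prod_mul_distrib, Finset.prod_mul_distrib, ← hp, mul_assoc]
            congr 2
            rw [Fin.prod_univ_succ, mul_comm]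
            simp only [hY, Fin.cons_zero, Fin.cons_succ, add_sub_add_left_eq_sub,
              Finset.sum_sub_distrib]
            congr 3
            abel
    calc _ ≤ ∑ j ∈ A ×ˢ W, ∑ l ∈ A ×ˢ W, μ j.1 * μ l.1 * (p * (∏ i, C i) *
          ((∏ i, bracket (j.2 i - l.2 i) ^ (-α i.succ)) *
            bracket (j.1 - l.1 - ∑ i, (j.2 i - l.2 i)) ^ (-α 0))) := by
          refine Finset.sum_le_sum fun j hj => Finset.sum_le_sum fun l hl => ?_
          exact mul_le_mul_of_nonneg_left (hpt j hj l hl)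
            (mul_nonneg (hμ.1 _ (Finset.mem_product.1 hj).1) (hμ.1 _ (Finset.mem_product.1 hl).1))
      _ = ∑ a ∈ A, ∑ b ∈ A, ∑ w ∈ W, μ a * μ b * (p * ∏ i, C i) * ∑ u ∈ W,
          ((∏ i, bracket (u i - w i) ^ (-α i.succ)) *
            bracket (a - b - ∑ i, (u i - w i)) ^ (-α 0)) := by
          simp only [Finset.sum_product, Finset.mul_sum, mul_assoc]
          refine Finset.sum_congr rfl fun a _ => ?_
          rw [Finset.sum_comm]
          refine Finset.sum_congr rfl fun b _ => ?_
          rw [Finset.sum_comm]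
      -- For fixed w the sum over u is an iterated Riesz convolution evaluated at a - b; the sum
      -- over w then only contributes the factor N.
      _ ≤ ∑ a ∈ A, ∑ b ∈ A, ∑ w ∈ W, μ a * μ b * (p * ∏ i, C i) *
          (C₂ * bracket (a - b) ^ (-(∑ i, α i - k * d))) := by
          refine Finset.sum_le_sum fun a ha => Finset.sum_le_sum fun b hb =>
            Finset.sum_le_sum fun w _ => ?_
          have := hμ.1 a ha
          have := hμ.1 b hb
          refine mul_le_mul_of_nonneg_left ?_ (by positivity)
          rw [Fin.sum_univ_succ]
          exact h₂ (fun _ => dyadicBox d m) w (a - b)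
      _ = _ := by
          simp only [Finset.sum_const, nsmul_eq_mul, hWcard, hI, rieszEnergy, bracket,
            Finset.mul_sum]
          refine Finset.sum_congr rfl fun a _ => Finset.sum_congr rfl fun b _ => ?_
          ring
  rw [hone] at key
  have h3 : N * p * (N * p) ≤ (∏ i, C i) * C₂ * pr * I * (N * p) := by
    calc N * p * (N * p) = (N * p) ^ 2 := by ring
      _ ≤ _ := key
      _ ≤ pr * (p * (∏ i, C i) * C₂ * N * I) := by gcongr
      _ = _ := by ring
  have h4 := le_of_mul_le_mul_right h3 (by positivity)
  rw [div_mul_eq_mul_div, le_div_iff₀ (by positivity), one_mul]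
  exact h4

end SecondMomentOfSums

/-! ### Percolation dominated by the given random sets in a ball far from the origin. -/

section LocalPercolation

/-- In a ball of radius ρ 2^m the percolation set hits K with probability at most of order 2^(-mα)
Cap_α(K), and R with probability at least of order 2^(-mβ) Cap_α(K). The factor 5 keeps the ball at
distance at least 4ρ 2^m from the origin, twice its diameter, as the hitting hypothesis requires.
The choice of s makes the ball fit in a box of side 2^(m+s+1). -/
lemma exists_percolation_domination (d : ℕ) (α β c : ℝ) (hα : 0 < α) (hβ : 0 < β) (hc : 0 < c)
    (ρ L : ℝ) (hρ : 0 < ρ) (hL : 0 ≤ L) (s : ℕ) (hs : ρ < 2 ^ s) :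
    ∃ B C : ℝ, 0 < B ∧ 0 < C ∧ ∀ (m : ℕ) (z : Fin d → ℤ), 5 * ρ * 2 ^ m ≤ latticeNorm z →
      latticeNorm z ≤ L * 2 ^ m → ∃ (X : BoxRandomSet d (m + s + 1)) (v : Fin d → ℤ),
        (∀ y ∈ dyadicBox d (m + s + 1), X.one y = (2 ^ (m + s + 1)) ^ (-α)) ∧
        (∀ y ∈ dyadicBox d (m + s + 1), ∀ y' ∈ dyadicBox d (m + s + 1),
          X.two y y' ≤ (2 ^ (m + s + 1)) ^ (-α) * (C * bracket (y - y') ^ (-α))) ∧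
        (∀ y, latticeNorm (y - z) ≤ ρ * 2 ^ m → y - v ∈ dyadicBox d (m + s + 1)) ∧
        ∀ (Ω : Type u) [MeasurableSpace Ω] (P : Measure Ω) [IsProbabilityMeasure P]
          (R : Ω → Set (Fin d → ℤ)) (C' : ℝ), HasCapacityHitting P R α β c C' →
          ∀ K ⊆ {y | latticeNorm (y - z) ≤ ρ * 2 ^ m},
            X.law {ω | (X.shift v ω ∩ K).Nonempty} ≤
              ENNReal.ofReal (B * (2 ^ m) ^ (β - α)) * P {ω | (R ω ∩ K).Nonempty} := by
  obtain ⟨C, hC, hperc⟩ := exists_percolation_randomSet d α hα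
  refine ⟨C / c * (L + ρ) ^ β, C, by positivity, hC, fun m z hz hzL => ?_⟩
  obtain ⟨X, h1, h2, h3⟩ := hperc (m + s + 1)
  set v : Fin d → ℤ := z - fun _ => 2 ^ (m + s) with hv
  have hm0 : (0 : ℝ) < 2 ^ m := by positivity
  have hbox : ∀ y, latticeNorm (y - z) ≤ ρ * 2 ^ m → y - v ∈ dyadicBox d (m + s + 1) := by
    intro y hy
    rw [mem_dyadicBox]
    intro i
    have h4 := (abs_le_latticeNorm (y - z) i).trans hy
    have h5 : ρ * 2 ^ m < (2 : ℝ) ^ (m + s) := by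
      rw [pow_add, mul_comm]; gcongr
    have h6 := abs_lt.1 (h4.trans_lt h5)
    have h7 : -(2 : ℤ) ^ (m + s) < (y - z) i ∧ (y - z) i < 2 ^ (m + s) := by exact_mod_cast h6
    have h8 : (y - v) i = (y - z) i + 2 ^ (m + s) := by simp [hv]; ring
    rw [h8, pow_succ]
    constructor <;> linarith [h7.1, h7.2]
  refine ⟨X, v, h1, h2, hbox, fun Ω _ P _ R C' hR K hK => ?_⟩
  rcases K.eq_empty_or_nonempty with rfl | ⟨y, hy⟩
  · simp
  have hfin : K.Finite := by
    refine ((dyadicBox d (m + s + 1)).finite_toSet.preimage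
      (sub_left_injective (b := v)).injOn).subset fun y hy => hbox y (hK hy)
  obtain ⟨K, rfl⟩ := hfin.exists_finset_coe
  have hyK := hK hy
  simp only [Set.mem_ofPred_eq] at hyK
  have hylow : 4 * ρ * 2 ^ m ≤ latticeNorm y := by
    have h4 : latticeNorm (y - (y - z)) ≤ latticeNorm y + latticeNorm (y - z) :=
      latticeNorm_sub_le _ _
    rw [sub_sub_cancel] at h4
    linarith
  have hyup : latticeNorm y ≤ (L + ρ) * 2 ^ m := by
    have h4 : latticeNorm (y - z + z) ≤ latticeNorm (y - z) + latticeNorm z :=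
      latticeNorm_add_le _ _
    rw [sub_add_cancel] at h4
    linarith
  have hy0 : 0 < latticeNorm y := lt_of_lt_of_le (by positivity) hylow
  have hyne : y ≠ 0 := by
    rintro rfl
    exact hy0.ne' latticeNorm_zero
  have hlow := (hR.bounds hy hyne (r := 2 * (ρ * 2 ^ m)) (by positivity) (fun u hu w hw => by
    have hu' := hK hu
    have hw' := hK hw
    simp only [Set.mem_ofPred_eq] at hu' hw'
    have h4 : latticeNorm (u - z - (w - z)) ≤ latticeNorm (u - z) + latticeNorm (w - z) :=
      latticeNorm_sub_le _ _
    rw [sub_sub_sub_cancel_right] at h4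
    linarith) (by linarith)).1
  have hcap := newtonCap_nonneg α K
  have hset : {ω | (X.shift v ω ∩ (K : Set (Fin d → ℤ))).Nonempty} =
      {ω | ∃ y ∈ K.image (-v + ·), y ∈ X.set ω} := by
    ext ω
    constructor
    · rintro ⟨w, hw, hwK⟩
      refine ⟨-v + w, Finset.mem_image_of_mem _ hwK, ?_⟩
      rw [neg_add_eq_sub]
      exact hw
    · rintro ⟨_, hu, hw⟩
      obtain ⟨w, hwK, rfl⟩ := Finset.mem_image.1 hu
      rw [neg_add_eq_sub] at hw
      exact ⟨w, hw, hwK⟩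
  have hhit := h3 (K.image (-v + ·)) (by
    intro u hu
    obtain ⟨w, hw, rfl⟩ := Finset.mem_image.1 hu
    rw [neg_add_eq_sub]
    exact hbox w (hK hw))
  rw [newtonCap_image_add] at hhit
  rw [hset, ← ofReal_measureReal, ← ofReal_measureReal (μ := P),
    ← ENNReal.ofReal_mul (by positivity)]
  refine ENNReal.ofReal_le_ofReal (hhit.trans ?_)
  set pr := P.real {ω | (R ω ∩ (K : Set (Fin d → ℤ))).Nonempty} with hpr
  have h5 : ((2 : ℝ) ^ (m + s + 1)) ^ (-α) ≤ (2 ^ m) ^ (-α) := by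
    refine Real.rpow_le_rpow_of_nonpos hm0 ?_ (by linarith)
    exact pow_le_pow_right₀ (by norm_num) (by omega)
  have h6 : ((L + ρ) * 2 ^ m) ^ (-β) ≤ latticeNorm y ^ (-β) :=
    Real.rpow_le_rpow_of_nonpos hy0 hyup (by linarith)
  have h7 : newtonCap α K ≤ c⁻¹ * ((L + ρ) * 2 ^ m) ^ β * pr := by
    have h8 : c * (((L + ρ) * 2 ^ m) ^ (-β) * newtonCap α K) ≤ pr := le_trans (by gcongr) hlow
    have h9 : (0 : ℝ) < ((L + ρ) * 2 ^ m) ^ β := by positivity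
    rw [Real.rpow_neg (by positivity)] at h8
    calc newtonCap α K = c⁻¹ * ((L + ρ) * 2 ^ m) ^ β *
          (c * ((((L + ρ) * 2 ^ m) ^ β)⁻¹ * newtonCap α K)) := by field_simp
      _ ≤ _ := by gcongr
  calc C * ((2 ^ (m + s + 1)) ^ (-α) * newtonCap α K)
      ≤ C * ((2 ^ m) ^ (-α) * (c⁻¹ * ((L + ρ) * 2 ^ m) ^ β * pr)) := by gcongr
    _ = _ := by
        rw [Real.mul_rpow (by positivity) (by positivity), sub_eq_add_neg β α,
          Real.rpow_add hm0]
        ring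

end LocalPercolation

/-! ### The lower bound. -/

section LowerBound

/-- The lower bound for the probability that a sum of at least two independent random sets
meets `x + A`. -/
theorem exists_le_sum_hit (d : ℕ) (k : ℕ) (hk : 1 ≤ k) (α β : Fin (k + 1) → ℝ)
    (hα : ∀ i, 0 < α i ∧ α i < d) (hβ : ∀ i, 0 < β i ∧ β i < d)
    (hαsum : (k : ℝ) * d < ∑ i, α i) (hβsum : (k : ℝ) * d < ∑ i, β i) (c : ℝ) (hc : 0 < c) :
    ∃ c' : ℝ, 0 < c' ∧ ∀ (Ω : Type u) [MeasurableSpace Ω] (P : Measure Ω) [IsProbabilityMeasure P]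
      (R : Fin (k + 1) → Ω → Set (Fin d → ℤ)) (C : ℝ), (∀ i, Measurable (R i)) → iIndepFun R P →
      (∀ i, HasCapacityHitting P (R i) (α i) (β i) c C) →
      ∀ (A : Finset (Fin d → ℤ)) (x : Fin d → ℤ), 0 ∈ A → x ≠ 0 →
        2 * latticeDiam A ≤ latticeNorm x →
        c' * (latticeNorm x ^ ((k : ℝ) * d - ∑ i, β i) * newtonCap (∑ i, α i - k * d) A) ≤
          P.real {ω | ∃ y : Fin (k + 1) → Fin d → ℤ, (∃ b ∈ A, ∑ i, y i = x + b) ∧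
            ∀ i, y i ∈ R i ω} := by
  have hk1 : (1 : ℝ) ≤ k := by exact_mod_cast hk
  -- A radius ρ 2^m accommodates a ∈ A, of norm at most diam(A) ≤ |x| / 2 < 2^m, together with k
  -- displacements of norm at most √d 2^m.
  set ρ : ℝ := 1 + k * Real.sqrt d with hρ
  have hsd := Real.sqrt_nonneg (d : ℝ)
  have hρ1 : 1 ≤ ρ := by rw [hρ]; nlinarith
  have hρd : Real.sqrt d ≤ ρ := by rw [hρ]; nlinarith
  obtain ⟨s, hs⟩ := pow_unbounded_of_one_lt ρ (one_lt_two : (1 : ℝ) < 2)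
  obtain ⟨M, hM⟩ := exists_nat_ge (1 + 5 * ρ)
  have hM1 : (1 : ℝ) ≤ M := by linarith
  set L : ℝ := 2 * (k * M + 1) with hL
  choose B C₁ hB hC₁ hdom using fun i => exists_percolation_domination.{u} d (α i) (β i) c
    (hα i).1 (hβ i).1 hc ρ L (by linarith) (by positivity) s hs
  obtain ⟨C₂, hC₂, hsec⟩ := exists_newtonCap_le_measureReal_pi d k α hα hαsum C₁ hC₁
  set e : ℝ := (k : ℝ) * d - ∑ i, β i with he
  have he0 : e < 0 := by linarith
  set κ : ℝ := ∏ i, ((2 : ℝ) ^ (s + 1)) ^ (-α i) with hκ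
  have hκ0 : 0 < κ := Finset.prod_pos fun i _ => by positivity
  have hB0 : 0 < ∏ i, B i := Finset.prod_pos fun i _ => hB i
  refine ⟨κ / (C₂ * ∏ i, B i), by positivity, fun Ω _ P _ R C hRm hind hR A x hA hx hdiam => ?_⟩
  set T := latticeNorm x with hT
  have hT1 : 1 ≤ T := one_le_latticeNorm hx
  set m := Nat.log 2 ⌊T⌋₊ with hm
  have hmT : (2 : ℝ) ^ m ≤ T := two_pow_log_floor_le hT1
  have hTm : T < 2 ^ m * 2 := by rw [← pow_succ]; exact lt_two_pow_log_floor T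
  have hm0 : (0 : ℝ) < 2 ^ m := by positivity
  -- The centres add up to x, and since k ≥ 1 all have norm at least (M - 1) |x| ≥ 5ρ |x|. Taking
  -- multiples of x avoids any choice of direction.
  set z : Fin (k + 1) → Fin d → ℤ := Fin.cons ((1 - k * M : ℤ) • x) fun _ => (M : ℤ) • x with hz
  have hznorm : ∀ i, ((M : ℝ) - 1) * T ≤ latticeNorm (z i) ∧ latticeNorm (z i) ≤ (k * M + 1) * T := by
    intro i
    refine Fin.cases ?_ (fun i => ?_) i
    · simp only [hz, Fin.cons_zero]
      rw [latticeNorm_smul]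
      push_cast
      have h1 : (M : ℝ) ≤ k * M := by nlinarith
      rw [abs_sub_comm, abs_of_nonneg (by linarith)]
      constructor <;> gcongr
      linarith
    · simp only [hz, Fin.cons_succ]
      rw [latticeNorm_smul]
      push_cast
      rw [abs_of_nonneg (by positivity)]
      have h1 : (M : ℝ) ≤ k * M := by nlinarith
      constructor <;> gcongr <;> linarith
  choose X v h1 h2 hbox hdom' using fun i => hdom i m (z i)
    (by
      refine le_trans ?_ (hznorm i).1
      gcongr
      linarith)
    (by
      refine (hznorm i).2.trans ?_
      rw [hL]
      nlinarith [show (0 : ℝ) ≤ k * M + 1 by positivity])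
  set G : Set (Fin (k + 1) → Fin d → ℤ) := {y | (∃ b ∈ A, ∑ i, y i = x + b) ∧
    ∀ i, latticeNorm (y i - z i) ≤ ρ * 2 ^ m} with hG
  have hsec' := hsec m (m + s + 1) X h1 h2 v z A G (fun y hy i => hbox i _ (hy.2 i)) (by
    intro a ha u hu
    rw [Fintype.mem_piFinset] at hu
    have hu' : ∀ i, latticeNorm (u i) ≤ Real.sqrt d * 2 ^ m := by
      intro i
      refine latticeNorm_le_of_abs_le hm0.le fun l => ?_
      have h3 := mem_dyadicBox.1 (hu i) l
      have h4 : (0 : ℝ) ≤ u i l ∧ (u i l : ℝ) < 2 ^ m := by exact_mod_cast h3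
      rw [abs_of_nonneg h4.1]
      exact h4.2.le
    refine ⟨⟨a, ha, ?_⟩, fun i => ?_⟩
    · rw [Fin.sum_univ_succ]
      simp only [Fin.cons_zero, Fin.cons_succ, hz, Finset.sum_add_distrib, Finset.sum_const,
        Finset.card_univ, Fintype.card_fin]
      rw [← natCast_zsmul, smul_smul, sub_smul, one_smul]
      abel
    · refine Fin.cases ?_ (fun i => ?_) i
      · simp only [Fin.cons_zero]
        rw [add_sub_assoc, add_sub_cancel_left]
        have h3 := latticeNorm_sub_le_diam ha hA
        rw [sub_zero] at h3
        have h4 : latticeNorm (∑ i, u i) ≤ k * (Real.sqrt d * 2 ^ m) := by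
          refine (latticeNorm_sum_le _ _).trans ((Finset.sum_le_sum fun i _ => hu' i).trans ?_)
          simp
        have h5 := latticeNorm_sub_le a (∑ i, u i)
        rw [hρ]
        linarith
      · simp only [Fin.cons_succ]
        rw [add_sub_cancel_left]
        exact (hu' i).trans (by gcongr))
  have hprob : ∀ i, IsProbabilityMeasure (P.map (R i)) := fun i =>
    Measure.isProbabilityMeasure_map (hRm i).aemeasurable
  have hmeas : ∀ v : Fin d → ℤ, MeasurableSet {S : Set (Fin d → ℤ) | v ∈ S} := fun v =>
    measurableSet_setOfPred.2 (measurable_set_mem v)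
  have hrepl := measure_pi_exists_mem_le (fun i => (X i).law) (fun i => P.map (R i))
    (fun i => (X i).shift (v i)) (fun i y => (X i).measurableSet_mem_shift (v i) y)
    (fun _ S => S) (fun _ => hmeas)
    (fun i => {y | latticeNorm (y - z i) ≤ ρ * 2 ^ m})
    (fun i => ENNReal.ofReal (B i * (2 ^ m) ^ (β i - α i)))
    (fun i K hK => by
      rw [Measure.map_apply (hRm i) (measurableSet_inter_nonempty (fun S => S) hmeas K)]
      exact hdom' i Ω P (R i) C (hR i) K hK) G (fun y hy i => hy.2 i)
  rw [← measure_exists_mem_eq_pi P R hRm hind G,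
    ← ENNReal.ofReal_prod_of_nonneg (fun i _ => by have := hB i; positivity)] at hrepl
  have hprod0 : 0 ≤ ∏ i, (B i * ((2 : ℝ) ^ m) ^ (β i - α i)) :=
    Finset.prod_nonneg fun i _ => by have := hB i; positivity
  have hrepl' : (Measure.pi fun i => (X i).law).real
      {ω | ∃ y ∈ G, ∀ i, y i ∈ (X i).shift (v i) (ω i)} ≤
      (∏ i, (B i * (2 ^ m) ^ (β i - α i))) * P.real {ω | ∃ y ∈ G, ∀ i, y i ∈ R i ω} := by
    have := ENNReal.toReal_mono (by finiteness) hrepl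
    rwa [ENNReal.toReal_mul, ENNReal.toReal_ofReal hprod0] at this
  have hmono : P.real {ω | ∃ y ∈ G, ∀ i, y i ∈ R i ω} ≤
      P.real {ω | ∃ y : Fin (k + 1) → Fin d → ℤ, (∃ b ∈ A, ∑ i, y i = x + b) ∧
            ∀ i, y i ∈ R i ω} :=
    measureReal_mono (fun ω ⟨y, hy, hyR⟩ => ⟨y, hy.1, hyR⟩)
  set cap := newtonCap (∑ i, α i - k * d) A with hcap
  have hcap0 : 0 ≤ cap := newtonCap_nonneg _ _
  set pr := P.real {ω | ∃ y : Fin (k + 1) → Fin d → ℤ, (∃ b ∈ A, ∑ i, y i = x + b) ∧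
            ∀ i, y i ∈ R i ω} with hpr
  have hall : ((2 ^ m) ^ d) ^ k * (∏ i, ((2 : ℝ) ^ (m + s + 1)) ^ (-α i)) * cap ≤
      C₂ * ((∏ i, (B i * (2 ^ m) ^ (β i - α i))) * pr) := by
    refine hsec'.trans ?_
    gcongr
    exact hrepl'.trans (by gcongr)
  have hp1 : ∏ i, ((2 : ℝ) ^ (m + s + 1)) ^ (-α i) = (2 ^ m) ^ (-∑ i, α i) * κ := by
    rw [hκ, ← Finset.sum_neg_distrib, Real.rpow_sum_of_pos hm0, ← Finset.prod_mul_distrib]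
    refine Finset.prod_congr rfl fun i _ => ?_
    rw [← Real.mul_rpow (by positivity) (by positivity), ← pow_add, add_assoc]
  have hp2 : ∏ i, (B i * ((2 : ℝ) ^ m) ^ (β i - α i)) =
      (∏ i, B i) * ((2 ^ m) ^ (-∑ i, α i) * (2 ^ m) ^ (∑ i, β i)) := by
    rw [Finset.prod_mul_distrib, ← Real.rpow_sum_of_pos hm0, ← Real.rpow_add hm0,
      Finset.sum_sub_distrib]
    congr 2
    ring
  have hp3 : (((2 : ℝ) ^ m) ^ d) ^ k = (2 ^ m) ^ ((k : ℝ) * d) := by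
    rw [← pow_mul, ← Real.rpow_natCast]
    congr 1
    push_cast
    ring
  have hp4 : T ^ e ≤ (2 ^ m) ^ e := Real.rpow_le_rpow_of_nonpos hm0 hmT he0.le
  rw [hp1, hp2, hp3] at hall
  have hα0 : (0 : ℝ) < (2 ^ m) ^ (-∑ i, α i) := by positivity
  have hβ0 : (0 : ℝ) < (2 ^ m) ^ (∑ i, β i) := by positivity
  -- The powers 2^(-m ∑ α i) on both sides cancel: percolation density on one, replacement factors
  -- on the other.
  have hfin : κ * ((2 ^ m) ^ e * cap) ≤ C₂ * (∏ i, B i) * pr := by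
    rw [he, Real.rpow_sub hm0]
    rw [div_mul_eq_mul_div, mul_div_assoc', div_le_iff₀ hβ0]
    refine le_of_mul_le_mul_left ?_ hα0
    linarith
  rw [div_mul_eq_mul_div, div_le_iff₀ (by positivity)]
  calc κ * (T ^ e * cap) ≤ κ * ((2 ^ m) ^ e * cap) := by gcongr
    _ ≤ _ := hfin
    _ = _ := by ring

end LowerBound

/-! ### Assembly of the two bounds. -/

lemma hitProb_sum_eq {d k : ℕ} {Ω : Type*} [MeasurableSpace Ω] (P : Measure Ω)
    (R : Fin k → Ω → Set (Fin d → ℤ)) (x : Fin d → ℤ) (A : Finset (Fin d → ℤ)) :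
    hitProb P (fun ω => ∑ i, R i ω) x A =
      P.real {ω | ∃ y : Fin k → Fin d → ℤ, (∃ b ∈ A, ∑ i, y i = x + b) ∧ ∀ i, y i ∈ R i ω} := by
  rw [hitProb]
  congr 1
  ext ω
  simp only [Set.mem_ofPred_eq]
  constructor
  · rintro ⟨w, hw, b, hb, rfl⟩
    obtain ⟨y, hy, hsum⟩ := Set.mem_fintype_sum _ _ |>.1 hw
    exact ⟨y, ⟨b, hb, hsum⟩, hy⟩
  · rintro ⟨y, ⟨b, hb, hsum⟩, hy⟩
    exact ⟨x + b, Set.mem_fintype_sum _ _ |>.2 ⟨y, hy, hsum⟩, b, hb, rfl⟩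

theorem theorem1 (d k : ℕ) (hd : 1 ≤ d) (hk : 1 ≤ k) (α β : Fin k → ℝ)
    (hα : ∀ i, 0 < α i ∧ α i < d) (hβ : ∀ i, 0 < β i ∧ β i < d)
    (hαsum : ((k : ℝ) - 1) * d < ∑ i, α i) (hβsum : ((k : ℝ) - 1) * d < ∑ i, β i)
    (c C : ℝ) (hc : 0 < c) (hC : 0 < C) :
    ∃ c' C' : ℝ, 0 < c' ∧ 0 < C' ∧
      ∀ (Ω : Type*) [MeasurableSpace Ω] (P : Measure Ω) [IsProbabilityMeasure P]
        (R : Fin k → Ω → Set (Fin d → ℤ)),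
        (∀ i, Measurable (R i)) → iIndepFun R P →
        (∀ i, HasCapacityHitting P (R i) (α i) (β i) c C) →
        ∀ (A : Finset (Fin d → ℤ)) (x : Fin d → ℤ), 0 ∈ A → x ≠ 0 →
          2 * latticeDiam A +
              (⨆ i, if α i ≤ β i then
                latticeDiam A ^ (((d : ℝ) - α i) / ((d : ℝ) - β i)) *
                  Real.log (latticeDiam A + 1) ^ (1 / ((d : ℝ) - β i))
                else 0) ≤ latticeNorm x →
          c' * (latticeNorm x ^ (((k : ℝ) - 1) * d - ∑ i, β i) *
              newtonCap ((∑ i, α i) - ((k : ℝ) - 1) * d) A)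
            ≤ hitProb P (fun ω => ∑ i, R i ω) x A ∧
          hitProb P (fun ω => ∑ i, R i ω) x A
            ≤ C' * (latticeNorm x ^ (((k : ℝ) - 1) * d - ∑ i, β i) *
              newtonCap ((∑ i, α i) - ((k : ℝ) - 1) * d) A) := by
  obtain ⟨k, rfl⟩ : ∃ l, k = l + 1 := ⟨k - 1, by omega⟩
  have hcast : ((k + 1 : ℕ) : ℝ) - 1 = k := by push_cast; ring
  rw [hcast] at hαsum hβsum
  simp only [hcast, hitProb_sum_eq]
  obtain ⟨C', hC', hupper⟩ := exists_sum_hit_le d hd k α β hα hβ hβsum c C hC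
  obtain ⟨c', hc', hlower⟩ : ∃ c' : ℝ, 0 < c' ∧ ∀ (Ω : Type _) [MeasurableSpace Ω] (P : Measure Ω)
      [IsProbabilityMeasure P] (R : Fin (k + 1) → Ω → Set (Fin d → ℤ)) (C : ℝ),
      (∀ i, Measurable (R i)) → iIndepFun R P →
      (∀ i, HasCapacityHitting P (R i) (α i) (β i) c C) →
      ∀ (A : Finset (Fin d → ℤ)) (x : Fin d → ℤ), 0 ∈ A → x ≠ 0 →
        2 * latticeDiam A ≤ latticeNorm x →
        c' * (latticeNorm x ^ ((k : ℝ) * d - ∑ i, β i) * newtonCap (∑ i, α i - k * d) A) ≤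
          P.real {ω | ∃ y : Fin (k + 1) → Fin d → ℤ, (∃ b ∈ A, ∑ i, y i = x + b) ∧
            ∀ i, y i ∈ R i ω} := by
    -- For a single set the lower bound is the hypothesis itself. The localisation around the
    -- centres z needs at least two summands, since one centre would have to be x.
    rcases Nat.eq_zero_or_pos k with rfl | hk
    · refine ⟨c, hc, fun Ω _ P _ R C _ _ hR A x hA hx hdiam => ?_⟩
      have := (hR 0 A x hA hx hdiam).1
      rw [← hitProb_sum_eq]
      simpa using this
    · exact exists_le_sum_hit d k hk α β hα hβ hαsum hβsum c hc
  refine ⟨c', C', hc', hC', fun Ω _ P _ R hRm hind hR A x hA hx hdist => ?_⟩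
  have hD := latticeDiam_nonneg A
  set f : Fin (k + 1) → ℝ := fun i => if α i ≤ β i then
    latticeDiam A ^ (((d : ℝ) - α i) / ((d : ℝ) - β i)) *
      Real.log (latticeDiam A + 1) ^ (1 / ((d : ℝ) - β i)) else 0 with hf
  have hf0 : ∀ i, 0 ≤ f i := by
    intro i
    have hlog : 0 ≤ Real.log (latticeDiam A + 1) := Real.log_nonneg (by linarith)
    simp only [hf]
    split_ifs <;> positivity
  have hsup : ∀ i, f i ≤ ⨆ i, f i := le_ciSup (Set.finite_range f).bddAbove
  have hdiam : 2 * latticeDiam A ≤ latticeNorm x := by linarith [hf0 0, hsup 0]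
  refine ⟨hlower Ω P R C hRm hind hR A x hA hx hdiam,
    hupper Ω P R hRm hind hR A x hA hx hdiam fun i hi => ?_⟩
  have h := hsup i
  simp only [hf, if_pos hi] at h
  linarith
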